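/- Let $(M,g)$ be a complete Riemannian manifold (smooth, second countable, without boundary), let $\varphi:M\to\mathbb R$ be smooth, and put $d\mu=e^{-\varphi}\,dV_g$. Let $p>1$ and $q>0$ satisfy $\delta:=q(p-1)-1\ge 0$, let $-\infty\le a<b\le+\infty$, and let $C:[a,b]\to[0,\infty)$ be smooth; here $[a,b]$ means the set of real $t$ with $a\le t\le b$. For real $r$ write $r^q:=|r|^{q-1}r$. Denote by $\mathcal L_{p,\varphi}v=e^{\varphi}\operatorname{div}(e^{-\varphi}|\nabla v|^{p-2}\nabla v)$ the weighted $p$-Laplacian in the sense of distributions, by $W^{1,r}_{\varphi}(M)$ the space of $u\in L^r(\mu)$ whose weak gradient is in $L^r(\mu)$, and by $W^{1,r}_{0;\varphi}(M)$ the closure of $C_c^\infty(M)$ in it. Let $u$ be a real-valued function on $M\times[a,b]$ such that for each $t\in[a,b]$ $$u(\cdot,t),\ u_t(\cdot,t)\in W^{1,q+1}_{0;\varphi}(M),\qquad \nabla (u^q)(\cdot,t)\in L^p(\mu).$$ Here $t\mapsto u(\cdot,t)$ is a $C^1$ curve in $L^{q+1}(\mu)$ with derivative $u_t$ (one-sided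 at the endpoints); if $0<q<1$, suppose moreover that $t\mapsto u^q(\cdot,t)$ is a differentiable curve in $L^{(q+1)/q}(\mu)$. Suppose that for each $t\in[a,b]$ the distribution $\mathcal L_{p,\varphi}u^q$ is a locally integrable function and, almost everywhere on $M$, $$\bigl|\partial_t u-\mathcal L_{p,\varphi}u^q\bigr|\le\begin{cases}C(t)\bigl(|u|+|\nabla u^q|^{p/(q+1)}\bigr)&\text{if }q\ge 1,\\ C(t)\bigl(|u|+|u|^{1/2}|\nabla u^q|^{p/(2q+2)}\bigr)&\text{if }0<q<1.\end{cases}$$ Set $$I(t)=\int_M|u|^{q+1}\,d\mu,\qquad D(t)=-\int_M|\nabla u^q|^p\,d\mu,\qquad N(t)=\frac{D(t)}{I(t)}.$$ Then at every $t\in[a,b]$ with $I(t)>0$ the functions $\log I$ and $N$ are differentiable (one-sidedly at the endpoints), and $$\frac{d}{dt}\log I(t)\ \ge\ \bigl(q+1+C(t)\bigr)N(t)-\bigl(2q+\tfrac32\bigr)C(t),$$ $$\frac{d}{dt}N(t)\ \ge\ \frac{pq}{q+1}\,C(t)^2\bigl(N(t)-q-\tfrac12\bigr).$$ -/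

import Mathlib

open MeasureTheory Filter Topology Set Bundle
open scoped Manifold ContDiff ENNReal Bundle

noncomputable section

namespace ParabolicFrequency

/-- The Euclidean space on which `n`-dimensional manifolds are modelled. -/
abbrev Euc (n : ℕ) : Type := EuclideanSpace ℝ (Fin n)

/-- The odd power `r ^ q := |r| ^ (q - 1) * r` of a real number of arbitrary sign. -/
def spow (r q : ℝ) : ℝ := |r| ^ (q - 1) * r

/-- The real times of the closed interval `[a, b]`, where `a = -∞` and `b = +∞` are allowed. -/
def timeInterval (a b : EReal) : Set ℝ := {t : ℝ | a ≤ (t : EReal) ∧ (t : EReal) ≤ b}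

section Geometry

variable {n : ℕ} {M : Type*} [TopologicalSpace M] [ChartedSpace (Euc n) M]

/-- The coordinate vector field of the chart at `x₀` in the constant direction `w`, at the point
with coordinates `y`: the image of `w` under the differential of the inverse chart. -/
def coordVector (x₀ : M) (y : Euc n) (w : Euc n) :
    TangentSpace 𝓘(ℝ, Euc n) ((chartAt (Euc n) x₀).symm y) :=
  mfderiv 𝓘(ℝ, Euc n) 𝓘(ℝ, Euc n) (chartAt (Euc n) x₀).symm y w

/-- The derivative `dη(X) = ⟨∇η, X⟩` of a function `η` on `M` along the tangent vector `X`. -/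
def dirDeriv (η : M → ℝ) (x : M) (X : TangentSpace 𝓘(ℝ, Euc n) x) : ℝ :=
  mfderiv 𝓘(ℝ, Euc n) 𝓘(ℝ, ℝ) η x X

variable [RiemannianBundle (fun x : M ↦ TangentSpace 𝓘(ℝ, Euc n) x)]

/-- The matrix `g_ij` of the Riemannian metric in the chart at `x₀`. -/
def gramMatrix (x₀ : M) (y : Euc n) : Matrix (Fin n) (Fin n) ℝ :=
  Matrix.of fun i j ↦ inner ℝ
    (coordVector x₀ y (EuclideanSpace.single i 1)) (coordVector x₀ y (EuclideanSpace.single j 1))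

variable [MeasurableSpace M]

/-- The Riemannian volume of the domain of the chart at `x₀`, extended by zero to `M`: the measure
`√(det g_ij) dy` of the coordinate domain, transported to the manifold. -/
def chartVolume (x₀ : M) : Measure M :=
  Measure.map (chartAt (Euc n) x₀).symm
    ((volume.restrict (chartAt (Euc n) x₀).target).withDensity
      fun y ↦ ENNReal.ofReal (Real.sqrt (gramMatrix x₀ y).det))

variable (n M) in
/-- The Riemannian volume measure `dV_g`: the least measure which dominates `√(det g_ij) dy` in
every chart. As these local measures agree on overlaps, it restricts to each of them. -/
def riemannianVolume : Measure M := ⨆ x₀ : M, chartVolume (n := n) x₀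

variable (n) in
/-- The weighted measure `e^{-φ} dV_g`. -/
def weightedVolume (φ : M → ℝ) : Measure M :=
  (riemannianVolume n M).withDensity fun x ↦ ENNReal.ofReal (Real.exp (-φ x))

/-- `G` is the weak gradient of `u`: in every chart, the functions `⟨G, ∂_w⟩` are the weak
directional derivatives of `u`, in the sense of test functions on the coordinate domain. -/
def IsWeakGradient (u : M → ℝ) (G : ∀ x : M, TangentSpace 𝓘(ℝ, Euc n) x) : Prop :=
  ∀ x₀ : M,
    LocallyIntegrableOn (fun y ↦ u ((chartAt (Euc n) x₀).symm y)) (chartAt (Euc n) x₀).target ∧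
    ∀ w : Euc n,
      LocallyIntegrableOn
        (fun y ↦ inner ℝ (G ((chartAt (Euc n) x₀).symm y)) (coordVector x₀ y w))
        (chartAt (Euc n) x₀).target ∧
      ∀ ψ : Euc n → ℝ, ContDiff ℝ ∞ ψ → HasCompactSupport ψ →
        tsupport ψ ⊆ (chartAt (Euc n) x₀).target →
        ∫ y in (chartAt (Euc n) x₀).target, u ((chartAt (Euc n) x₀).symm y) * fderiv ℝ ψ y w =
          -∫ y in (chartAt (Euc n) x₀).target,
            inner ℝ (G ((chartAt (Euc n) x₀).symm y)) (coordVector x₀ y w) * ψ y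

variable (n) in
/-- Smooth, compactly supported functions on `M`. -/
def IsTestFunction (η : M → ℝ) : Prop :=
  ContMDiff 𝓘(ℝ, Euc n) 𝓘(ℝ, ℝ) ∞ η ∧ HasCompactSupport η

variable (n) in
/-- The weighted Sobolev space `W^{1,r}_φ(M)`. -/
def MemSobolev (r : ℝ) (φ : M → ℝ) (u : M → ℝ) : Prop :=
  MemLp u (ENNReal.ofReal r) (weightedVolume n φ) ∧
    ∃ G : ∀ x : M, TangentSpace 𝓘(ℝ, Euc n) x, IsWeakGradient u G ∧
      MemLp (fun x ↦ ‖G x‖) (ENNReal.ofReal r) (weightedVolume n φ)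

variable (n) in
/-- The space `W^{1,r}_{0;φ}(M)`: the closure of the test functions in `W^{1,r}_φ(M)`. -/
def MemSobolevZero (r : ℝ) (φ : M → ℝ) (u : M → ℝ) : Prop :=
  MemSobolev n r φ u ∧ ∀ ε : ℝ≥0∞, 0 < ε → ∃ η : M → ℝ, IsTestFunction n η ∧
    eLpNorm (fun x ↦ u x - η x) (ENNReal.ofReal r) (weightedVolume n φ) < ε ∧
    ∃ H : ∀ x : M, TangentSpace 𝓘(ℝ, Euc n) x, IsWeakGradient (fun x ↦ u x - η x) H ∧
      eLpNorm (fun x ↦ ‖H x‖) (ENNReal.ofReal r) (weightedVolume n φ) < ε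

/-- `f` is the weighted `p`-Laplacian `e^φ div (e^{-φ} |V|^{p-2} V)` of a function with weak
gradient `V`, in the sense of distributions. -/
def IsWeakPLaplacian (p : ℝ) (φ : M → ℝ) (V : ∀ x : M, TangentSpace 𝓘(ℝ, Euc n) x)
    (f : M → ℝ) : Prop :=
  LocallyIntegrable f (weightedVolume n φ) ∧
    ∀ η : M → ℝ, IsTestFunction n η →
      ∫ x, f x * η x ∂(weightedVolume n φ) =
        -∫ x, ‖V x‖ ^ (p - 2) * dirDeriv η x (V x)
          ∂(weightedVolume n φ)

variable (n) in
/-- `I = ∫ |u|^{q+1} e^{-φ} dV_g`. -/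
def energyI (q : ℝ) (φ : M → ℝ) (u : M → ℝ) : ℝ :=
  ∫ x, |u x| ^ (q + 1) ∂(weightedVolume n φ)

/-- `D = -∫ |V|^p e^{-φ} dV_g`, where `V` is the weak gradient of `u^q`. -/
def energyD (p : ℝ) (φ : M → ℝ) (V : ∀ x : M, TangentSpace 𝓘(ℝ, Euc n) x) : ℝ :=
  -∫ x, ‖V x‖ ^ p ∂(weightedVolume n φ)

/-- The parabolic frequency `N = D / I`. -/
def frequency (p q : ℝ) (φ : M → ℝ) (u : M → ℝ)
    (V : ∀ x : M, TangentSpace 𝓘(ℝ, Euc n) x) : ℝ :=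
  energyD p φ V / energyI n q φ u

end Geometry

/-- The curve `t ↦ u t` in `L^r(μ)` has the derivative `w` at the time `t`, within the set `T` of
times, in the norm of `L^r(μ)`. -/
def HasLpDerivWithinAt {M : Type*} [MeasurableSpace M] (r : ℝ) (μ : Measure M)
    (u : ℝ → M → ℝ) (w : M → ℝ) (T : Set ℝ) (t : ℝ) : Prop :=
  (∀ s ∈ T, MemLp (u s) (ENNReal.ofReal r) μ) ∧ MemLp w (ENNReal.ofReal r) μ ∧
    Tendsto
      (fun s ↦ eLpNorm (fun x ↦ (u s x - u t x) / (s - t) - w x) (ENNReal.ofReal r) μ)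
      (𝓝[T \ {t}] t) (𝓝 0)

/-- The curve `t ↦ w t`, on the set `T` of times, is continuous for the norm of `L^r(μ)`. -/
def LpContinuousOn {M : Type*} [MeasurableSpace M] (r : ℝ) (μ : Measure M)
    (w : ℝ → M → ℝ) (T : Set ℝ) : Prop :=
  ∀ t ∈ T, Tendsto (fun s ↦ eLpNorm (fun x ↦ w s x - w t x) (ENNReal.ofReal r) μ)
    (𝓝[T] t) (𝓝 0)

/-- The admissible size of the perturbation at a point where `|u| = U` and `|∇u^q| = G`,
at a time where the coefficient equals `c`. -/
def errorBound (p q c U G : ℝ) : ℝ :=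
  if 1 ≤ q then c * (U + G ^ (p / (q + 1)))
  else c * (U + U ^ (1 / 2 : ℝ) * G ^ (p / (2 * q + 2)))

end ParabolicFrequency

end

/-! Write `v = u^q`, let `f` be the weighted `p`-Laplacian of `v`, `e = u_t - f` the error, `k =
|u|^(q-1)` and `X = (u_t + f)/2`. Testing the equation of `f` with `v` gives `D = ∫ f v`; formally
`I' = (q+1) ∫ v u_t` and `D' = p ∫ f ∂_t v = p q ∫ k f u_t`. Inserting `f = X - e/2` and `u_t = X +
e/2`, the numerator of `N'` becomes `D' I - D I' = p q (∫ k X² - ¼ ∫ k e²) I - (q+1) ((∫ k X u)² - ¼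
(∫ k e u)²)`. Since `p q ≥ q + 1`, which is the condition `δ ≥ 0`, the Cauchy-Schwarz inequality
with weight `k` makes the `X`-terms nonnegative. The square of `∫ k e u` has a good sign, and
Young's inequality bounds `∫ k e²` by `I` and `-D`. This is `frequency_deriv_numerator_ge`; the
bound for `log I` is `le_integral_spow_mul`.

Two points need analysis. The first is the differentiability of `D`, as nothing is assumed on the
gradient as a function of time. The energy `∫ |∇v|^p` is convex in `v` with subgradient `-p f`, so
its difference quotients lie between the pairings of `-p f(t)` and of `-p f(s)` with those of `v`.
The differential inequality bounds `f(s)` in `L^(q+1)`, and differentiability of the energy along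
segments yields enough weak convergence of `f(s)` to `f(t)`: see
`hasDerivWithinAt_of_subgradient_of_directional`.

The second is the formula `∫ f(s) v(s') = -∫ |V(s)|^(p-2) ⟨V(s), V(s')⟩`, where `V` is the weak
gradient of `v`, although `f` is defined by smooth compactly supported test functions only: see
`IsWeakPLaplacian.integral_mul_eq`. The function `v` is truncated smoothly, mollified in charts, and
cut off by functions whose gradients tend to zero uniformly. Such cutoffs come from the Hopf-Rinow
theorem and a smoothing of Lipschitz functions. The condition `δ ≥ 0` enters again: it puts the
truncations of `v` into `L^p`, which kills the boundary term.

For `q < 1` the derivative of `v` is given rather than computed. Where `u ≠ 0` it is found by the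
chain rule; where `u = 0`, both `u_t` and `f` vanish almost everywhere. -/

namespace ParabolicFrequency

/-! ### Pointwise estimates of the error by Young's inequality. -/

section ErrorBound

/-- Young's inequality for exponents of fixed sum. A vanishing exponent is allowed, because `s = q -
1` is zero at `q = 1`. -/
lemma rpow_mul_rpow_le_of_add_eq {U b s t m : ℝ} (hU : 0 ≤ U) (hb : 0 ≤ b) (hs : 0 ≤ s)
    (ht : 0 ≤ t) (hm : 0 < m) (h : s + t = m) :
    U ^ s * b ^ t ≤ s / m * U ^ m + t / m * b ^ m := by
  have := Real.geom_mean_le_arith_mean2_weighted (w₁ := s / m) (w₂ := t / m)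
    (p₁ := U ^ m) (p₂ := b ^ m) (by positivity) (by positivity) (by positivity) (by positivity)
    (by rw [← add_div, h, div_self hm.ne'])
  rwa [← Real.rpow_mul hU, ← Real.rpow_mul hb, mul_div_cancel₀ _ hm.ne',
    mul_div_cancel₀ _ hm.ne'] at this

variable {p q c U G : ℝ}

lemma rpow_div_rpow_self (hq : 0 < q) (hG : 0 ≤ G) :
    (G ^ (p / (q + 1))) ^ (q + 1) = G ^ p := by
  rw [← Real.rpow_mul hG, div_mul_cancel₀ _ (by linarith)]

lemma rpow_div_two_mul (hq : 0 < q) (hG : 0 ≤ G) :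
    G ^ (p / (2 * q + 2)) = (G ^ (p / (q + 1))) ^ (1 / 2 : ℝ) := by
  rw [← Real.rpow_mul hG]; congr 1; field_simp

/-- This is one role of the factor `U^(1/2)` in the range `q < 1`: where `u` vanishes the equation
holds exactly. -/
lemma errorBound_zero_of_lt_one (hq1 : q < 1) : errorBound p q c 0 G = 0 := by
  rw [errorBound, if_neg (not_le.2 hq1), Real.zero_rpow (by norm_num)]
  ring

/-- A bound linear in `U` and `G^(p/(q+1))`, common to both ranges of `q`; both quantities come from
functions in `L^(q+1)`. -/
lemma errorBound_le_add (hq : 0 < q) (hc : 0 ≤ c) (hU : 0 ≤ U) (hG : 0 ≤ G) :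
    errorBound p q c U G ≤ c * (2 * U + G ^ (p / (q + 1))) := by
  have hb : 0 ≤ G ^ (p / (q + 1)) := by positivity
  unfold errorBound
  split_ifs
  · gcongr; linarith
  · rw [rpow_div_two_mul hq hG]
    have := rpow_mul_rpow_le_of_add_eq (s := 1 / 2) (t := 1 / 2) (m := 1) hU hb
      (by norm_num) (by norm_num) (by norm_num) (by norm_num)
    rw [Real.rpow_one, Real.rpow_one] at this
    refine mul_le_mul_of_nonneg_left ?_ hc
    linarith

/-- Young's inequality with exponents `q, 1` when `q ≥ 1`, and `q + 1/2, 1/2` when `q < 1`. The two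
constants come from different ranges: the coefficient of `U^(q+1)` is the one for `q < 1`, that of
`G^p` the one for `q ≥ 1`. -/
lemma rpow_mul_errorBound_le (hq : 0 < q) (hc : 0 ≤ c) (hU : 0 ≤ U) (hG : 0 ≤ G) :
    U ^ q * errorBound p q c U G ≤
      c * ((2 * q + 3 / 2) / (q + 1) * U ^ (q + 1) + 1 / (q + 1) * G ^ p) := by
  have hb : 0 ≤ G ^ (p / (q + 1)) := by positivity
  have hU1 : U ^ q * U = U ^ (q + 1) := by rw [Real.rpow_add_one' hU (by linarith)]
  have hUm : 0 ≤ U ^ (q + 1) := by positivity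
  have hGp : 0 ≤ G ^ p := by positivity
  have h1 : 1 / (q + 1) * (q + 1) = 1 := by field_simp
  have h0 : 0 < 1 / (q + 1) := by positivity
  set k := 1 / (q + 1)
  rw [← rpow_div_rpow_self hq hG, ]
  rw [← rpow_div_rpow_self hq hG] at hGp
  unfold errorBound
  split_ifs
  · have := rpow_mul_rpow_le_of_add_eq (s := q) (t := 1) (m := q + 1) hU hb hq.le zero_le_one
      (by linarith) rfl
    rw [Real.rpow_one] at this
    rw [show U ^ q * (c * (U + G ^ (p / (q + 1)))) =
      c * (U ^ q * U + U ^ q * G ^ (p / (q + 1))) by ring, hU1]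
    apply mul_le_mul_of_nonneg_left _ hc
    have e1 : (2 * q + 3 / 2) / (q + 1) = 1 + q / (q + 1) + k / 2 := by
      simp only [k]; field_simp; ring
    rw [e1]
    nlinarith
  · rw [rpow_div_two_mul hq hG]
    have := rpow_mul_rpow_le_of_add_eq (s := q + 1 / 2) (t := 1 / 2) (m := q + 1) hU hb
      (by linarith) (by norm_num) (by linarith) (by ring)
    rw [show U ^ q * (c * (U + U ^ (1 / 2 : ℝ) * (G ^ (p / (q + 1))) ^ (1 / 2 : ℝ))) =
      c * (U ^ q * U + U ^ q * U ^ (1 / 2 : ℝ) * (G ^ (p / (q + 1))) ^ (1 / 2 : ℝ)) by ring, hU1,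
      ← Real.rpow_add_of_nonneg hU hq.le (by norm_num)]
    apply mul_le_mul_of_nonneg_left _ hc
    have e1 : (2 * q + 3 / 2) / (q + 1) = 1 + (q + 1 / 2) / (q + 1) := by
      field_simp; ring
    have e2 : 1 / 2 / (q + 1) = k / 2 := by simp only [k]; field_simp
    rw [e1]
    rw [e2] at this
    nlinarith

lemma rpow_sub_one_mul_sq {U : ℝ} (hq : 0 < q) (hU : 0 ≤ U) :
    U ^ (q - 1) * U ^ 2 = U ^ (q + 1) := by
  rcases hU.eq_or_lt with rfl | h
  · rw [Real.zero_rpow (by linarith : q + 1 ≠ 0)]; simp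
  · rw [← Real.rpow_natCast, ← Real.rpow_add h]; norm_num; ring_nf

lemma rpow_sub_one_mul_self {U : ℝ} (hq : 0 < q) (hU : 0 ≤ U) :
    U ^ (q - 1) * U = U ^ q := by
  rcases hU.eq_or_lt with rfl | h
  · rw [Real.zero_rpow hq.ne']; simp
  · rw [← Real.rpow_add_one h.ne']; ring_nf

/-- After `(U + d)² ≤ 2 (U² + d²)`, the mixed term is `U^(q-1) b²` for `q ≥ 1`, with `b =
G^(p/(q+1))`, and Young's inequality applies as `q - 1 ≥ 0`. For `q < 1` that term would be
uncontrolled near `U = 0`; the geometric mean in the hypothesis turns it into `U^q b`. The constant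
`q + 1/2` is the one for `q < 1`, the full coefficient of `G^p` the one for `q ≥ 1`. -/
lemma rpow_mul_errorBound_sq_le (hq : 0 < q) (hU : 0 ≤ U) (hG : 0 ≤ G) :
    U ^ (q - 1) * errorBound p q c U G ^ 2 ≤
      c ^ 2 * (4 / (q + 1)) * ((q + 1 / 2) * U ^ (q + 1) + G ^ p) := by
  have hb : 0 ≤ G ^ (p / (q + 1)) := by positivity
  have hUm : 0 ≤ U ^ (q + 1) := by positivity
  have hGp : 0 ≤ G ^ p := by positivity
  have hUq : 0 ≤ U ^ (q - 1) := by positivity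
  have hk : 0 < 1 / (q + 1) := by positivity
  have h2 := rpow_sub_one_mul_sq hq hU
  have h1 := rpow_sub_one_mul_self hq hU
  rw [← rpow_div_rpow_self hq hG]
  rw [← rpow_div_rpow_self hq hG] at hGp
  unfold errorBound
  split_ifs with h
  · have := rpow_mul_rpow_le_of_add_eq (s := q - 1) (t := 2) (m := q + 1) hU hb (by linarith)
      zero_le_two (by linarith) (by ring)
    rw [Real.rpow_two] at this
    set b := G ^ (p / (q + 1))
    calc U ^ (q - 1) * (c * (U + b)) ^ 2
        = c ^ 2 * (U ^ (q - 1) * (U + b) ^ 2) := by ring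
      _ ≤ c ^ 2 * (U ^ (q - 1) * (2 * (U ^ 2 + b ^ 2))) := by
        gcongr; nlinarith [sq_nonneg (U - b)]
      _ = c ^ 2 * (2 * (U ^ (q + 1) + U ^ (q - 1) * b ^ 2)) := by rw [← h2]; ring
      _ ≤ c ^ 2 * (2 * (U ^ (q + 1) + ((q - 1) / (q + 1) * U ^ (q + 1) +
            2 / (q + 1) * b ^ (q + 1)))) := by gcongr
      _ = c ^ 2 * ((4 / (q + 1)) * (q * U ^ (q + 1) + b ^ (q + 1))) := by field_simp; ring
      _ ≤ c ^ 2 * ((4 / (q + 1)) * ((q + 1 / 2) * U ^ (q + 1) + b ^ (q + 1))) := by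
        gcongr; linarith
      _ = _ := by ring
  · rw [rpow_div_two_mul hq hG]
    have := rpow_mul_rpow_le_of_add_eq (s := q) (t := 1) (m := q + 1) hU hb hq.le
      zero_le_one (by linarith) (by ring)
    rw [Real.rpow_one] at this
    set b := G ^ (p / (q + 1))
    have hs : (U ^ (1 / 2 : ℝ) * b ^ (1 / 2 : ℝ)) ^ 2 = U * b := by
      rw [mul_pow, ← Real.rpow_natCast, ← Real.rpow_natCast, ← Real.rpow_mul hU,
        ← Real.rpow_mul hb]; norm_num
    set d := U ^ (1 / 2 : ℝ) * b ^ (1 / 2 : ℝ)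
    calc U ^ (q - 1) * (c * (U + d)) ^ 2
        = c ^ 2 * (U ^ (q - 1) * (U + d) ^ 2) := by ring
      _ ≤ c ^ 2 * (U ^ (q - 1) * (2 * (U ^ 2 + d ^ 2))) := by
        gcongr; nlinarith [sq_nonneg (U - d)]
      _ = c ^ 2 * (2 * (U ^ (q - 1) * U ^ 2 + U ^ (q - 1) * U * b)) := by rw [hs]; ring
      _ = c ^ 2 * (2 * (U ^ (q + 1) + U ^ q * b)) := by rw [h2, h1]
      _ ≤ c ^ 2 * (2 * (U ^ (q + 1) + (q / (q + 1) * U ^ (q + 1) +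
            1 / (q + 1) * b ^ (q + 1)))) := by gcongr
      _ = c ^ 2 * ((4 / (q + 1)) * ((q + 1 / 2) * U ^ (q + 1) + b ^ (q + 1) / 2)) := by
        field_simp; ring
      _ ≤ c ^ 2 * ((4 / (q + 1)) * ((q + 1 / 2) * U ^ (q + 1) + b ^ (q + 1))) := by
        gcongr; linarith
      _ = _ := by ring

end ErrorBound

/-! ### Integral inequalities at a fixed time. -/

section Static

variable {α : Type*} [MeasurableSpace α] {μ : Measure α} {p q c : ℝ} {u ut f G : α → ℝ}

lemma memLp_rpow_div (hp : 1 < p) (hq : 0 < q) (hG : MemLp G (ENNReal.ofReal p) μ)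
    (hG0 : ∀ x, 0 ≤ G x) :
    MemLp (fun x ↦ G x ^ (p / (q + 1))) (ENNReal.ofReal (q + 1)) μ := by
  have h := hG.norm_rpow_div (ENNReal.ofReal (p / (q + 1)))
  rw [ENNReal.toReal_ofReal (by positivity), ← ENNReal.ofReal_div_of_pos (by positivity),
    div_div_cancel₀ (by positivity)] at h
  simpa [abs_of_nonneg (hG0 _)] using h

lemma memLp_abs_rpow {r s : ℝ} (hs : 0 < s) (hu : MemLp u (ENNReal.ofReal r) μ) :
    MemLp (fun x ↦ |u x| ^ s) (ENNReal.ofReal (r / s)) μ := by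
  have h := hu.norm_rpow_div (ENNReal.ofReal s)
  rwa [ENNReal.toReal_ofReal hs.le, ← ENNReal.ofReal_div_of_pos hs] at h

lemma integrable_abs_rpow {r : ℝ} (hr : 0 < r) (hu : MemLp u (ENNReal.ofReal r) μ) :
    Integrable (fun x ↦ |u x| ^ r) μ := by
  have := memLp_abs_rpow hr hu
  rwa [div_self hr.ne', ENNReal.ofReal_one, memLp_one_iff_integrable] at this

/-- The `p`-Laplacian, known to be locally integrable only, gains global integrability from the
differential inequality. Its pairings with functions in `L^((q+1)/q)`, such as `u^q`, then make
sense. -/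
lemma memLp_of_abs_sub_le_errorBound (hp : 1 < p) (hq : 0 < q) (hc : 0 ≤ c)
    (hu : MemLp u (ENNReal.ofReal (q + 1)) μ) (hut : MemLp ut (ENNReal.ofReal (q + 1)) μ)
    (hf : AEStronglyMeasurable f μ) (hG : MemLp G (ENNReal.ofReal p) μ) (hG0 : ∀ x, 0 ≤ G x)
    (hE : ∀ᵐ x ∂μ, |ut x - f x| ≤ errorBound p q c |u x| (G x)) :
    MemLp f (ENNReal.ofReal (q + 1)) μ := by
  have h1 : MemLp (fun x ↦ c * (2 * |u x| + G x ^ (p / (q + 1)))) (ENNReal.ofReal (q + 1)) μ :=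
    ((hu.abs.const_mul 2).add (memLp_rpow_div hp hq hG hG0)).const_mul c
  have h2 : MemLp (fun x ↦ ut x - f x) (ENNReal.ofReal (q + 1)) μ := by
    refine h1.mono (hut.1.sub hf) ?_
    filter_upwards [hE] with x hx
    exact (hx.trans (errorBound_le_add hq hc (abs_nonneg _) (hG0 x))).trans (le_abs_self _)
  have := hut.sub h2
  refine this.ae_eq ?_
  filter_upwards with x
  simp

lemma abs_spow (hq : 0 < q) (a : ℝ) : |spow a q| = |a| ^ q := by
  rw [spow, abs_mul, abs_of_nonneg (by positivity), rpow_sub_one_mul_self hq (abs_nonneg a)]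

lemma measurable_spow : Measurable fun a : ℝ ↦ spow a q := by
  unfold spow; fun_prop

lemma memLp_spow (hq : 0 < q) (hu : MemLp u (ENNReal.ofReal (q + 1)) μ) :
    MemLp (fun x ↦ spow (u x) q) (ENNReal.ofReal ((q + 1) / q)) μ := by
  refine (memLp_abs_rpow hq hu).mono
    (measurable_spow.comp_aemeasurable hu.1.aemeasurable).aestronglyMeasurable ?_
  filter_upwards with x
  rw [Real.norm_eq_abs, Real.norm_eq_abs, abs_spow hq]
  exact le_abs_self _

lemma holderConjugate_ofReal (hq : 0 < q) :
    ENNReal.HolderConjugate (ENNReal.ofReal (q + 1)) (ENNReal.ofReal ((q + 1) / q)) := by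
  apply Real.HolderConjugate.ennrealOfReal
  rw [Real.holderConjugate_iff]
  refine ⟨by linarith, ?_⟩
  field_simp
  ring

lemma integrable_mul_of_memLp {g h : α → ℝ} (hq : 0 < q)
    (hg : MemLp g (ENNReal.ofReal (q + 1)) μ) (hh : MemLp h (ENNReal.ofReal ((q + 1) / q)) μ) :
    Integrable (fun x ↦ g x * h x) μ := by
  have := holderConjugate_ofReal hq
  exact hg.integrable_mul hh

/-- The right-hand side is `I'`. Replacing `ut` by `f` in it gives `(q+1) D`, and the difference is
controlled by `rpow_mul_errorBound_le`. -/
lemma le_integral_spow_mul (hp : 1 < p) (hq : 0 < q) (hc : 0 ≤ c)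
    (hu : MemLp u (ENNReal.ofReal (q + 1)) μ) (hut : MemLp ut (ENNReal.ofReal (q + 1)) μ)
    (hf : AEStronglyMeasurable f μ) (hG : MemLp G (ENNReal.ofReal p) μ) (hG0 : ∀ x, 0 ≤ G x)
    (hE : ∀ᵐ x ∂μ, |ut x - f x| ≤ errorBound p q c |u x| (G x))
    (hD : ∫ x, f x * spow (u x) q ∂μ = -∫ x, G x ^ p ∂μ) :
    (q + 1 + c) * (-∫ x, G x ^ p ∂μ) - (2 * q + 3 / 2) * c * ∫ x, |u x| ^ (q + 1) ∂μ ≤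
      (q + 1) * ∫ x, spow (u x) q * ut x ∂μ := by
  have hfm := memLp_of_abs_sub_le_errorBound hp hq hc hu hut hf hG hG0 hE
  have hv := memLp_spow hq hu
  have i1 := integrable_mul_of_memLp hq hfm hv
  have i2 := integrable_mul_of_memLp hq hut hv
  have iI := integrable_abs_rpow (by linarith) hu
  have iG : Integrable (fun x ↦ G x ^ p) μ := by
    simpa [abs_of_nonneg (hG0 _)] using integrable_abs_rpow (by linarith) hG
  have key : -(c * ((2 * q + 3 / 2) / (q + 1) * ∫ x, |u x| ^ (q + 1) ∂μ) +
      c * (1 / (q + 1) * ∫ x, G x ^ p ∂μ)) ≤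
      ∫ x, ut x * spow (u x) q ∂μ - ∫ x, f x * spow (u x) q ∂μ := by
    rw [← integral_sub i2 i1, ← integral_const_mul, ← integral_const_mul, ← integral_const_mul,
      ← integral_const_mul, ← integral_add ((iI.const_mul _).const_mul _)
      ((iG.const_mul _).const_mul _), ← integral_neg]
    refine integral_mono_ae (((iI.const_mul _).const_mul _).add
      ((iG.const_mul _).const_mul _)).neg (i2.sub i1) ?_
    filter_upwards [hE] with x hx
    have h1 := rpow_mul_errorBound_le (p := p) hq hc (abs_nonneg (u x)) (hG0 x)
    have h2 : |(ut x - f x) * spow (u x) q| ≤ |u x| ^ q * errorBound p q c |u x| (G x) := by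
      rw [abs_mul, abs_spow hq, mul_comm]
      gcongr
    have h3 := neg_abs_le ((ut x - f x) * spow (u x) q)
    linarith
  have hG0' : 0 ≤ ∫ x, G x ^ p ∂μ := integral_nonneg fun x ↦ Real.rpow_nonneg (hG0 x) _
  have hcomm : ∫ x, ut x * spow (u x) q ∂μ = ∫ x, spow (u x) q * ut x ∂μ := by
    congr with x
    exact mul_comm _ _
  rw [hD, hcomm] at key
  have hq1 : 0 < q + 1 := by linarith
  have e : (q + 1) * -(c * ((2 * q + 3 / 2) / (q + 1) * ∫ x, |u x| ^ (q + 1) ∂μ) +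
      c * (1 / (q + 1) * ∫ x, G x ^ p ∂μ)) =
      -((2 * q + 3 / 2) * c * ∫ x, |u x| ^ (q + 1) ∂μ + c * ∫ x, G x ^ p ∂μ) := by
    field_simp
  have := mul_le_mul_of_nonneg_left key hq1.le
  rw [e] at this
  linarith

/-- Weighted Cauchy-Schwarz inequality by the discriminant: the integral of `k (X - l u)²` is
nonnegative, and `l` is taken at the minimum. -/
lemma sq_integral_mul_le_of_weight {k X : α → ℝ} (hk : ∀ x, 0 ≤ k x)
    (h1 : Integrable (fun x ↦ k x * X x ^ 2) μ) (h2 : Integrable (fun x ↦ k x * X x * u x) μ)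
    (h3 : Integrable (fun x ↦ k x * u x ^ 2) μ) (h0 : 0 < ∫ x, k x * u x ^ 2 ∂μ) :
    (∫ x, k x * X x * u x ∂μ) ^ 2 ≤ (∫ x, k x * X x ^ 2 ∂μ) * ∫ x, k x * u x ^ 2 ∂μ := by
  set a := ∫ x, k x * X x ^ 2 ∂μ
  set b := ∫ x, k x * X x * u x ∂μ
  set d := ∫ x, k x * u x ^ 2 ∂μ
  have h : ∀ l : ℝ, 0 ≤ a - 2 * l * b + l ^ 2 * d := by
    intro l
    have e : a - 2 * l * b + l ^ 2 * d = ∫ x, k x * (X x - l * u x) ^ 2 ∂μ := by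
      have h12 : Integrable (fun x ↦ k x * X x ^ 2 - 2 * l * (k x * X x * u x)) μ :=
        h1.sub (h2.const_mul _)
      rw [← integral_const_mul, ← integral_const_mul, ← integral_sub h1 (h2.const_mul _),
        ← integral_add h12 (h3.const_mul _)]
      congr with x
      ring
    rw [e]
    exact integral_nonneg fun x ↦ mul_nonneg (hk x) (sq_nonneg _)
  have := h (b / d)
  have e : a - 2 * (b / d) * b + (b / d) ^ 2 * d = (a * d - b ^ 2) / d := by
    field_simp; ring
  rw [e, le_div_iff₀ h0] at this
  linarith

/-- The core computation. The midpoint `X` of `ut` and `f` diagonalises the three integrals: `f u`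
and `ut u` become `X u ∓ e u / 2`, and `f ut` becomes `X² - e²/4`, so that `e` enters only through
squares. -/
lemma frequency_deriv_numerator_ge {w : α → ℝ} (hp : 1 < p) (hq : 0 < q)
    (hδ : 0 ≤ q * (p - 1) - 1) (hc : 0 ≤ c)
    (hu : MemLp u (ENNReal.ofReal (q + 1)) μ) (hut : MemLp ut (ENNReal.ofReal (q + 1)) μ)
    (hf : AEStronglyMeasurable f μ) (hG : MemLp G (ENNReal.ofReal p) μ) (hG0 : ∀ x, 0 ≤ G x)
    (hE : ∀ᵐ x ∂μ, |ut x - f x| ≤ errorBound p q c |u x| (G x))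
    (hD : ∫ x, f x * spow (u x) q ∂μ = -∫ x, G x ^ p ∂μ)
    (hw : MemLp w (ENNReal.ofReal ((q + 1) / q)) μ)
    (hfw : ∀ᵐ x ∂μ, f x * w x = q * (|u x| ^ (q - 1) * (f x * ut x)))
    (hI : 0 < ∫ x, |u x| ^ (q + 1) ∂μ) :
    p * q / (q + 1) * c ^ 2 * ((-∫ x, G x ^ p ∂μ) - (q + 1 / 2) * ∫ x, |u x| ^ (q + 1) ∂μ) *
      (∫ x, |u x| ^ (q + 1) ∂μ) ≤
      (p * ∫ x, f x * w x ∂μ) * (∫ x, |u x| ^ (q + 1) ∂μ) -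
        (-∫ x, G x ^ p ∂μ) * ((q + 1) * ∫ x, spow (u x) q * ut x ∂μ) := by
  have hfm := memLp_of_abs_sub_le_errorBound hp hq hc hu hut hf hG hG0 hE
  have hv := memLp_spow hq hu
  have i1 := integrable_mul_of_memLp hq hfm hv
  have i2 := integrable_mul_of_memLp hq hut hv
  have iI := integrable_abs_rpow (by linarith) hu
  have iG : Integrable (fun x ↦ G x ^ p) μ := by
    simpa [abs_of_nonneg (hG0 _)] using integrable_abs_rpow (by linarith) hG
  have i3 := integrable_mul_of_memLp hq hfm hw
  set k : α → ℝ := fun x ↦ |u x| ^ (q - 1) with hkdef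
  have hk : ∀ x, 0 ≤ k x := fun x ↦ by positivity
  have hkm : AEStronglyMeasurable k μ := by
    have := hu.1.aemeasurable
    exact AEMeasurable.aestronglyMeasurable (by fun_prop)
  set e : α → ℝ := fun x ↦ ut x - f x with hedef
  set X : α → ℝ := fun x ↦ ut x - e x / 2 with hXdef
  have hem : AEStronglyMeasurable e μ := hut.1.sub hf
  -- integrability of the weighted square of the error
  have hbd : ∀ᵐ x ∂μ, k x * e x ^ 2 ≤
      c ^ 2 * (4 / (q + 1)) * ((q + 1 / 2) * |u x| ^ (q + 1) + G x ^ p) := by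
    filter_upwards [hE] with x hx
    refine le_trans ?_ (rpow_mul_errorBound_sq_le hq (abs_nonneg (u x)) (hG0 x))
    rw [← sq_abs (e x)]
    exact mul_le_mul_of_nonneg_left (pow_le_pow_left₀ (abs_nonneg _) hx 2) (hk x)
  have iR : Integrable (fun x ↦ c ^ 2 * (4 / (q + 1)) *
      ((q + 1 / 2) * |u x| ^ (q + 1) + G x ^ p)) μ :=
    ((iI.const_mul _).add iG).const_mul _
  have ie : Integrable (fun x ↦ k x * e x ^ 2) μ := by
    refine iR.mono' (hkm.mul (hem.pow 2)) ?_
    filter_upwards [hbd] with x hx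
    rwa [Real.norm_eq_abs, abs_of_nonneg (mul_nonneg (hk x) (sq_nonneg _))]
  -- For `q < 1` the weight is unbounded near the zeros of `u`, so integrability is drawn from the
  -- pairing of `f` with `w`. That of `k X²` follows from `X² = f ut + e²/4`.
  have ifut : Integrable (fun x ↦ k x * (f x * ut x)) μ := by
    refine (i3.const_mul q⁻¹).congr ?_
    filter_upwards [hfw] with x hx
    rw [hx, ← mul_assoc, inv_mul_cancel₀ hq.ne', one_mul]
  have iX : Integrable (fun x ↦ k x * X x ^ 2) μ := by
    refine (ifut.add (ie.const_mul (1 / 4))).congr ?_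
    filter_upwards with x
    simp only [hXdef, hedef, Pi.add_apply]
    ring
  have hv' : ∀ x, spow (u x) q = k x * u x := fun x ↦ rfl
  have iXu : Integrable (fun x ↦ k x * X x * u x) μ := by
    refine ((i1.add i2).const_mul (1 / 2)).congr ?_
    filter_upwards with x
    simp only [hXdef, hedef, Pi.add_apply, hv']
    ring
  have ieu : Integrable (fun x ↦ k x * e x * u x) μ := by
    refine (i2.sub i1).congr ?_
    filter_upwards with x
    simp only [hedef, Pi.sub_apply, hv']
    ring
  have hku : ∀ x, k x * u x ^ 2 = |u x| ^ (q + 1) := fun x ↦ by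
    rw [← sq_abs, rpow_sub_one_mul_sq hq (abs_nonneg _)]
  have cs := sq_integral_mul_le_of_weight (u := u) hk iX iXu
    (by simpa only [hku] using iI) (by simpa only [hku] using hI)
  simp only [hku] at cs
  have eD : ∫ x, f x * spow (u x) q ∂μ =
      ∫ x, k x * X x * u x ∂μ - (1 / 2) * ∫ x, k x * e x * u x ∂μ := by
    rw [← integral_const_mul, ← integral_sub iXu (ieu.const_mul _)]
    congr with x
    simp only [hXdef, hedef, hv']
    ring
  have eI : ∫ x, spow (u x) q * ut x ∂μ =
      ∫ x, k x * X x * u x ∂μ + (1 / 2) * ∫ x, k x * e x * u x ∂μ := by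
    rw [← integral_const_mul, ← integral_add iXu (ieu.const_mul _)]
    congr with x
    simp only [hXdef, hedef, hv']
    ring
  have eW : ∫ x, f x * w x ∂μ =
      q * (∫ x, k x * X x ^ 2 ∂μ - (1 / 4) * ∫ x, k x * e x ^ 2 ∂μ) := by
    rw [integral_congr_ae hfw, integral_const_mul, ← integral_const_mul (1 / 4),
      ← integral_sub iX (ie.const_mul _)]
    congr with x
    simp only [hXdef, hedef]
    ring
  have hQ : ∫ x, k x * e x ^ 2 ∂μ ≤ c ^ 2 * (4 / (q + 1)) *
      ((q + 1 / 2) * ∫ x, |u x| ^ (q + 1) ∂μ + ∫ x, G x ^ p ∂μ) := by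
    rw [← integral_const_mul (q + 1 / 2), ← integral_add (iI.const_mul _) iG,
      ← integral_const_mul]
    exact integral_mono_ae ie iR hbd
  have hS : 0 ≤ ∫ x, k x * X x ^ 2 ∂μ := integral_nonneg fun x ↦ mul_nonneg (hk x) (sq_nonneg _)
  have hGe : ∫ x, G x ^ p ∂μ = -∫ x, f x * spow (u x) q ∂μ := by rw [hD]; ring
  rw [hGe] at hQ
  rw [← hD]
  rw [eW, eI]
  rw [eD] at hQ ⊢
  set S := ∫ x, k x * X x ^ 2 ∂μ
  set Q := ∫ x, k x * e x ^ 2 ∂μ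
  set C := ∫ x, k x * X x * u x ∂μ
  set d := ∫ x, k x * e x * u x ∂μ
  set I := ∫ x, |u x| ^ (q + 1) ∂μ
  -- The only use of `δ ≥ 0` in the inequality: the factor `p q` of `S I` may be lowered to `q + 1`,
  -- which matches Cauchy-Schwarz.
  have hpq : 0 ≤ p * q - (q + 1) := by linarith
  have h1 : 0 ≤ (p * q - (q + 1)) * (S * I) := by positivity
  have h2 : (q + 1) * C ^ 2 ≤ (q + 1) * (S * I) := by gcongr
  have h3 : 0 ≤ (q + 1) * d ^ 2 := by positivity
  have h4 : p * q * I / 4 * Q ≤ p * q * I / 4 * (c ^ 2 * (4 / (q + 1)) *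
      ((q + 1 / 2) * I + -(C - 1 / 2 * d))) := by gcongr
  have h5 : p * q * I / 4 * (c ^ 2 * (4 / (q + 1)) * ((q + 1 / 2) * I + -(C - 1 / 2 * d))) =
      -(p * q / (q + 1) * c ^ 2 * (C - 1 / 2 * d - (q + 1 / 2) * I) * I) := by
    field_simp; ring
  rw [h5] at h4
  nlinarith

end Static

/-! ### First-order expansion of the odd power. -/

section SignedPower

lemma hasDerivAt_spow {x : ℝ} (q : ℝ) (hx : x ≠ 0) :
    HasDerivAt (fun y ↦ spow y q) (q * |x| ^ (q - 1)) x := by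
  have h := ((hasDerivAt_abs hx).rpow_const (p := q - 1) (Or.inl (abs_ne_zero.2 hx))).mul
    (hasDerivAt_id x)
  refine h.congr_deriv ?_
  have e : |x| ^ (q - 1) = |x| ^ (q - 1 - 1) * |x| := by
    rw [← Real.rpow_add_one (abs_ne_zero.2 hx)]; ring_nf
  have hs : (SignType.sign x : ℝ) * x = |x| := sign_mul_self x
  simp only [id]
  rw [e]
  linear_combination (q - 1) * |x| ^ (q - 1 - 1) * hs

lemma spow_mul (a b q : ℝ) : spow (a * b) q = spow a q * spow b q := by
  unfold spow
  rw [abs_mul, Real.mul_rpow (abs_nonneg _) (abs_nonneg _)]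
  ring

lemma spow_one_left (q : ℝ) : spow 1 q = 1 := by simp [spow]

lemma abs_spow_sub_one_le {q ε : ℝ} (hq : 1 ≤ q) (hε : 0 < ε) :
    ∃ K : ℝ, 1 ≤ K ∧ ∀ x : ℝ,
      |spow x q - 1 - q * (x - 1)| ≤ |x - 1| * (ε + K * |x - 1| ^ (q - 1)) := by
  have h := (hasDerivAt_spow q one_ne_zero).isLittleO
  have h2 := h.def hε
  rw [Metric.eventually_nhds_iff] at h2
  obtain ⟨δ, hδ, h3⟩ := h2
  -- Far from `1`, where `|x - 1| ≥ δ`, the three summands absorb `|x|^q`, the constant `1` and the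
  -- linear term respectively.
  set K := (1 + δ⁻¹) ^ q + δ⁻¹ ^ q + q * δ⁻¹ ^ (q - 1) with hK
  have hq0 : 0 < q := by linarith
  have hK1 : 1 ≤ K := by
    have : 1 ≤ (1 + δ⁻¹) ^ q := Real.one_le_rpow (by linarith [inv_pos.2 hδ]) hq0.le
    have h4 : 0 ≤ δ⁻¹ ^ q + q * δ⁻¹ ^ (q - 1) := by positivity
    linarith
  refine ⟨K, hK1, fun x ↦ ?_⟩
  by_cases hx : |x - 1| < δ
  · have := h3 (y := x) (by rwa [Real.dist_eq])
    simp only [spow_one_left, abs_one, Real.one_rpow, mul_one, smul_eq_mul, Real.norm_eq_abs]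
      at this
    rw [mul_comm q]
    refine this.trans ?_
    rw [mul_comm]
    gcongr
    have : 0 ≤ K * |x - 1| ^ (q - 1) := by positivity
    linarith
  · push Not at hx
    set d := |x - 1| with hd
    have hd0 : 0 < d := hδ.trans_le hx
    have h1 : 1 ≤ δ⁻¹ * d := by rw [inv_mul_eq_div, one_le_div hδ]; exact hx
    have e1 : |spow x q| ≤ (1 + δ⁻¹) ^ q * d ^ q := by
      rw [abs_spow hq0, ← Real.mul_rpow (by positivity) (by positivity)]
      apply Real.rpow_le_rpow (abs_nonneg _) _ hq0.le
      calc |x| = |(x - 1) + 1| := by ring_nf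
        _ ≤ d + 1 := by simpa using abs_add_le (x - 1) 1
        _ ≤ _ := by linarith
    have e2 : 1 ≤ δ⁻¹ ^ q * d ^ q := by
      rw [← Real.mul_rpow (by positivity) (by positivity)]
      exact Real.one_le_rpow h1 hq0.le
    have e3 : 1 ≤ δ⁻¹ ^ (q - 1) * d ^ (q - 1) := by
      rw [← Real.mul_rpow (by positivity) (by positivity)]
      exact Real.one_le_rpow h1 (by linarith)
    have e4 : d * d ^ (q - 1) = d ^ q := by
      rw [mul_comm, ← Real.rpow_add_one hd0.ne']; ring_nf
    calc |spow x q - 1 - q * (x - 1)| ≤ |spow x q| + |(1 : ℝ)| + |q * (x - 1)| := by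
          have h1 := abs_sub (spow x q - 1) (q * (x - 1))
          have h2 := abs_sub (spow x q) 1
          linarith
      _ = |spow x q| + 1 + q * d := by rw [abs_one, abs_mul, abs_of_pos hq0]
      _ ≤ (1 + δ⁻¹) ^ q * d ^ q + δ⁻¹ ^ q * d ^ q + q * d * (δ⁻¹ ^ (q - 1) * d ^ (q - 1)) := by
          exact add_le_add (add_le_add e1 e2) (le_mul_of_one_le_right (by positivity) e3)
      _ = K * d ^ q := by rw [← e4, hK]; ring
      _ = d * (0 + K * d ^ (q - 1)) := by rw [← e4]; ring
      _ ≤ d * (ε + K * d ^ (q - 1)) := by gcongr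

/-- By homogeneity the expansion at `1` gives the one at any `b ≠ 0`, with the same `K`. Uniformity
in `a` and `b` is what differentiability between Lebesgue spaces requires. -/
lemma abs_spow_sub_spow_sub_le {q ε : ℝ} (hq : 1 ≤ q) (hε : 0 < ε) :
    ∃ K : ℝ, 1 ≤ K ∧ ∀ a b : ℝ,
      |spow a q - spow b q - q * |b| ^ (q - 1) * (a - b)| ≤
        |a - b| * (ε * |b| ^ (q - 1) + K * |a - b| ^ (q - 1)) := by
  obtain ⟨K, hK, h⟩ := abs_spow_sub_one_le hq hε
  refine ⟨K, hK, fun a b ↦ ?_⟩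
  rcases eq_or_ne b 0 with rfl | hb
  · rcases hq.eq_or_lt with rfl | hq1
    · simp [spow]
      nlinarith [abs_nonneg a]
    · rw [abs_zero, Real.zero_rpow (by linarith)]
      have : spow 0 q = 0 := by simp [spow]
      rw [this]
      simp only [sub_zero, mul_zero, zero_mul, zero_add]
      rw [abs_spow (by linarith), ← rpow_sub_one_mul_self (by linarith) (abs_nonneg a)]
      have : 0 ≤ |a| * |a| ^ (q - 1) := by positivity
      nlinarith
  · have hx := h (a / b)
    have ea : a = a / b * b := by field_simp
    set x := a / b
    rw [ea, spow_mul, show x * b - b = (x - 1) * b by ring,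
      show spow x q * spow b q - spow b q - q * |b| ^ (q - 1) * ((x - 1) * b) =
        (spow x q - 1 - q * (x - 1)) * spow b q by unfold spow; ring, abs_mul, abs_mul,
      abs_spow (by linarith), Real.mul_rpow (abs_nonneg _) (abs_nonneg _),
      ← rpow_sub_one_mul_self (by linarith) (abs_nonneg b)]
    calc _ ≤ |x - 1| * (ε + K * |x - 1| ^ (q - 1)) * (|b| ^ (q - 1) * |b|) := by gcongr
      _ = _ := by ring

lemma spow_exponent_one (a : ℝ) : spow a 1 = a := by simp [spow]

end SignedPower

/-! ### Time derivatives of `u^q` in Lebesgue spaces. -/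

section LpCurve

variable {α : Type*} [MeasurableSpace α] {μ : Measure α} {q : ℝ}

/-- Hölder's inequality with exponents `q + 1` and `(q+1)/(q-1)`, whose inverses add up to
`q/(q+1)`. -/
lemma eLpNorm_mul_abs_rpow_le (hq : 1 < q) {g h : α → ℝ} (hg : AEStronglyMeasurable g μ)
    (hh : AEStronglyMeasurable h μ) :
    eLpNorm (fun x ↦ g x * |h x| ^ (q - 1)) (ENNReal.ofReal ((q + 1) / q)) μ ≤
      eLpNorm g (ENNReal.ofReal (q + 1)) μ *
        eLpNorm h (ENNReal.ofReal (q + 1)) μ ^ (q - 1) := by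
  have hq1 : 0 < q - 1 := by linarith
  have hT : ENNReal.HolderTriple (ENNReal.ofReal (q + 1)) (ENNReal.ofReal ((q + 1) / (q - 1)))
      (ENNReal.ofReal ((q + 1) / q)) := by
    constructor
    rw [← ENNReal.ofReal_inv_of_pos (by positivity), ← ENNReal.ofReal_inv_of_pos (by positivity),
      ← ENNReal.ofReal_inv_of_pos (by positivity), ← ENNReal.ofReal_add (by positivity)
      (by positivity)]
    congr 1
    field_simp
    ring
  have h1 := eLpNorm_norm_rpow (p := ENNReal.ofReal ((q + 1) / (q - 1))) (μ := μ) h hq1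
  rw [← ENNReal.ofReal_mul (by positivity), div_mul_cancel₀ _ hq1.ne'] at h1
  have hm : AEStronglyMeasurable (fun x ↦ ‖h x‖ ^ (q - 1)) μ := by
    have := hh.aemeasurable
    exact AEMeasurable.aestronglyMeasurable (by fun_prop)
  have h2 := eLpNorm_smul_le_mul_eLpNorm (μ := μ) (p := ENNReal.ofReal (q + 1))
    (q := ENNReal.ofReal ((q + 1) / (q - 1))) (r := ENNReal.ofReal ((q + 1) / q)) hm hg
  rw [h1] at h2
  exact h2

lemma HasLpDerivWithinAt.tendsto_eLpNorm_sub {r : ℝ} {u : ℝ → α → ℝ} {w : α → ℝ} {T : Set ℝ}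
    {t : ℝ} (hr : 1 ≤ r) (h : HasLpDerivWithinAt r μ u w T t) (ht : t ∈ T) :
    (∀ᶠ s in 𝓝[T \ {t}] t, eLpNorm (fun x ↦ (u s x - u t x) / (s - t)) (ENNReal.ofReal r) μ ≤
      1 + eLpNorm w (ENNReal.ofReal r) μ) ∧
    Tendsto (fun s ↦ eLpNorm (fun x ↦ u s x - u t x) (ENNReal.ofReal r) μ)
      (𝓝[T \ {t}] t) (𝓝 0) := by
  obtain ⟨h1, h2, h3⟩ := h
  have hr' : 1 ≤ ENNReal.ofReal r := by rwa [ENNReal.one_le_ofReal]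
  have hb : ∀ᶠ s in 𝓝[T \ {t}] t, eLpNorm (fun x ↦ (u s x - u t x) / (s - t))
      (ENNReal.ofReal r) μ ≤ 1 + eLpNorm w (ENNReal.ofReal r) μ := by
    filter_upwards [(ENNReal.tendsto_nhds_zero.1 h3) 1 one_pos, self_mem_nhdsWithin] with s hs hsT
    have hm : AEStronglyMeasurable (fun x ↦ (u s x - u t x) / (s - t) - w x) μ := by
      have := ((h1 s hsT.1).1.sub (h1 t ht).1).mul_const (s - t)⁻¹
      exact this.sub h2.1
    calc _ = eLpNorm ((fun x ↦ (u s x - u t x) / (s - t) - w x) + w) (ENNReal.ofReal r) μ := by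
            congr 1; ext x; simp
      _ ≤ _ := eLpNorm_add_le hm h2.1 hr'
      _ ≤ _ := by gcongr
  refine ⟨hb, ?_⟩
  have hz : Tendsto (fun s : ℝ ↦ ENNReal.ofReal |s - t| * (1 + eLpNorm w (ENNReal.ofReal r) μ))
      (𝓝[T \ {t}] t) (𝓝 0) := by
    have h4 : Tendsto (fun s : ℝ ↦ ENNReal.ofReal |s - t|) (𝓝[T \ {t}] t) (𝓝 0) := by
      rw [← ENNReal.ofReal_zero]
      apply ENNReal.tendsto_ofReal
      have : Tendsto (fun s : ℝ ↦ |s - t|) (𝓝 t) (𝓝 |t - t|) :=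
        Continuous.tendsto (by fun_prop) t
      simp only [sub_self, abs_zero] at this
      exact this.mono_left nhdsWithin_le_nhds
    have := ENNReal.Tendsto.mul_const (b := 1 + eLpNorm w (ENNReal.ofReal r) μ) h4
      (Or.inr (by finiteness [h2.2]))
    simpa using this
  refine tendsto_of_tendsto_of_tendsto_of_le_of_le' tendsto_const_nhds hz
    (Eventually.of_forall fun _ ↦ zero_le) ?_
  filter_upwards [hb, self_mem_nhdsWithin] with s hs hsT
  have hne : s - t ≠ 0 := sub_ne_zero.2 hsT.2
  calc _ = eLpNorm ((s - t) • fun x ↦ (u s x - u t x) / (s - t)) (ENNReal.ofReal r) μ := by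
        congr 1; ext x; simp [mul_div_cancel₀ _ hne]
    _ = ENNReal.ofReal |s - t| * _ := by
        rw [eLpNorm_const_smul, Real.enorm_eq_ofReal_abs]
    _ ≤ _ := by gcongr

/-- For `q ≥ 1` the odd power is a differentiable map from `L^(q+1)` to `L^((q+1)/q)`, so the
derivative of `u^q` need not be assumed. -/
lemma HasLpDerivWithinAt.spow (hq : 1 ≤ q) {u : ℝ → α → ℝ} {w : α → ℝ} {T : Set ℝ}
    {t : ℝ} (h : HasLpDerivWithinAt (q + 1) μ u w T t) (ht : t ∈ T) :
    HasLpDerivWithinAt ((q + 1) / q) μ (fun s x ↦ spow (u s x) q)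
      (fun x ↦ q * |u t x| ^ (q - 1) * w x) T t := by
  -- At `q = 1` the Hölder exponent `(q+1)/(q-1)` degenerates; there the power is the identity.
  rcases hq.eq_or_lt with rfl | hq1
  · simpa [spow_exponent_one, HasLpDerivWithinAt] using h
  have hq0 : 0 < q := by linarith
  obtain ⟨hb, hz⟩ := h.tendsto_eLpNorm_sub (by linarith) ht
  obtain ⟨h1, h2, h3⟩ := h
  have hut := (h1 t ht)
  have hum := hut.1.aemeasurable
  have hwm := h2.1.aemeasurable
  have hR : 1 ≤ ENNReal.ofReal ((q + 1) / q) := by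
    rw [ENNReal.one_le_ofReal, le_div_iff₀ hq0]; linarith
  refine ⟨fun s hs ↦ memLp_spow hq0 (h1 s hs), ⟨AEMeasurable.aestronglyMeasurable
    (by fun_prop), ?_⟩, ?_⟩
  · have := eLpNorm_mul_abs_rpow_le hq1 (h2.const_mul q).1 hut.1
    have e : (fun x ↦ q * |u t x| ^ (q - 1) * w x) = fun x ↦ q * w x * |u t x| ^ (q - 1) := by
      ext x; ring
    rw [e]
    refine this.trans_lt (ENNReal.mul_lt_top (h2.const_mul q).2 ?_)
    exact ENNReal.rpow_lt_top_of_nonneg (by linarith) hut.2.ne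
  set P := ENNReal.ofReal (q + 1)
  set R := ENNReal.ofReal ((q + 1) / q)
  set A := 1 + eLpNorm w P μ
  set U := eLpNorm (u t) P μ ^ (q - 1)
  have hA : A ≠ ⊤ := by finiteness [h2.2]
  have hU : U ≠ ⊤ := (ENNReal.rpow_lt_top_of_nonneg (by linarith) hut.2.ne).ne
  rw [ENNReal.tendsto_nhds_zero]
  intro ε' hε'
  obtain ⟨ε, hε, hεA⟩ : ∃ ε : ℝ, 0 < ε ∧ ENNReal.ofReal ε * (A * U) ≤ ε' / 2 := by
    have : Tendsto (fun ε : ℝ ↦ ENNReal.ofReal ε * (A * U)) (𝓝[>] 0) (𝓝 0) := by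
      have h4 : Tendsto (fun ε : ℝ ↦ ENNReal.ofReal ε) (𝓝[>] 0) (𝓝 0) := by
        rw [← ENNReal.ofReal_zero]
        exact ENNReal.tendsto_ofReal (tendsto_id.mono_left nhdsWithin_le_nhds)
      have := ENNReal.Tendsto.mul_const (b := A * U) h4 (Or.inr (ENNReal.mul_ne_top hA hU))
      simpa using this
    have h5 := (ENNReal.tendsto_nhds_zero.1 this) (ε' / 2) (ENNReal.half_pos hε'.ne')
    obtain ⟨ε, h6, h7⟩ := (h5.and self_mem_nhdsWithin).exists
    exact ⟨ε, h7, h6⟩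
  obtain ⟨K, hK, hKb⟩ := abs_spow_sub_spow_sub_le hq hε
  have hlim : Tendsto (fun s ↦ ENNReal.ofReal K *
      (A * eLpNorm (fun x ↦ u s x - u t x) P μ ^ (q - 1)) +
      ENNReal.ofReal q * (eLpNorm (fun x ↦ (u s x - u t x) / (s - t) - w x) P μ * U))
      (𝓝[T \ {t}] t) (𝓝 0) := by
    have l1 : Tendsto (fun s ↦ eLpNorm (fun x ↦ u s x - u t x) P μ ^ (q - 1))
        (𝓝[T \ {t}] t) (𝓝 0) := by
      have := hz.ennrpow_const (q - 1)
      rwa [ENNReal.zero_rpow_of_pos (by linarith)] at this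
    have l2 := ENNReal.Tendsto.const_mul (a := ENNReal.ofReal K)
      (ENNReal.Tendsto.const_mul (a := A) l1 (Or.inr hA)) (Or.inr ENNReal.ofReal_ne_top)
    have l3 := ENNReal.Tendsto.const_mul (a := ENNReal.ofReal q)
      (ENNReal.Tendsto.mul_const (b := U) h3 (Or.inr hU)) (Or.inr ENNReal.ofReal_ne_top)
    simpa using l2.add l3
  filter_upwards [hb, (ENNReal.tendsto_nhds_zero.1 hlim) (ε' / 2) (ENNReal.half_pos hε'.ne'),
    self_mem_nhdsWithin] with s hs hs2 hsT
  have hne : s - t ≠ 0 := sub_ne_zero.2 hsT.2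
  have husm := (h1 s hsT.1).1.aemeasurable
  set Δ : α → ℝ := fun x ↦ (u s x - u t x) / (s - t) with hΔ
  -- The remainder splits into three parts: `ε a1`, small by the choice of `ε`; `K a2`, which tends
  -- to zero because `u s` tends to `u t`; and `q a3`, which tends to zero by differentiability of
  -- `u`.
  set a1 : α → ℝ := fun x ↦ Δ x * |u t x| ^ (q - 1)
  set a2 : α → ℝ := fun x ↦ Δ x * |u s x - u t x| ^ (q - 1)
  set a3 : α → ℝ := fun x ↦ (Δ x - w x) * |u t x| ^ (q - 1)
  have m1 : AEStronglyMeasurable a1 μ := AEMeasurable.aestronglyMeasurable (by fun_prop)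
  have m2 : AEStronglyMeasurable a2 μ := AEMeasurable.aestronglyMeasurable (by fun_prop)
  have m3 : AEStronglyMeasurable a3 μ := AEMeasurable.aestronglyMeasurable (by fun_prop)
  have mΔ : AEStronglyMeasurable Δ μ := AEMeasurable.aestronglyMeasurable (by fun_prop)
  have hpt : ∀ x, ‖(ParabolicFrequency.spow (u s x) q - ParabolicFrequency.spow (u t x) q) /
      (s - t) - q * |u t x| ^ (q - 1) * w x‖ ≤
      ‖(ε • fun x ↦ ‖a1 x‖) x + (K • fun x ↦ ‖a2 x‖) x + (q • fun x ↦ ‖a3 x‖) x‖ := by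
    intro x
    have hx := hKb (u s x) (u t x)
    have e : (ParabolicFrequency.spow (u s x) q - ParabolicFrequency.spow (u t x) q) /
      (s - t) - q * |u t x| ^ (q - 1) * w x =
      (ParabolicFrequency.spow (u s x) q - ParabolicFrequency.spow (u t x) q -
        q * |u t x| ^ (q - 1) * (u s x - u t x)) / (s - t) + q * a3 x := by
      simp only [a3, hΔ]; field_simp; ring
    rw [e]
    simp only [Pi.smul_apply, smul_eq_mul]
    refine le_trans ?_ (le_abs_self _)
    refine (norm_add_le _ _).trans ?_
    have e2 : ‖q * a3 x‖ = q * ‖a3 x‖ := by rw [norm_mul, Real.norm_of_nonneg hq0.le]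
    rw [e2]
    gcongr
    rw [norm_div, div_le_iff₀ (norm_pos_iff.2 hne)]
    refine hx.trans (le_of_eq ?_)
    simp only [a1, a2, hΔ, norm_mul, norm_div, Real.norm_eq_abs]
    rw [abs_of_nonneg (by positivity : 0 ≤ |u t x| ^ (q - 1)),
      abs_of_nonneg (by positivity : 0 ≤ |u s x - u t x| ^ (q - 1))]
    have : |s - t| ≠ 0 := abs_ne_zero.2 hne
    field_simp
  calc _ ≤ eLpNorm ((ε • fun x ↦ ‖a1 x‖) + (K • fun x ↦ ‖a2 x‖) + (q • fun x ↦ ‖a3 x‖)) R μ :=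
        eLpNorm_mono hpt
    _ ≤ eLpNorm (ε • fun x ↦ ‖a1 x‖) R μ + eLpNorm (K • fun x ↦ ‖a2 x‖) R μ +
        eLpNorm (q • fun x ↦ ‖a3 x‖) R μ := by
        refine (eLpNorm_add_le ((m1.norm.const_smul _).add (m2.norm.const_smul _))
          (m3.norm.const_smul _) hR).trans ?_
        gcongr
        exact eLpNorm_add_le (m1.norm.const_smul _) (m2.norm.const_smul _) hR
    _ = ENNReal.ofReal ε * eLpNorm a1 R μ + ENNReal.ofReal K * eLpNorm a2 R μ +
        ENNReal.ofReal q * eLpNorm a3 R μ := by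
        rw [eLpNorm_const_smul, eLpNorm_const_smul, eLpNorm_const_smul, eLpNorm_norm,
          eLpNorm_norm, eLpNorm_norm, Real.enorm_eq_ofReal hε.le, Real.enorm_eq_ofReal hq0.le,
          Real.enorm_eq_ofReal (by linarith)]
    _ ≤ ENNReal.ofReal ε * (A * U) + ENNReal.ofReal K *
        (A * eLpNorm (fun x ↦ u s x - u t x) P μ ^ (q - 1)) +
        ENNReal.ofReal q * (eLpNorm (fun x ↦ Δ x - w x) P μ * U) := by
        gcongr
        · exact (eLpNorm_mul_abs_rpow_le hq1 mΔ hut.1).trans (by gcongr)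
        · exact (eLpNorm_mul_abs_rpow_le hq1 mΔ ((h1 s hsT.1).1.sub hut.1)).trans (by gcongr; rfl)
        · exact eLpNorm_mul_abs_rpow_le hq1 (mΔ.sub h2.1) hut.1
    _ ≤ ε' / 2 + ε' / 2 := by
        rw [add_assoc]
        gcongr
    _ = ε' := ENNReal.add_halves _

lemma tendsto_ae_of_tendsto_eLpNorm {r : ℝ≥0∞} (hr : r ≠ 0) {F : ℕ → α → ℝ} {g : α → ℝ}
    (hF : ∀ n, AEStronglyMeasurable (F n) μ) (hg : AEStronglyMeasurable g μ)
    (h : Tendsto (fun n ↦ eLpNorm (fun x ↦ F n x - g x) r μ) atTop (𝓝 0)) :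
    ∃ ns : ℕ → ℕ, StrictMono ns ∧ ∀ᵐ x ∂μ, Tendsto (fun i ↦ F (ns i) x) atTop (𝓝 (g x)) :=
  (tendstoInMeasure_of_tendsto_eLpNorm hr hF hg h).exists_seq_tendsto_ae

/-- For `q < 1` the odd power is not differentiable at zero and both derivatives are data. They are
compared along times for which both families of difference quotients converge almost everywhere. -/
lemma ae_deriv_spow_of_lt_one (hq0 : 0 < q) (hq : q < 1) {u : ℝ → α → ℝ} {ut w : α → ℝ}
    {T : Set ℝ} {t : ℝ} (ht : t ∈ T) [NeBot (𝓝[T \ {t}] t)]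
    (hu : HasLpDerivWithinAt (q + 1) μ u ut T t)
    (hv : HasLpDerivWithinAt ((q + 1) / q) μ (fun s x ↦ spow (u s x) q) w T t) :
    ∀ᵐ x ∂μ, (u t x = 0 → ut x = 0) ∧ (u t x ≠ 0 → w x = q * |u t x| ^ (q - 1) * ut x) := by
  obtain ⟨s, hs⟩ := exists_seq_tendsto (𝓝[T \ {t}] t)
  -- times in `T \ {t}` converging to `t`
  have hsT : ∃ s : ℕ → ℝ, Tendsto s atTop (𝓝[T \ {t}] t) ∧ ∀ n, s n ∈ T \ {t} := by
    have := hs.eventually self_mem_nhdsWithin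
    obtain ⟨N, hN⟩ := eventually_atTop.1 this
    exact ⟨fun n ↦ s (n + N), hs.comp (tendsto_add_atTop_nat N), fun n ↦ hN _ (by omega)⟩
  clear hs
  obtain ⟨s, hs, hsT⟩ := hsT
  have hP : ENNReal.ofReal (q + 1) ≠ 0 := by
    rw [Ne, ENNReal.ofReal_eq_zero]; push Not; linarith
  have hR : ENNReal.ofReal ((q + 1) / q) ≠ 0 := by
    rw [Ne, ENNReal.ofReal_eq_zero]; push Not; positivity
  obtain ⟨ns, hns, hae⟩ := tendsto_ae_of_tendsto_eLpNorm hP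
    (F := fun n x ↦ (u (s n) x - u t x) / (s n - t))
    (fun n ↦ ((hu.1 _ (hsT n).1).1.sub (hu.1 _ ht).1).mul_const (s n - t)⁻¹) hu.2.1.1
    (hu.2.2.comp hs)
  obtain ⟨ms, hms, hae2⟩ := tendsto_ae_of_tendsto_eLpNorm hR
    (F := fun n x ↦ (spow (u (s (ns n)) x) q - spow (u t x) q) / (s (ns n) - t))
    (fun n ↦ ((hv.1 _ (hsT _).1).1.sub (hv.1 _ ht).1).mul_const (s _ - t)⁻¹) hv.2.1.1
    (hv.2.2.comp (hs.comp hns.tendsto_atTop))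
  set σ : ℕ → ℝ := fun n ↦ s (ns (ms n))
  have hσ : Tendsto σ atTop (𝓝[T \ {t}] t) := hs.comp (hns.tendsto_atTop.comp hms.tendsto_atTop)
  have hσT : ∀ n, σ n ∈ T \ {t} := fun n ↦ hsT _
  have hσne : ∀ n, σ n - t ≠ 0 := fun n ↦ sub_ne_zero.2 (hσT n).2
  have hσ0 : Tendsto (fun n ↦ σ n - t) atTop (𝓝 0) := by
    have := (hσ.mono_right nhdsWithin_le_nhds).sub_const t
    rwa [sub_self] at this
  filter_upwards [hae, hae2] with x hx1 hx2
  have hx1 : Tendsto (fun n ↦ (u (σ n) x - u t x) / (σ n - t)) atTop (𝓝 (ut x)) :=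
    hx1.comp hms.tendsto_atTop
  change Tendsto (fun n ↦ (spow (u (σ n) x) q - spow (u t x) q) / (σ n - t)) atTop (𝓝 (w x))
    at hx2
  constructor
  · intro h0
    have hq' : 0 < 1 / q - 1 := by rw [sub_pos, lt_div_iff₀ hq0]; linarith
    have hs0 : spow 0 q = 0 := by simp [spow]
    simp only [h0, hs0, sub_zero] at hx1 hx2
    -- Where `u t` vanishes, `|u| = |u^q|^(1/q)` with `1/q > 1`. The spare factor `|σ n - t|^(1/q -
    -- 1)` tends to zero while the quotients of `u^q` stay bounded.
    have e : ∀ n, |u (σ n) x / (σ n - t)| =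
        |σ n - t| ^ (1 / q - 1) * |spow (u (σ n) x) q / (σ n - t)| ^ (1 / q) := by
      intro n
      have hp : 0 < |σ n - t| := abs_pos.2 (hσne n)
      rw [abs_div, abs_div, abs_spow hq0, Real.div_rpow (by positivity) (by positivity),
        ← Real.rpow_mul (abs_nonneg _), mul_one_div_cancel hq0.ne', Real.rpow_one,
        Real.rpow_sub hp, Real.rpow_one]
      have : |σ n - t| ^ (1 / q) ≠ 0 := (Real.rpow_pos_of_pos hp _).ne'
      field_simp
    have l1 : Tendsto (fun n ↦ |σ n - t| ^ (1 / q - 1) *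
        |spow (u (σ n) x) q / (σ n - t)| ^ (1 / q)) atTop (𝓝 (0 * |w x| ^ (1 / q))) := by
      refine Tendsto.mul ?_ (hx2.abs.rpow_const (Or.inr (by positivity)))
      have := hσ0.abs.rpow_const (p := 1 / q - 1) (Or.inr hq'.le)
      rwa [abs_zero, Real.zero_rpow hq'.ne'] at this
    simp_rw [← e, zero_mul] at l1
    exact abs_eq_zero.1 (tendsto_nhds_unique hx1.abs l1)
  · intro hne
    have l0 : Tendsto (fun n ↦ (σ n - t)⁻¹ • (u (σ n) x - u t x)) atTop (𝓝 (ut x)) := by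
      refine hx1.congr fun n ↦ ?_
      rw [smul_eq_mul, div_eq_inv_mul]
    have ld : Tendsto (fun n ↦ u (σ n) x - u t x) atTop (𝓝 0) := by
      have := hσ0.mul hx1
      rw [zero_mul] at this
      exact this.congr fun n ↦ mul_div_cancel₀ _ (hσne n)
    have l1 := (hasFDerivWithinAt_univ.2 (hasDerivAt_spow q hne).hasFDerivAt).lim ld
      (Eventually.of_forall fun _ ↦ mem_univ _) l0
    refine tendsto_nhds_unique hx2 ?_
    simp only [add_sub_cancel, smul_eq_mul] at l1
    convert l1 using 2
    · rw [div_eq_inv_mul]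
    · simp [mul_comm]

end LpCurve

/-! ### Differentiating a convex energy along a curve by means of its subgradients. -/

section Banach

variable {X Y : Type*} [NormedAddCommGroup X] [NormedSpace ℝ X] [NormedAddCommGroup Y]
  [NormedSpace ℝ Y] {B : Y →L[ℝ] X →L[ℝ] ℝ} {E : ℝ → ℝ} {v : ℝ → X} {w : X} {f : ℝ → Y}
  {T : Set ℝ} {t : ℝ}

/-- If `B (f s)` is a subgradient of `E` along the curve `v` at every time `s`, then `E` is
differentiable at `t` as soon as the subgradients converge along the difference quotients. -/
lemma hasDerivWithinAt_of_subgradient (ht : t ∈ T)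
    (hsub : ∀ s ∈ T, ∀ s' ∈ T, E s' + B (f s') (v s - v s') ≤ E s)
    (hv : Tendsto (fun s ↦ B (f t) (slope v t s)) (𝓝[T \ {t}] t) (𝓝 (B (f t) w)))
    (hlim : Tendsto (fun s ↦ B (f s) (slope v t s)) (𝓝[T \ {t}] t) (𝓝 (B (f t) w))) :
    HasDerivWithinAt E (B (f t) w) T t := by
  rw [hasDerivWithinAt_iff_tendsto_slope, tendsto_iff_norm_sub_tendsto_zero]
  have h0 : Tendsto (fun s ↦ ‖B (f t) (slope v t s) - B (f t) w‖ +
      ‖B (f s) (slope v t s) - B (f t) w‖) (𝓝[T \ {t}] t) (𝓝 (0 + 0)) :=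
    (tendsto_iff_norm_sub_tendsto_zero.1 hv).add (tendsto_iff_norm_sub_tendsto_zero.1 hlim)
  rw [add_zero] at h0
  refine tendsto_of_tendsto_of_tendsto_of_le_of_le' tendsto_const_nhds h0
    (Eventually.of_forall fun _ ↦ norm_nonneg _) ?_
  filter_upwards [self_mem_nhdsWithin] with s hs
  -- The subgradient inequalities based at `t` and at `s` trap the slope of `E` between `B (f t)`
  -- and `B (f s)` of the slope of `v`, in an order given by the sign of `s - t`.
  have h1 := hsub s hs.1 t ht
  have h2 := hsub t ht s hs.1
  have e : v s - v t = (s - t) • slope v t s := (sub_smul_slope v t s).symm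
  have e2 : v t - v s = -((s - t) • slope v t s) := by rw [← e]; abel
  have e3 : E s - E t = (s - t) * slope E t s := (sub_smul_slope E t s).symm
  rw [e, map_smul, smul_eq_mul] at h1
  rw [e2, map_neg, map_smul, smul_eq_mul] at h2
  set x := slope E t s
  set y := B (f t) (slope v t s)
  set z := B (f s) (slope v t s)
  set d := B (f t) w
  have h1' : (s - t) * y ≤ (s - t) * x := by linarith
  have h2' : (s - t) * x ≤ (s - t) * z := by linarith
  rw [Real.norm_eq_abs, Real.norm_eq_abs, Real.norm_eq_abs]
  have ha := le_abs_self (y - d)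
  have hb := neg_abs_le (y - d)
  have hc := le_abs_self (z - d)
  have hd := neg_abs_le (z - d)
  rcases lt_or_gt_of_ne (sub_ne_zero.2 hs.2) with h | h
  · have h3 := (mul_le_mul_left_of_neg h).1 h1'
    have h4 := (mul_le_mul_left_of_neg h).1 h2'
    rw [abs_le]; constructor <;> linarith
  · have h3 := le_of_mul_le_mul_left h1' h
    have h4 := le_of_mul_le_mul_left h2' h
    rw [abs_le]; constructor <;> linarith

/-- The easy case, applied to `I`, whose subgradient is a multiple of the norm-continuous curve
`u^q`. -/
lemma hasDerivWithinAt_of_continuous_subgradient (ht : t ∈ T) (hv : HasDerivWithinAt v w T t)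
    (hf : ContinuousWithinAt f T t)
    (hsub : ∀ s ∈ T, ∀ s' ∈ T, E s' + B (f s') (v s - v s') ≤ E s) :
    HasDerivWithinAt E (B (f t) w) T t := by
  have hslope := hasDerivWithinAt_iff_tendsto_slope.1 hv
  have hf' : Tendsto f (𝓝[T \ {t}] t) (𝓝 (f t)) :=
    hf.mono_left (nhdsWithin_mono _ sdiff_subset)
  have hc : Continuous fun z : Y × X ↦ B z.1 z.2 := B.isBoundedBilinearMap.continuous
  exact hasDerivWithinAt_of_subgradient ht hsub
    (((B (f t)).continuous.tendsto _).comp hslope)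
    ((hc.tendsto (f t, w)).comp (hf'.prodMk_nhds hslope))

/-- An absorption argument: the inequality based at `s` bounds `E s` by `E t` plus `‖B‖ ‖f s‖ ‖v t -
v s‖`, and the growth hypothesis makes the last term at most half of `E s` for `s` near `t`. -/
lemma eventually_norm_le_of_subgradient (ht : t ∈ T) (hv : ContinuousWithinAt v T t)
    (hsub : ∀ s ∈ T, ∀ s' ∈ T, E s' + B (f s') (v s - v s') ≤ E s)
    {A K : ℝ} (hA : 0 ≤ A) (hK : 0 ≤ K)
    (hf : ∀ᶠ s in 𝓝[T] t, ‖f s‖ ≤ A + K * E s) :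
    ∃ R, ∀ᶠ s in 𝓝[T] t, ‖f s‖ ≤ R := by
  have h0 : Tendsto (fun s ↦ ‖B‖ * ‖v t - v s‖ * (A + K)) (𝓝[T] t) (𝓝 0) := by
    have : Tendsto (fun s ↦ ‖B‖ * ‖v t - v s‖ * (A + K)) (𝓝[T] t)
        (𝓝 (‖B‖ * ‖v t - v t‖ * (A + K))) :=
      ((tendsto_const_nhds.sub hv).norm.const_mul _).mul_const _
    simpa using this
  have h1 : ∀ᶠ s in 𝓝[T] t, ‖B‖ * ‖v t - v s‖ * (A + K) < 1 / 2 :=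
    h0.eventually_lt_const (by norm_num)
  refine ⟨A + K * (2 * |E t| + 1), ?_⟩
  filter_upwards [h1, hf, self_mem_nhdsWithin] with s hs1 hs2 hsT
  have h2 := hsub t ht s hsT
  have h3 : -(‖B‖ * ‖f s‖ * ‖v t - v s‖) ≤ B (f s) (v t - v s) := by
    have := B.le_opNorm₂ (f s) (v t - v s)
    rw [Real.norm_eq_abs] at this
    linarith [neg_abs_le (B (f s) (v t - v s))]
  refine hs2.trans ?_
  gcongr
  -- When `E s > 1` the bound `A + K E s` may be replaced by the homogeneous `(A + K) E s`, which
  -- can be absorbed.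
  by_cases hE : E s ≤ 1
  · linarith [abs_nonneg (E t)]
  push Not at hE
  set b := ‖B‖ * ‖v t - v s‖ with hb
  have hb0 : 0 ≤ b := by positivity
  have h4 : ‖B‖ * ‖f s‖ * ‖v t - v s‖ ≤ 1 / 2 * E s := by
    calc _ = b * ‖f s‖ := by rw [hb]; ring
      _ ≤ b * (A + K * E s) := by gcongr
      _ ≤ b * ((A + K) * E s) := by
        gcongr
        nlinarith
      _ = b * (A + K) * E s := by ring
      _ ≤ 1 / 2 * E s := by gcongr
  linarith [le_abs_self (E t)]

/-- Here `h ε` is meant to be the energy at `v t + ε z`. By convexity its difference quotients at a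
small positive and a small negative `ε` bound `B (f s) z` from above and below, up to terms that
vanish as `s` tends to `t`. Differentiability of `h` at zero then forces convergence. -/
lemma tendsto_subgradient_of_hasDerivAt (ht : t ∈ T) (hv : ContinuousWithinAt v T t)
    (hsub : ∀ s ∈ T, ∀ s' ∈ T, E s' + B (f s') (v s - v s') ≤ E s)
    {R : ℝ} (hf : ∀ᶠ s in 𝓝[T] t, ‖f s‖ ≤ R) {z : X} {h : ℝ → ℝ}
    (hh : HasDerivAt h (B (f t) z) 0) (h0 : h 0 = E t)
    (hle : ∀ s ∈ T, ∀ ε, E s + B (f s) (v t + ε • z - v s) ≤ h ε) :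
    Tendsto (fun s ↦ B (f s) z) (𝓝[T] t) (𝓝 (B (f t) z)) := by
  have hz : Tendsto (fun s ↦ B (f s) (v t - v s)) (𝓝[T] t) (𝓝 0) := by
    have h1 : Tendsto (fun s ↦ ‖B‖ * R * ‖v t - v s‖) (𝓝[T] t) (𝓝 0) := by
      have : Tendsto (fun s ↦ ‖B‖ * R * ‖v t - v s‖) (𝓝[T] t) (𝓝 (‖B‖ * R * ‖v t - v t‖)) :=
        (tendsto_const_nhds.sub hv).norm.const_mul _
      simpa using this
    refine squeeze_zero_norm' ?_ h1
    filter_upwards [hf] with s hs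
    refine (B.le_opNorm₂ _ _).trans ?_
    gcongr
  have hz' : Tendsto (fun s ↦ B (f t) (v s - v t)) (𝓝[T] t) (𝓝 0) := by
    have : Tendsto (fun s ↦ B (f t) (v s - v t)) (𝓝[T] t) (𝓝 (B (f t) (v t - v t))) :=
      ((B (f t)).continuous.tendsto _).comp (hv.sub tendsto_const_nhds)
    simpa using this
  -- lower bound for the energies in terms of the one at time `t`
  have key : ∀ ε : ℝ, ∀ s ∈ T, ε * B (f s) z ≤
      h ε - h 0 - B (f s) (v t - v s) - B (f t) (v s - v t) := by
    intro ε s hs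
    have h1 := hle s hs ε
    have h2 := hsub s hs t ht
    have e : v t + ε • z - v s = (v t - v s) + ε • z := by abel
    rw [e, map_add, map_smul, smul_eq_mul] at h1
    linarith
  have hr : Tendsto (fun s ↦ B (f s) (v t - v s) + B (f t) (v s - v t)) (𝓝[T] t) (𝓝 0) := by
    simpa using hz.add hz'
  rw [hasDerivAt_iff_tendsto_slope_zero] at hh
  rw [Metric.tendsto_nhds]
  intro δ hδ
  have hev := Metric.tendsto_nhds.1 hh (δ / 2) (by positivity)
  rw [eventually_nhdsWithin_iff, Metric.eventually_nhds_iff] at hev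
  obtain ⟨ρ, hρ, hev⟩ := hev
  have hp := hev (y := ρ / 2) (by rw [Real.dist_eq, sub_zero, abs_of_pos] <;> linarith)
    (by simp; linarith)
  have hm := hev (y := -(ρ / 2)) (by rw [Real.dist_eq, sub_zero, abs_neg, abs_of_pos] <;> linarith)
    (by simp; linarith)
  rw [Real.dist_eq, abs_lt, zero_add, smul_eq_mul] at hp hm
  -- Divided by the step `ρ / 2`, this remainder contributes `δ / 2`; the difference quotient
  -- contributes the other half.
  filter_upwards [Metric.tendsto_nhds.1 hr (δ * ρ / 4) (by positivity), self_mem_nhdsWithin]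
    with s hs hsT
  rw [Real.dist_eq, sub_zero, abs_lt] at hs
  have k1 := key (ρ / 2) s hsT
  have k2 := key (-(ρ / 2)) s hsT
  rw [Real.dist_eq, abs_lt]
  have e1 : h (ρ / 2) - h 0 = (ρ / 2) * ((ρ / 2)⁻¹ * (h (ρ / 2) - h 0)) := by
    field_simp
  have e2 : h (-(ρ / 2)) - h 0 = -(ρ / 2) * ((-(ρ / 2))⁻¹ * (h (-(ρ / 2)) - h 0)) := by
    field_simp
  rw [e1] at k1
  rw [e2] at k2
  set a := (ρ / 2)⁻¹ * (h (ρ / 2) - h 0)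
  set b := (-(ρ / 2))⁻¹ * (h (-(ρ / 2)) - h 0)
  set x := B (f s) z
  set y := B (f t) z
  have hρ2 : 0 < ρ / 2 := by positivity
  constructor
  · by_contra hcon
    push Not at hcon
    nlinarith
  · by_contra hcon
    push Not at hcon
    nlinarith

/-- No norm continuity of `f` is available, and the energy need not be differentiable in the
direction `w`. The directions `v s' - v t` suffice: slopes of `v` approximate `w` in norm, and the
subgradients are bounded. -/
lemma hasDerivWithinAt_of_subgradient_of_directional (ht : t ∈ T)
    (hv : HasDerivWithinAt v w T t)
    (hsub : ∀ s ∈ T, ∀ s' ∈ T, E s' + B (f s') (v s - v s') ≤ E s)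
    {A K : ℝ} (hA : 0 ≤ A) (hK : 0 ≤ K) (hf : ∀ᶠ s in 𝓝[T] t, ‖f s‖ ≤ A + K * E s)
    (hdir : ∀ s' ∈ T, ∃ h : ℝ → ℝ, HasDerivAt h (B (f t) (v s' - v t)) 0 ∧ h 0 = E t ∧
      ∀ s ∈ T, ∀ ε, E s + B (f s) (v t + ε • (v s' - v t) - v s) ≤ h ε) :
    HasDerivWithinAt E (B (f t) w) T t := by
  have hvc := hv.continuousWithinAt
  obtain ⟨R, hR⟩ := eventually_norm_le_of_subgradient ht hvc hsub hA hK hf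
  have hslope := hasDerivWithinAt_iff_tendsto_slope.1 hv
  have hle : 𝓝[T \ {t}] t ≤ 𝓝[T] t := nhdsWithin_mono _ sdiff_subset
  have hweak : ∀ s' ∈ T, Tendsto (fun s ↦ B (f s) (slope v t s')) (𝓝[T \ {t}] t)
      (𝓝 (B (f t) (slope v t s'))) := by
    intro s' hs'
    obtain ⟨h, h1, h2, h3⟩ := hdir s' hs'
    have := (tendsto_subgradient_of_hasDerivAt ht hvc hsub hR h1 h2 h3).mono_left hle
    simp only [slope_def_module, map_smul]
    exact this.const_smul _
  refine hasDerivWithinAt_of_subgradient ht hsub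
    (((B (f t)).continuous.tendsto _).comp hslope) ?_
  rw [Metric.tendsto_nhds]
  intro δ hδ
  have hR1 : 0 < ‖B‖ * (|R| + ‖f t‖) + 1 := by positivity
  set η := δ / (4 * (‖B‖ * (|R| + ‖f t‖) + 1)) with hη
  have hη0 : 0 < η := by positivity
  have hclose := Metric.tendsto_nhds.1 hslope η hη0
  rcases eq_or_neBot (𝓝[T \ {t}] t) with hbot | hne
  · rw [hbot]; exact eventually_bot
  -- A single time `s'` is frozen whose slope is close to `w`; weak convergence is used for this
  -- slope only.
  obtain ⟨s', hs', hs'T⟩ := (hclose.and self_mem_nhdsWithin).exists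
  filter_upwards [hclose, Metric.tendsto_nhds.1 (hweak s' hs'T.1) (δ / 4) (by positivity),
    hR.filter_mono hle] with s hs1 hs2 hs3
  rw [dist_eq_norm] at *
  have e : B (f s) (slope v t s) - B (f t) w =
      B (f s) (slope v t s - w) - B (f s) (slope v t s' - w) +
      (B (f s) (slope v t s') - B (f t) (slope v t s')) + B (f t) (slope v t s' - w) := by
    simp only [map_sub]; ring
  have hb : ∀ g : Y, ‖g‖ ≤ |R| + ‖f t‖ → ∀ y : X, ‖y‖ < η → ‖B g y‖ ≤ δ / 4 := by
    intro g hg y hy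
    calc ‖B g y‖ ≤ ‖B‖ * ‖g‖ * ‖y‖ := B.le_opNorm₂ _ _
      _ ≤ ‖B‖ * (|R| + ‖f t‖) * η := by gcongr
      _ ≤ (‖B‖ * (|R| + ‖f t‖) + 1) * η := by gcongr; linarith
      _ = δ / 4 := by rw [hη]; field_simp
  have hfs : ‖f s‖ ≤ |R| + ‖f t‖ := by
    linarith [le_abs_self R, norm_nonneg (f t)]
  have n1 := hb _ hfs _ hs1
  have n2 := hb _ hfs _ hs'
  have n3 := hb (f t) (by linarith [abs_nonneg R]) _ hs'
  rw [e]
  calc _ ≤ ‖B (f s) (slope v t s - w)‖ + ‖B (f s) (slope v t s' - w)‖ +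
        ‖B (f s) (slope v t s') - B (f t) (slope v t s')‖ + ‖B (f t) (slope v t s' - w)‖ :=
        (norm_add_le _ _).trans (by
          gcongr
          refine (norm_add_le _ _).trans ?_
          gcongr
          exact norm_sub_le _ _)
    _ < δ := by linarith

end Banach

/-! ### Curves of functions as curves in the Banach spaces `L^r`, and their duality. -/

section ToLp

variable {α : Type*} [MeasurableSpace α] {μ : Measure α}

open Classical in
/-- The class of `g` in `L^r(μ)`, or zero if `g` is not in this space. -/
noncomputable def toLpOrZero (r : ℝ≥0∞) (μ : Measure α) (g : α → ℝ) : Lp ℝ r μ :=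
  if h : MemLp g r μ then h.toLp g else 0

lemma coeFn_toLpOrZero {r : ℝ≥0∞} {g : α → ℝ} (h : MemLp g r μ) :
    toLpOrZero r μ g =ᵐ[μ] g := by
  rw [toLpOrZero, dif_pos h]
  exact h.coeFn_toLp

lemma norm_toLpOrZero {r : ℝ≥0∞} {g : α → ℝ} (h : MemLp g r μ) :
    ‖toLpOrZero r μ g‖ = (eLpNorm g r μ).toReal := by
  rw [toLpOrZero, dif_pos h, Lp.norm_toLp]

lemma toLpOrZero_eq {r : ℝ≥0∞} {g : α → ℝ} {G : Lp ℝ r μ} (h : MemLp g r μ) (hG : G =ᵐ[μ] g) :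
    G = toLpOrZero r μ g :=
  Lp.ext (hG.trans (coeFn_toLpOrZero h).symm)

lemma toLpOrZero_sub {r : ℝ≥0∞} {g h : α → ℝ} (hg : MemLp g r μ) (hh : MemLp h r μ) :
    toLpOrZero r μ g - toLpOrZero r μ h = toLpOrZero r μ (fun x ↦ g x - h x) := by
  refine toLpOrZero_eq (hg.sub hh) ?_
  filter_upwards [Lp.coeFn_sub (toLpOrZero r μ g) (toLpOrZero r μ h), coeFn_toLpOrZero hg,
    coeFn_toLpOrZero hh] with x h1 h2 h3
  rw [h1, Pi.sub_apply, h2, h3]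

lemma toLpOrZero_smul {r : ℝ≥0∞} {g : α → ℝ} (c : ℝ) (hg : MemLp g r μ) :
    c • toLpOrZero r μ g = toLpOrZero r μ (fun x ↦ c * g x) := by
  refine toLpOrZero_eq (hg.const_mul c) ?_
  filter_upwards [Lp.coeFn_smul c (toLpOrZero r μ g), coeFn_toLpOrZero hg] with x h1 h2
  rw [h1, Pi.smul_apply, h2, smul_eq_mul]

lemma HasLpDerivWithinAt.hasDerivWithinAt {r : ℝ} [Fact (1 ≤ ENNReal.ofReal r)]
    {u : ℝ → α → ℝ} {w : α → ℝ} {T : Set ℝ} {t : ℝ} (ht : t ∈ T)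
    (h : HasLpDerivWithinAt r μ u w T t) :
    HasDerivWithinAt (fun s ↦ toLpOrZero (ENNReal.ofReal r) μ (u s))
      (toLpOrZero (ENNReal.ofReal r) μ w) T t := by
  rw [hasDerivWithinAt_iff_tendsto_slope, tendsto_iff_norm_sub_tendsto_zero]
  have h0 := (ENNReal.tendsto_toReal ENNReal.zero_ne_top).comp h.2.2
  rw [ENNReal.toReal_zero] at h0
  refine h0.congr' ?_
  filter_upwards [self_mem_nhdsWithin] with s hs
  have hs1 := h.1 s hs.1
  have ht1 := h.1 t ht
  have h1 : MemLp (fun x ↦ u s x - u t x) (ENNReal.ofReal r) μ := hs1.sub ht1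
  have h2 : MemLp (fun x ↦ (s - t)⁻¹ * (u s x - u t x)) (ENNReal.ofReal r) μ := h1.const_mul _
  have h3 : MemLp (fun x ↦ (s - t)⁻¹ * (u s x - u t x) - w x) (ENNReal.ofReal r) μ :=
    h2.sub h.2.1
  rw [slope_def_module, toLpOrZero_sub hs1 ht1, toLpOrZero_smul _ h1, toLpOrZero_sub h2 h.2.1,
    norm_toLpOrZero h3]
  simp only [Function.comp]
  congr 2
  ext x
  rw [div_eq_inv_mul]

/-- The duality pairing of two Lebesgue spaces with conjugate exponents. -/
noncomputable def lpDual (P R : ℝ≥0∞) (μ : Measure α) [P.HolderConjugate R] [Fact (1 ≤ P)]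
    [Fact (1 ≤ R)] : Lp ℝ P μ →L[ℝ] Lp ℝ R μ →L[ℝ] ℝ :=
  (ContinuousLinearMap.mul ℝ ℝ).lpPairing μ P R

lemma lpDual_toLpOrZero {P R : ℝ≥0∞} [P.HolderConjugate R] [Fact (1 ≤ P)] [Fact (1 ≤ R)]
    {f g : α → ℝ} (hf : MemLp f P μ) (hg : MemLp g R μ) :
    lpDual P R μ (toLpOrZero P μ f) (toLpOrZero R μ g) = ∫ x, f x * g x ∂μ := by
  rw [lpDual, ContinuousLinearMap.lpPairing_eq_integral]
  apply integral_congr_ae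
  filter_upwards [coeFn_toLpOrZero hf, coeFn_toLpOrZero hg] with x h1 h2
  simp [h1, h2]

end ToLp

/-! ### Convexity and differentiability of `‖·‖^p` on an inner product space. -/

section NormRpow

variable {F : Type*} [NormedAddCommGroup F] [InnerProductSpace ℝ F] {p : ℝ}

lemma abs_norm_rpow_mul_inner_le (hp : 1 < p) (a b : F) :
    |‖a‖ ^ (p - 2) * inner ℝ a b| ≤ ‖a‖ ^ (p - 1) * ‖b‖ := by
  rw [abs_mul, abs_of_nonneg (by positivity)]
  have h := rpow_sub_one_mul_self (q := p - 1) (by linarith) (norm_nonneg a)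
  rw [show p - 1 - 1 = p - 2 by ring] at h
  calc _ ≤ ‖a‖ ^ (p - 2) * (‖a‖ * ‖b‖) := by gcongr; exact abs_real_inner_le_norm a b
    _ = _ := by rw [← mul_assoc, h]

lemma norm_rpow_mul_inner_self (hp : 1 < p) (a : F) :
    ‖a‖ ^ (p - 2) * inner ℝ a a = ‖a‖ ^ p := by
  have h := rpow_sub_one_mul_sq (q := p - 1) (by linarith) (norm_nonneg a)
  rw [show p - 1 - 1 = p - 2 by ring, sub_add_cancel] at h
  rw [real_inner_self_eq_norm_sq, h]

lemma norm_rpow_sub_one_mul_le (hp : 1 < p) (a b : F) :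
    ‖a‖ ^ (p - 1) * ‖b‖ ≤ (p - 1) / p * ‖a‖ ^ p + 1 / p * ‖b‖ ^ p := by
  have := rpow_mul_rpow_le_of_add_eq (s := p - 1) (t := 1) (m := p) (norm_nonneg a)
    (norm_nonneg b) (by linarith) zero_le_one (by linarith) (by ring)
  rwa [Real.rpow_one] at this

/-- The supporting-hyperplane inequality of the convex function `‖·‖^p`, obtained from
Cauchy-Schwarz and Young. -/
lemma norm_rpow_add_inner_le (hp : 1 < p) (a b : F) :
    ‖a‖ ^ p + p * (‖a‖ ^ (p - 2) * inner ℝ a (b - a)) ≤ ‖b‖ ^ p := by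
  have h1 := (le_abs_self _).trans (abs_norm_rpow_mul_inner_le hp a b)
  have h2 := norm_rpow_sub_one_mul_le hp a b
  have h3 := norm_rpow_mul_inner_self hp a
  rw [inner_sub_right, mul_sub, h3]
  have h4 : p * (‖a‖ ^ (p - 2) * inner ℝ a b) ≤
      p * ((p - 1) / p * ‖a‖ ^ p + 1 / p * ‖b‖ ^ p) := by
    gcongr; exact h1.trans h2
  have h5 : p * ((p - 1) / p * ‖a‖ ^ p + 1 / p * ‖b‖ ^ p) = (p - 1) * ‖a‖ ^ p + ‖b‖ ^ p := by
    field_simp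
  linarith

lemma hasDerivAt_norm_add_smul_rpow (hp : 1 < p) (a b : F) (ε : ℝ) :
    HasDerivAt (fun ε : ℝ ↦ ‖a + ε • b‖ ^ p)
      (p * (‖a + ε • b‖ ^ (p - 2) * inner ℝ (a + ε • b) b)) ε := by
  have h1 := hasFDerivAt_norm_rpow (a + ε • b) hp
  have h2 : HasDerivAt (fun ε : ℝ ↦ a + ε • b) b ε := by
    simpa using ((hasDerivAt_id ε).smul_const b).const_add a
  refine (h1.comp_hasDerivAt ε h2).congr_deriv ?_
  rw [smul_apply, innerSL_apply_apply, smul_eq_mul, mul_assoc]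

end NormRpow

/-! ### The functional `∫ ‖V‖^p` on fields with values in varying inner product spaces. -/

section Fields

variable {α : Type*} [MeasurableSpace α] {μ : Measure α} {E : α → Type*}
  [∀ x, NormedAddCommGroup (E x)] [∀ x, InnerProductSpace ℝ (E x)] {p : ℝ}
  {V W : ∀ x, E x}

lemma integrable_norm_rpow (hp : 1 < p) (hV : MemLp (fun x ↦ ‖V x‖) (ENNReal.ofReal p) μ) :
    Integrable (fun x ↦ ‖V x‖ ^ p) μ := by
  simpa using integrable_abs_rpow (by linarith) hV

lemma integrable_norm_rpow_mul_inner (hp : 1 < p)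
    (hV : MemLp (fun x ↦ ‖V x‖) (ENNReal.ofReal p) μ)
    (hW : MemLp (fun x ↦ ‖W x‖) (ENNReal.ofReal p) μ)
    (hVW : AEStronglyMeasurable (fun x ↦ inner ℝ (V x) (W x)) μ) :
    Integrable (fun x ↦ ‖V x‖ ^ (p - 2) * inner ℝ (V x) (W x)) μ := by
  have hm : AEStronglyMeasurable (fun x ↦ ‖V x‖ ^ (p - 2)) μ := by
    have := hV.1.aemeasurable
    exact AEMeasurable.aestronglyMeasurable (by fun_prop)
  refine (((integrable_norm_rpow hp hV).const_mul ((p - 1) / p)).add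
    ((integrable_norm_rpow hp hW).const_mul (1 / p))).mono' (hm.mul hVW) ?_
  filter_upwards with x
  exact (abs_norm_rpow_mul_inner_le hp _ _).trans (norm_rpow_sub_one_mul_le hp _ _)

/-- The values lie in unrelated fibres, so measurability of a field is expressed through scalar
products only. -/
lemma aestronglyMeasurable_norm_of_inner_self
    (hVV : AEStronglyMeasurable (fun x ↦ inner ℝ (V x) (V x)) μ) :
    AEStronglyMeasurable (fun x ↦ ‖V x‖) μ := by
  have e : (fun x ↦ ‖V x‖) = fun x ↦ √(inner ℝ (V x) (V x)) := by
    ext x; rw [norm_eq_sqrt_real_inner]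
  rw [e]
  exact (hVV.aemeasurable.sqrt).aestronglyMeasurable

lemma aestronglyMeasurable_norm_add_smul
    (hVV : AEStronglyMeasurable (fun x ↦ inner ℝ (V x) (V x)) μ)
    (hVW : AEStronglyMeasurable (fun x ↦ inner ℝ (V x) (W x)) μ)
    (hWW : AEStronglyMeasurable (fun x ↦ inner ℝ (W x) (W x)) μ) (ε : ℝ) :
    AEStronglyMeasurable (fun x ↦ ‖V x + ε • W x‖) μ := by
  apply aestronglyMeasurable_norm_of_inner_self (V := fun x ↦ V x + ε • W x)
  have e : (fun x ↦ inner ℝ (V x + ε • W x) (V x + ε • W x)) = fun x ↦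
      inner ℝ (V x) (V x) + 2 * ε * inner ℝ (V x) (W x) + ε ^ 2 * inner ℝ (W x) (W x) := by
    ext x
    rw [inner_add_left, inner_add_right, inner_add_right, inner_smul_right, inner_smul_left,
      inner_smul_left, inner_smul_right, real_inner_comm (V x) (W x)]
    simp
    ring
  rw [e]
  exact (hVV.add (hVW.const_mul _)).add (hWW.const_mul _)

lemma memLp_norm_add_smul
    (hV : MemLp (fun x ↦ ‖V x‖) (ENNReal.ofReal p) μ)
    (hW : MemLp (fun x ↦ ‖W x‖) (ENNReal.ofReal p) μ)
    (hVV : AEStronglyMeasurable (fun x ↦ inner ℝ (V x) (V x)) μ)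
    (hVW : AEStronglyMeasurable (fun x ↦ inner ℝ (V x) (W x)) μ)
    (hWW : AEStronglyMeasurable (fun x ↦ inner ℝ (W x) (W x)) μ) (ε : ℝ) :
    MemLp (fun x ↦ ‖V x + ε • W x‖) (ENNReal.ofReal p) μ := by
  refine (hV.add (hW.const_mul |ε|)).mono (aestronglyMeasurable_norm_add_smul hVV hVW hWW ε) ?_
  filter_upwards with x
  rw [norm_norm]
  refine le_trans ?_ (le_abs_self _)
  refine (norm_add_le _ _).trans ?_
  rw [norm_smul, Real.norm_eq_abs]
  rfl

/-- Differentiation under the integral, dominated for `|ε| < 1` by a multiple of `(‖V‖ + ‖W‖)^p`. -/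
lemma hasDerivAt_integral_norm_rpow (hp : 1 < p)
    (hV : MemLp (fun x ↦ ‖V x‖) (ENNReal.ofReal p) μ)
    (hW : MemLp (fun x ↦ ‖W x‖) (ENNReal.ofReal p) μ)
    (hVV : AEStronglyMeasurable (fun x ↦ inner ℝ (V x) (V x)) μ)
    (hVW : AEStronglyMeasurable (fun x ↦ inner ℝ (V x) (W x)) μ)
    (hWW : AEStronglyMeasurable (fun x ↦ inner ℝ (W x) (W x)) μ) :
    HasDerivAt (fun ε : ℝ ↦ ∫ x, ‖V x + ε • W x‖ ^ p ∂μ)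
      (p * ∫ x, ‖V x‖ ^ (p - 2) * inner ℝ (V x) (W x) ∂μ) 0 := by
  have hm : ∀ ε : ℝ, AEStronglyMeasurable (fun x ↦ ‖V x + ε • W x‖ ^ p) μ := fun ε ↦ by
    have := (aestronglyMeasurable_norm_add_smul hVV hVW hWW ε).aemeasurable
    exact AEMeasurable.aestronglyMeasurable (by fun_prop)
  have h := hasDerivAt_integral_of_dominated_loc_of_deriv_le (μ := μ) (x₀ := (0 : ℝ))
    (F := fun ε x ↦ ‖V x + ε • W x‖ ^ p)
    (F' := fun ε x ↦ p * (‖V x + ε • W x‖ ^ (p - 2) * inner ℝ (V x + ε • W x) (W x)))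
    (bound := fun x ↦ p * (‖V x‖ + ‖W x‖) ^ p) (s := Metric.ball 0 1)
    (Metric.ball_mem_nhds _ one_pos) (Eventually.of_forall hm) ?_ ?_ ?_ ?_ ?_
  · refine h.2.congr_deriv ?_
    rw [← integral_const_mul]
    congr with x
    simp
  · simpa using integrable_norm_rpow hp hV
  · simp only [zero_smul, add_zero]
    exact ((integrable_norm_rpow_mul_inner hp hV hW hVW).const_mul p).1
  · filter_upwards with x ε hε
    rw [Metric.mem_ball, dist_zero_right, Real.norm_eq_abs] at hε
    rw [norm_mul, Real.norm_of_nonneg (by linarith : 0 ≤ p)]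
    gcongr
    refine (abs_norm_rpow_mul_inner_le hp _ _).trans ?_
    have h1 : ‖V x + ε • W x‖ ≤ ‖V x‖ + ‖W x‖ := by
      refine (norm_add_le _ _).trans ?_
      rw [norm_smul, Real.norm_eq_abs]
      gcongr
      exact mul_le_of_le_one_left (norm_nonneg _) hε.le
    have h2 := rpow_sub_one_mul_self (q := p) (by linarith)
      (add_nonneg (norm_nonneg (V x)) (norm_nonneg (W x)))
    rw [← h2]
    exact mul_le_mul (Real.rpow_le_rpow (norm_nonneg _) h1 (by linarith))
      (by linarith [norm_nonneg (V x)]) (norm_nonneg _) (by positivity)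
  · have := integrable_abs_rpow (by linarith) (hV.add hW)
    refine (this.const_mul p).congr ?_
    filter_upwards with x
    rw [Pi.add_apply, abs_of_nonneg (by positivity)]
  · filter_upwards with x ε _
    exact hasDerivAt_norm_add_smul_rpow hp _ _ _

lemma integral_norm_rpow_add_le (hp : 1 < p)
    (hV : MemLp (fun x ↦ ‖V x‖) (ENNReal.ofReal p) μ)
    (hW : MemLp (fun x ↦ ‖W x‖) (ENNReal.ofReal p) μ)
    (hVW : AEStronglyMeasurable (fun x ↦ inner ℝ (V x) (W x)) μ)
    (hVV : AEStronglyMeasurable (fun x ↦ inner ℝ (V x) (V x)) μ) :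
    ∫ x, ‖V x‖ ^ p ∂μ + p * (∫ x, ‖V x‖ ^ (p - 2) * inner ℝ (V x) (W x) ∂μ -
      ∫ x, ‖V x‖ ^ (p - 2) * inner ℝ (V x) (V x) ∂μ) ≤ ∫ x, ‖W x‖ ^ p ∂μ := by
  have i1 := integrable_norm_rpow_mul_inner hp hV hW hVW
  have i2 := integrable_norm_rpow_mul_inner hp hV hV hVV
  have i3 := integrable_norm_rpow hp hV
  have i12 : Integrable (fun x ↦ p * (‖V x‖ ^ (p - 2) * inner ℝ (V x) (W x) -
      ‖V x‖ ^ (p - 2) * inner ℝ (V x) (V x))) μ := (i1.sub i2).const_mul p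
  rw [← integral_sub i1 i2, ← integral_const_mul, ← integral_add i3 i12]
  refine integral_mono (i3.add i12) (integrable_norm_rpow hp hW) fun x ↦ ?_
  have := norm_rpow_add_inner_le hp (V x) (W x)
  rw [inner_sub_right, mul_sub] at this
  exact this

end Fields

/-! ### Bounds for the `p`-Laplacian in terms of the energy. -/

section

variable {α : Type*} [MeasurableSpace α] {μ : Measure α} {p q c : ℝ} {u ut f G : α → ℝ}

/-- The norm is the energy to the power `1/(q+1) ≤ 1`. It is weakened to an affine bound, the form
of growth that `eventually_norm_le_of_subgradient` accepts. -/
lemma toReal_eLpNorm_rpow_div_le (hp : 1 < p) (hq : 0 < q) (hG : MemLp G (ENNReal.ofReal p) μ)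
    (hG0 : ∀ x, 0 ≤ G x) :
    (eLpNorm (fun x ↦ G x ^ (p / (q + 1))) (ENNReal.ofReal (q + 1)) μ).toReal ≤
      1 + ∫ x, G x ^ p ∂μ := by
  have hq1 : 0 < q + 1 := by linarith
  rw [(memLp_rpow_div hp hq hG hG0).eLpNorm_eq_integral_rpow_norm (by simpa using hq1) (by simp),
    ENNReal.toReal_ofReal hq1.le, ENNReal.toReal_ofReal (by positivity)]
  have e : ∀ x, ‖G x ^ (p / (q + 1))‖ ^ (q + 1) = G x ^ p := fun x ↦ by
    rw [Real.norm_of_nonneg (Real.rpow_nonneg (hG0 x) _), rpow_div_rpow_self hq (hG0 x)]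
  simp_rw [e]
  have h0 : 0 ≤ ∫ x, G x ^ p ∂μ := integral_nonneg fun x ↦ Real.rpow_nonneg (hG0 x) _
  calc _ ≤ (1 + ∫ x, G x ^ p ∂μ) ^ (q + 1)⁻¹ := by gcongr; linarith
    _ ≤ (1 + ∫ x, G x ^ p ∂μ) ^ (1 : ℝ) := by
      apply Real.rpow_le_rpow_of_exponent_le (by linarith)
      apply inv_le_one_of_one_le₀; linarith
    _ = _ := Real.rpow_one _

lemma toReal_eLpNorm_le_of_errorBound (hp : 1 < p) (hq : 0 < q) (hc : 0 ≤ c)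
    (hu : MemLp u (ENNReal.ofReal (q + 1)) μ) (hut : MemLp ut (ENNReal.ofReal (q + 1)) μ)
    (hf : AEStronglyMeasurable f μ) (hG : MemLp G (ENNReal.ofReal p) μ) (hG0 : ∀ x, 0 ≤ G x)
    (hE : ∀ᵐ x ∂μ, |ut x - f x| ≤ errorBound p q c |u x| (G x)) :
    (eLpNorm f (ENNReal.ofReal (q + 1)) μ).toReal ≤
      (eLpNorm ut (ENNReal.ofReal (q + 1)) μ).toReal +
        c * (2 * (eLpNorm u (ENNReal.ofReal (q + 1)) μ).toReal + (1 + ∫ x, G x ^ p ∂μ)) := by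
  have hP1 : 1 ≤ ENNReal.ofReal (q + 1) := by rw [ENNReal.one_le_ofReal]; linarith
  set P := ENNReal.ofReal (q + 1)
  have hb := memLp_rpow_div (q := q) hp hq hG hG0
  set b : α → ℝ := fun x ↦ G x ^ (p / (q + 1))
  have h1 : eLpNorm f P μ ≤ eLpNorm ut P μ + ENNReal.ofReal c *
      (2 * eLpNorm u P μ + eLpNorm b P μ) := by
    calc eLpNorm f P μ = eLpNorm (ut - (ut - f)) P μ := by simp
      _ ≤ eLpNorm ut P μ + eLpNorm (ut - f) P μ := eLpNorm_sub_le hut.1 (hut.1.sub hf) hP1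
      _ ≤ eLpNorm ut P μ + eLpNorm (c • ((2 : ℝ) • (fun x ↦ |u x|) + b)) P μ := by
        gcongr 1
        refine eLpNorm_mono_ae ?_
        filter_upwards [hE] with x hx
        exact (hx.trans (errorBound_le_add hq hc (abs_nonneg _) (hG0 x))).trans (le_abs_self _)
      _ ≤ eLpNorm ut P μ + ENNReal.ofReal c *
          (eLpNorm ((2 : ℝ) • (fun x ↦ |u x|)) P μ + eLpNorm b P μ) := by
        rw [eLpNorm_const_smul, Real.enorm_eq_ofReal hc]
        gcongr
        exact eLpNorm_add_le (hu.abs.1.const_smul _) hb.1 hP1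
      _ = _ := by
        rw [eLpNorm_const_smul, Real.enorm_eq_ofReal zero_le_two]
        have : eLpNorm (fun x ↦ |u x|) P μ = eLpNorm u P μ := eLpNorm_norm u
        rw [this]
        norm_num
  have h2 := ENNReal.toReal_mono (by finiteness [hut.2, hu.2, hb.2]) h1
  rw [ENNReal.toReal_add (by finiteness [hut.2]) (by finiteness [hu.2, hb.2]),
    ENNReal.toReal_mul, ENNReal.toReal_add (by finiteness [hu.2]) (by finiteness [hb.2]),
    ENNReal.toReal_mul, ENNReal.toReal_ofReal hc] at h2
  refine h2.trans ?_
  have h3 := toReal_eLpNorm_rpow_div_le (q := q) hp hq hG hG0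
  simp only [ENNReal.toReal_ofNat]
  gcongr

end

/-! ### Differentiability of `I` and `D`, and monotonicity of the frequency given integration by
parts. -/

section Evolution

variable {α : Type*} [MeasurableSpace α] {μ : Measure α} {E : α → Type*}
  [∀ x, NormedAddCommGroup (E x)] [∀ x, InnerProductSpace ℝ (E x)] {p q : ℝ} {T : Set ℝ}
  {C : ℝ → ℝ} {u ut f : ℝ → α → ℝ} {V : ℝ → ∀ x, E x} {t : ℝ}

/-- The functional `∫ |u|^(q+1)` is convex with subgradient `(q+1) u^q`. Differentiability of `u^q`
serves only to make the subgradient continuous in time. -/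
lemma hasDerivWithinAt_integral_abs_rpow (hq : 0 < q) (ht : t ∈ T)
    (hut : HasLpDerivWithinAt (q + 1) μ u (ut t) T t) {w : α → ℝ}
    (hvt : HasLpDerivWithinAt ((q + 1) / q) μ (fun s x ↦ spow (u s x) q) w T t) :
    HasDerivWithinAt (fun s ↦ ∫ x, |u s x| ^ (q + 1) ∂μ)
      ((q + 1) * ∫ x, spow (u t x) q * ut t x ∂μ) T t := by
  have hP := holderConjugate_ofReal hq
  have hP1 : Fact (1 ≤ ENNReal.ofReal (q + 1)) := ⟨by rw [ENNReal.one_le_ofReal]; linarith⟩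
  have hR1 : Fact (1 ≤ ENNReal.ofReal ((q + 1) / q)) :=
    ⟨by rw [ENNReal.one_le_ofReal, le_div_iff₀ hq]; linarith⟩
  have hP' : ENNReal.HolderConjugate (ENNReal.ofReal ((q + 1) / q)) (ENNReal.ofReal (q + 1)) :=
    hP.symm
  set P := ENNReal.ofReal (q + 1)
  set R := ENNReal.ofReal ((q + 1) / q)
  have hd := hut.hasDerivWithinAt ht
  have hd2 := hvt.hasDerivWithinAt ht
  have hm : ∀ s ∈ T, MemLp (u s) P μ := hut.1
  have hv : ∀ s ∈ T, MemLp (fun x ↦ spow (u s x) q) R μ := hvt.1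
  let B := (q + 1) • lpDual R P μ
  have hB : ∀ s ∈ T, ∀ g : α → ℝ, MemLp g P μ → B (toLpOrZero R μ (fun x ↦ spow (u s x) q))
      (toLpOrZero P μ g) = (q + 1) * ∫ x, spow (u s x) q * g x ∂μ := by
    intro s hs g hg
    simp only [B, smul_apply, smul_eq_mul]
    rw [lpDual_toLpOrZero (hv s hs) hg]
  have key := hasDerivWithinAt_of_continuous_subgradient (B := B) (E := fun s ↦ ∫ x, |u s x| ^ (q + 1) ∂μ)
    (v := fun s ↦ toLpOrZero P μ (u s)) (f := fun s ↦ toLpOrZero R μ (fun x ↦ spow (u s x) q))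
    (w := toLpOrZero P μ (ut t)) ht hd hd2.continuousWithinAt ?_
  · rwa [hB t ht _ hut.2.1] at key
  · intro s hs s' hs'
    have hss : MemLp (fun x ↦ u s x - u s' x) P μ := (hm s hs).sub (hm s' hs')
    rw [toLpOrZero_sub (hm s hs) (hm s' hs'), hB s' hs' _ hss]
    have i1 := integrable_abs_rpow (by linarith) (hm s hs)
    have i2 := integrable_abs_rpow (by linarith) (hm s' hs')
    have i3 : Integrable (fun x ↦ spow (u s' x) q * (u s x - u s' x)) μ := by
      simpa only [mul_comm] using integrable_mul_of_memLp hq hss (hv s' hs')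
    rw [← integral_const_mul, ← integral_add i2 (i3.const_mul _)]
    refine integral_mono (i2.add (i3.const_mul _)) i1 fun x ↦ ?_
    have := norm_rpow_add_inner_le (p := q + 1) (by linarith) (u s' x) (u s x)
    rw [show q + 1 - 2 = q - 1 by ring] at this
    refine le_trans (le_of_eq ?_) this
    simp only [spow, Real.norm_eq_abs]
    rw [real_inner_eq_re_inner, RCLike.inner_apply]
    simp only [conj_trivial, RCLike.re_to_real]
    ring

/-- The energy identity `d/dt ∫ |V|^p = -p ∫ f w`, where `f` is the `p`-Laplacian and `w` the time
derivative of `u^q`. -/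
lemma hasDerivWithinAt_integral_norm_rpow (hp : 1 < p) (hq : 0 < q) (ht : t ∈ T)
    (hC : ContinuousOn C T) (hC0 : ∀ s ∈ T, 0 ≤ C s)
    (hut : ∀ s ∈ T, HasLpDerivWithinAt (q + 1) μ u (ut s) T s)
    (hutc : LpContinuousOn (q + 1) μ ut T) {w : α → ℝ}
    (hvt : HasLpDerivWithinAt ((q + 1) / q) μ (fun s x ↦ spow (u s x) q) w T t)
    (hVp : ∀ s ∈ T, MemLp (fun x ↦ ‖V s x‖) (ENNReal.ofReal p) μ)
    (hVm : ∀ s ∈ T, ∀ s' ∈ T, AEStronglyMeasurable (fun x ↦ inner ℝ (V s x) (V s' x)) μ)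
    (hf : ∀ s ∈ T, AEStronglyMeasurable (f s) μ)
    (hE : ∀ s ∈ T, ∀ᵐ x ∂μ, |ut s x - f s x| ≤ errorBound p q (C s) |u s x| ‖V s x‖)
    (hibp : ∀ s ∈ T, ∀ s' ∈ T, ∫ x, f s x * spow (u s' x) q ∂μ =
      -∫ x, ‖V s x‖ ^ (p - 2) * inner ℝ (V s x) (V s' x) ∂μ) :
    HasDerivWithinAt (fun s ↦ ∫ x, ‖V s x‖ ^ p ∂μ) (-(p * ∫ x, f t x * w x ∂μ)) T t := by
  have hP := holderConjugate_ofReal hq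
  have hP1 : Fact (1 ≤ ENNReal.ofReal (q + 1)) := ⟨by rw [ENNReal.one_le_ofReal]; linarith⟩
  have hR1 : Fact (1 ≤ ENNReal.ofReal ((q + 1) / q)) :=
    ⟨by rw [ENNReal.one_le_ofReal, le_div_iff₀ hq]; linarith⟩
  have hm : ∀ s ∈ T, MemLp (u s) (ENNReal.ofReal (q + 1)) μ := (hut t ht).1
  have hfm : ∀ s ∈ T, MemLp (f s) (ENNReal.ofReal (q + 1)) μ := fun s hs ↦
    memLp_of_abs_sub_le_errorBound hp hq (hC0 s hs) (hm s hs) (hut s hs).2.1 (hf s hs) (hVp s hs)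
      (fun _ ↦ norm_nonneg _) (hE s hs)
  have hfb : ∀ s ∈ T, _ := fun s hs ↦
    toReal_eLpNorm_le_of_errorBound hp hq (hC0 s hs) (hm s hs) (hut s hs).2.1 (hf s hs) (hVp s hs)
      (fun _ ↦ norm_nonneg _) (hE s hs)
  set P := ENNReal.ofReal (q + 1)
  set R := ENNReal.ofReal ((q + 1) / q)
  have hd := hvt.hasDerivWithinAt ht
  have hv : ∀ s ∈ T, MemLp (fun x ↦ spow (u s x) q) R μ := hvt.1
  let v : ℝ → Lp ℝ R μ := fun s ↦ toLpOrZero R μ (fun x ↦ spow (u s x) q)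
  -- With this sign `B (f s)` is a subgradient of the energy at `u^q`: integration by parts turns it
  -- into `p ∫ ‖V‖^(p-2) ⟨V, ·⟩`.
  let B := (-p) • lpDual P R μ
  have hB : ∀ s ∈ T, ∀ g : α → ℝ, MemLp g R μ → B (toLpOrZero P μ (f s))
      (toLpOrZero R μ g) = -(p * ∫ x, f s x * g x ∂μ) := by
    intro s hs g hg
    simp only [B, smul_apply, smul_eq_mul]
    rw [lpDual_toLpOrZero (hfm s hs) hg]
    ring
  have hBV : ∀ s ∈ T, ∀ s' ∈ T, B (toLpOrZero P μ (f s)) (v s') =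
      p * ∫ x, ‖V s x‖ ^ (p - 2) * inner ℝ (V s x) (V s' x) ∂μ := by
    intro s hs s' hs'
    rw [hB s hs _ (hv s' hs'), hibp s hs s' hs']
    ring
  -- The constants come from the `L^(q+1)` bound of `f s`, with `C s`, `‖u s‖` and `‖ut s‖` replaced
  -- by their values at `t` plus one, which is legitimate for `s` near `t` by continuity.
  have key := hasDerivWithinAt_of_subgradient_of_directional (B := B)
    (E := fun s ↦ ∫ x, ‖V s x‖ ^ p ∂μ) (v := v) (f := fun s ↦ toLpOrZero P μ (f s))
    (w := toLpOrZero R μ w) (A := (eLpNorm (ut t) P μ).toReal + 1 +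
      (C t + 1) * (2 * ((eLpNorm (u t) P μ).toReal + 1) + 1)) (K := C t + 1) ht hd ?_ ?_ ?_ ?_ ?_
  · rwa [hB t ht _ hvt.2.1] at key
  · intro s hs s' hs'
    rw [map_sub, hBV s' hs' s hs, hBV s' hs' s' hs', ← mul_sub]
    exact integral_norm_rpow_add_le hp (hVp s' hs') (hVp s hs) (hVm s' hs' s hs)
      (hVm s' hs' s' hs')
  · have := hC0 t ht
    positivity
  · have := hC0 t ht
    positivity
  · have h1 : ∀ᶠ s in 𝓝[T] t, C s < C t + 1 := (hC t ht).eventually_lt_const (by linarith)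
    have h2 : ∀ᶠ s in 𝓝[T] t, ‖toLpOrZero P μ (u s)‖ < ‖toLpOrZero P μ (u t)‖ + 1 :=
      ((hut t ht).hasDerivWithinAt ht).continuousWithinAt.norm.eventually_lt_const (by linarith)
    have h3 := (ENNReal.tendsto_nhds_zero.1 (hutc t ht)) 1 one_pos
    filter_upwards [h1, h2, h3, self_mem_nhdsWithin] with s hs1 hs2 hs3 hs
    rw [norm_toLpOrZero (hm s hs), norm_toLpOrZero (hm t ht)] at hs2
    have hs4 : (eLpNorm (ut s) P μ).toReal ≤ (eLpNorm (ut t) P μ).toReal + 1 := by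
      have e : eLpNorm (ut s) P μ ≤ eLpNorm (ut t) P μ + 1 := by
        calc eLpNorm (ut s) P μ = eLpNorm (ut t + fun x ↦ ut s x - ut t x) P μ := by
              congr 1; ext x; simp
          _ ≤ _ := eLpNorm_add_le (hut t ht).2.1.1
              ((hut s hs).2.1.1.sub (hut t ht).2.1.1) hP1.out
          _ ≤ _ := by gcongr
      have := ENNReal.toReal_mono (by finiteness [(hut t ht).2.1.2]) e
      rwa [ENNReal.toReal_add (by finiteness [(hut t ht).2.1.2]) (by finiteness),
        ENNReal.toReal_one] at this
    rw [norm_toLpOrZero (hfm s hs)]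
    have h0 : 0 ≤ ∫ x, ‖V s x‖ ^ p ∂μ := integral_nonneg fun x ↦ by positivity
    have hCs := hC0 s hs
    have hCt := hC0 t ht
    calc _ ≤ _ := hfb s hs
      _ ≤ (eLpNorm (ut t) P μ).toReal + 1 + (C t + 1) * (2 * ((eLpNorm (u t) P μ).toReal + 1) +
          (1 + ∫ x, ‖V s x‖ ^ p ∂μ)) := by gcongr
      _ = _ := by ring
  · intro s' hs'
    have hWp : MemLp (fun x ↦ ‖V s' x - V t x‖) (ENNReal.ofReal p) μ := by
      have := memLp_norm_add_smul (hVp s' hs') (hVp t ht) (hVm s' hs' s' hs') (hVm s' hs' t ht)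
        (hVm t ht t ht) (-1)
      simpa [sub_eq_add_neg] using this
    have hVW : ∀ s ∈ T, AEStronglyMeasurable (fun x ↦ inner ℝ (V s x) (V s' x - V t x)) μ := by
      intro s hs
      simp_rw [inner_sub_right]
      exact (hVm s hs s' hs').sub (hVm s hs t ht)
    have hWW : AEStronglyMeasurable
        (fun x ↦ inner ℝ (V s' x - V t x) (V s' x - V t x)) μ := by
      have := (hVW s' hs').sub (hVW t ht)
      refine this.congr (Eventually.of_forall fun x ↦ ?_)
      simp only [Pi.sub_apply, ← inner_sub_left]
    -- The energy along the segment from the state at `t` towards the state at `s'`, written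
    -- directly on gradients.
    refine ⟨fun ε ↦ ∫ x, ‖V t x + ε • (V s' x - V t x)‖ ^ p ∂μ, ?_, ?_, ?_⟩
    · refine (hasDerivAt_integral_norm_rpow hp (hVp t ht) hWp (hVm t ht t ht) (hVW t ht)
        hWW).congr_deriv ?_
      rw [map_sub, hBV t ht s' hs', hBV t ht t ht, ← mul_sub, ← integral_sub]
      · simp_rw [inner_sub_right, mul_sub]
      · exact integrable_norm_rpow_mul_inner hp (hVp t ht) (hVp s' hs') (hVm t ht s' hs')
      · exact integrable_norm_rpow_mul_inner hp (hVp t ht) (hVp t ht) (hVm t ht t ht)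
    · simp
    · intro s hs ε
      have i1 := integrable_norm_rpow_mul_inner hp (hVp s hs) (hVp t ht) (hVm s hs t ht)
      have i2 := integrable_norm_rpow_mul_inner hp (hVp s hs) (hVp s' hs') (hVm s hs s' hs')
      have hX := memLp_norm_add_smul (hVp t ht) hWp (hVm t ht t ht) (hVW t ht) hWW ε
      have hVX : AEStronglyMeasurable
          (fun x ↦ inner ℝ (V s x) (V t x + ε • (V s' x - V t x))) μ := by
        simp_rw [inner_add_right, inner_smul_right]
        exact (hVm s hs t ht).add ((hVW s hs).const_mul ε)
      refine le_trans (le_of_eq ?_) (integral_norm_rpow_add_le hp (hVp s hs) hX hVX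
        (hVm s hs s hs))
      rw [map_sub, map_add, map_smul, map_sub, hBV s hs t ht, hBV s hs s' hs', hBV s hs s hs]
      have e : ∫ x, ‖V s x‖ ^ (p - 2) * inner ℝ (V s x) (V t x + ε • (V s' x - V t x)) ∂μ =
          ∫ x, ‖V s x‖ ^ (p - 2) * inner ℝ (V s x) (V t x) ∂μ +
          ε * (∫ x, ‖V s x‖ ^ (p - 2) * inner ℝ (V s x) (V s' x) ∂μ -
          ∫ x, ‖V s x‖ ^ (p - 2) * inner ℝ (V s x) (V t x) ∂μ) := by
        have i3 : Integrable (fun x ↦ ε * (‖V s x‖ ^ (p - 2) * inner ℝ (V s x) (V s' x) -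
            ‖V s x‖ ^ (p - 2) * inner ℝ (V s x) (V t x))) μ := (i2.sub i1).const_mul ε
        rw [← integral_sub i2 i1, ← integral_const_mul, ← integral_add i1 i3]
        congr with x
        rw [inner_add_right, inner_smul_right, inner_sub_right]
        ring
      rw [e, smul_eq_mul]
      ring

/-- The monotonicity of the parabolic frequency, for a family of inner product spaces over a
measure space in which the integration by parts formula holds. -/
theorem frequency_monotonicity_of_integration_by_parts (hp : 1 < p) (hq : 0 < q)
    (hδ : 0 ≤ q * (p - 1) - 1) (hT : UniqueDiffOn ℝ T)
    (hC : ContinuousOn C T) (hC0 : ∀ s ∈ T, 0 ≤ C s)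
    (hut : ∀ s ∈ T, HasLpDerivWithinAt (q + 1) μ u (ut s) T s)
    (hutc : LpContinuousOn (q + 1) μ ut T)
    (hvt : q < 1 → ∀ t ∈ T, ∃ w : α → ℝ,
      HasLpDerivWithinAt ((q + 1) / q) μ (fun s x ↦ spow (u s x) q) w T t)
    (hVp : ∀ s ∈ T, MemLp (fun x ↦ ‖V s x‖) (ENNReal.ofReal p) μ)
    (hVm : ∀ s ∈ T, ∀ s' ∈ T, AEStronglyMeasurable (fun x ↦ inner ℝ (V s x) (V s' x)) μ)
    (hf : ∀ s ∈ T, AEStronglyMeasurable (f s) μ)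
    (hE : ∀ s ∈ T, ∀ᵐ x ∂μ, |ut s x - f s x| ≤ errorBound p q (C s) |u s x| ‖V s x‖)
    (hibp : ∀ s ∈ T, ∀ s' ∈ T, ∫ x, f s x * spow (u s' x) q ∂μ =
      -∫ x, ‖V s x‖ ^ (p - 2) * inner ℝ (V s x) (V s' x) ∂μ)
    (ht : t ∈ T) {I N : ℝ → ℝ} (hIdef : I = fun s ↦ ∫ x, |u s x| ^ (q + 1) ∂μ)
    (hNdef : N = fun s ↦ (-∫ x, ‖V s x‖ ^ p ∂μ) / I s) (hI : 0 < I t) :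
    (DifferentiableWithinAt ℝ (fun s ↦ Real.log (I s)) T t ∧
      (q + 1 + C t) * N t - (2 * q + 3 / 2) * C t ≤
        derivWithin (fun s ↦ Real.log (I s)) T t) ∧
    (DifferentiableWithinAt ℝ N T t ∧
      p * q / (q + 1) * C t ^ 2 * (N t - q - 1 / 2) ≤ derivWithin N T t) := by
  have hne : NeBot (𝓝[T \ {t}] t) := (hT t ht).accPt |> accPt_principal_iff_nhdsWithin.1
  obtain ⟨w, hw, hfw⟩ : ∃ w : α → ℝ,
      HasLpDerivWithinAt ((q + 1) / q) μ (fun s x ↦ spow (u s x) q) w T t ∧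
      ∀ᵐ x ∂μ, f t x * w x = q * (|u t x| ^ (q - 1) * (f t x * ut t x)) := by
    rcases le_or_gt 1 q with h1 | h1
    · refine ⟨_, (hut t ht).spow h1 ht, Eventually.of_forall fun x ↦ ?_⟩
      ring
    · obtain ⟨w, hw⟩ := hvt h1 t ht
      refine ⟨w, hw, ?_⟩
      filter_upwards [ae_deriv_spow_of_lt_one hq h1 ht (hut t ht) hw, hE t ht] with x hx hx2
      -- At a zero of `u` the error bound vanishes and so does `ut`, hence `f` vanishes too and both
      -- sides are zero whatever `w` is there.
      by_cases h0 : u t x = 0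
      · rw [h0, abs_zero, errorBound_zero_of_lt_one h1, hx.1 h0, zero_sub, abs_neg] at hx2
        rw [hx.1 h0, abs_eq_zero.1 (le_antisymm hx2 (abs_nonneg _))]
        simp
      · rw [hx.2 h0]; ring
  have dI := hasDerivWithinAt_integral_abs_rpow hq ht (hut t ht) hw
  have dE := hasDerivWithinAt_integral_norm_rpow hp hq ht hC hC0 hut hutc hw hVp hVm hf hE hibp
  rw [← hIdef] at dI
  have hm := (hut t ht).1 t ht
  have hD : ∫ x, f t x * spow (u t x) q ∂μ = -∫ x, ‖V t x‖ ^ p ∂μ := by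
    rw [hibp t ht t ht]
    simp_rw [norm_rpow_mul_inner_self hp]
  have k1 := le_integral_spow_mul hp hq (hC0 t ht) hm (hut t ht).2.1 (hf t ht) (hVp t ht)
    (fun _ ↦ norm_nonneg _) (hE t ht) hD
  have hIt : I t = ∫ x, |u t x| ^ (q + 1) ∂μ := by rw [hIdef]
  have k2 := frequency_deriv_numerator_ge hp hq hδ (hC0 t ht) hm (hut t ht).2.1 (hf t ht)
    (hVp t ht) (fun _ ↦ norm_nonneg _) (hE t ht) hD hw.2.1 hfw (hIt ▸ hI)
  rw [← hIt] at k1 k2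
  have dlog := dI.log hI.ne'
  have dN := dE.neg.div dI hI.ne'
  rw [show (-fun s ↦ ∫ x, ‖V s x‖ ^ p ∂μ) / I = N by rw [hNdef]; rfl] at dN
  have hNt : N t = (-∫ x, ‖V t x‖ ^ p ∂μ) / I t := by rw [hNdef]
  refine ⟨⟨dlog.differentiableWithinAt, ?_⟩, ⟨dN.differentiableWithinAt, ?_⟩⟩
  · rw [dlog.derivWithin (hT t ht), le_div_iff₀ hI, hNt]
    refine le_trans (le_of_eq ?_) k1
    field_simp
  · rw [dN.derivWithin (hT t ht), le_div_iff₀ (by positivity), hNt]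
    simp only [Pi.neg_apply, neg_neg]
    refine le_trans (le_of_eq ?_) k2
    field_simp
    ring

end Evolution

/-! ### The metric in coordinates. -/

section Chart

variable {n : ℕ} {M : Type*} [TopologicalSpace M] [ChartedSpace (Euc n) M]
  [IsManifold 𝓘(ℝ, Euc n) ∞ M]

/-- Joint continuity in point and direction, needed for compactness arguments over unit spheres; it
is the continuity of the tangent map of the inverse chart. -/
lemma continuousOn_coordVector (x₀ : M) :
    ContinuousOn (fun z : Euc n × Euc n ↦
      (⟨(chartAt (Euc n) x₀).symm z.1, coordVector x₀ z.1 z.2⟩ :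
        TangentBundle 𝓘(ℝ, Euc n) M)) ((chartAt (Euc n) x₀).target ×ˢ univ) := by
  have h : ContMDiffOn 𝓘(ℝ, Euc n) 𝓘(ℝ, Euc n) ∞ (chartAt (Euc n) x₀).symm
      (chartAt (Euc n) x₀).target := contMDiffOn_chart_symm
  have h2 := h.continuousOn_tangentMapWithin (by simp)
    (chartAt (Euc n) x₀).open_target.uniqueMDiffOn
  have h3 : Continuous (fun z : Euc n × Euc n ↦ (⟨z.1, z.2⟩ : TangentBundle 𝓘(ℝ, Euc n) (Euc n))) :=
    (tangentBundleModelSpaceHomeomorph 𝓘(ℝ, Euc n)).symm.continuous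
  have h4 := h2.comp h3.continuousOn (s := (chartAt (Euc n) x₀).target ×ˢ univ)
    (fun z hz ↦ hz.1)
  refine h4.congr fun z hz ↦ ?_
  simp only [Function.comp, tangentMapWithin, coordVector]
  rw [mfderivWithin_of_isOpen (chartAt (Euc n) x₀).open_target hz.1]

lemma mdifferentiableAt_chart_symm (x₀ : M) {y : Euc n} (hy : y ∈ (chartAt (Euc n) x₀).target) :
    MDifferentiableAt 𝓘(ℝ, Euc n) 𝓘(ℝ, Euc n) (chartAt (Euc n) x₀).symm y :=
  ((contMDiffOn_chart_symm (n := ∞)).mdifferentiableOn (by simp) y hy).mdifferentiableAt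
    ((chartAt (Euc n) x₀).open_target.mem_nhds hy)

lemma mdifferentiableAt_chart (x₀ : M) {x : M} (hx : x ∈ (chartAt (Euc n) x₀).source) :
    MDifferentiableAt 𝓘(ℝ, Euc n) 𝓘(ℝ, Euc n) (chartAt (Euc n) x₀) x :=
  ((contMDiffOn_chart (n := ∞)).mdifferentiableOn (by simp) x hx).mdifferentiableAt
    ((chartAt (Euc n) x₀).open_source.mem_nhds hx)

/-- The components of a tangent vector at the point with coordinates `y`. -/
noncomputable def coordRepr (x₀ : M) (y : Euc n) (X : TangentSpace 𝓘(ℝ, Euc n) ((chartAt (Euc n) x₀).symm y)) :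
    Euc n :=
  mfderiv 𝓘(ℝ, Euc n) 𝓘(ℝ, Euc n) (chartAt (Euc n) x₀) ((chartAt (Euc n) x₀).symm y) X

lemma coordVector_coordRepr (x₀ : M) {y : Euc n} (hy : y ∈ (chartAt (Euc n) x₀).target)
    (X : TangentSpace 𝓘(ℝ, Euc n) ((chartAt (Euc n) x₀).symm y)) :
    coordVector x₀ y (coordRepr x₀ y X) = X := by
  have hs := (chartAt (Euc n) x₀).map_target hy
  have hr := (chartAt (Euc n) x₀).right_inv hy
  have h1 := mfderiv_comp_of_eq (x := (chartAt (Euc n) x₀).symm y) (y := y)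
    (mdifferentiableAt_chart_symm x₀ hy) (mdifferentiableAt_chart x₀ hs) hr
  have h2 : mfderiv 𝓘(ℝ, Euc n) 𝓘(ℝ, Euc n) ((chartAt (Euc n) x₀).symm ∘ chartAt (Euc n) x₀)
      ((chartAt (Euc n) x₀).symm y) =
      ContinuousLinearMap.id ℝ (TangentSpace 𝓘(ℝ, Euc n) ((chartAt (Euc n) x₀).symm y)) := by
    rw [← mfderiv_id]
    apply Filter.EventuallyEq.mfderiv_eq
    filter_upwards [(chartAt (Euc n) x₀).open_source.mem_nhds hs] with x hx
    exact (chartAt (Euc n) x₀).left_inv hx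
  have h3 := congrArg (fun L : Euc n →L[ℝ] Euc n ↦ L X) (h1.symm.trans h2)
  -- Changing the base point along `hr` is harmless, since every tangent space unfolds to `Euc n`.
  have h4 := congrArg (fun z ↦ (show Euc n →L[ℝ] Euc n from
    mfderiv 𝓘(ℝ, Euc n) 𝓘(ℝ, Euc n) (chartAt (Euc n) x₀).symm z) (coordRepr x₀ y X)) hr
  exact h4.symm.trans h3

lemma coordRepr_coordVector (x₀ : M) {y : Euc n} (hy : y ∈ (chartAt (Euc n) x₀).target)
    (w : Euc n) : coordRepr x₀ y (coordVector x₀ y w) = w := by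
  have hs := (chartAt (Euc n) x₀).map_target hy
  have h1 := mfderiv_comp (x := y) (mdifferentiableAt_chart x₀ hs)
    (mdifferentiableAt_chart_symm x₀ hy)
  have h2 : mfderiv 𝓘(ℝ, Euc n) 𝓘(ℝ, Euc n) (chartAt (Euc n) x₀ ∘ (chartAt (Euc n) x₀).symm) y =
      ContinuousLinearMap.id ℝ (TangentSpace 𝓘(ℝ, Euc n) y) := by
    rw [← mfderiv_id]
    apply Filter.EventuallyEq.mfderiv_eq
    filter_upwards [(chartAt (Euc n) x₀).open_target.mem_nhds hy] with x hx
    exact (chartAt (Euc n) x₀).right_inv hx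
  exact congrArg (fun L : Euc n →L[ℝ] Euc n ↦ L w) (h1.symm.trans h2)

omit [IsManifold 𝓘(ℝ, Euc n) ∞ M] in
lemma coordVector_sum (x₀ : M) (y w : Euc n) :
    coordVector x₀ y w = ∑ i, w i • coordVector x₀ y (EuclideanSpace.single i 1) := by
  have h : w = ∑ i, w i • EuclideanSpace.single i (1 : ℝ) := by
    ext j
    simp [Finset.sum_apply, Pi.single_apply]
  let L : Euc n →L[ℝ] Euc n := mfderiv 𝓘(ℝ, Euc n) 𝓘(ℝ, Euc n) (chartAt (Euc n) x₀).symm y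
  exact (congrArg L h).trans ((map_sum L _ _).trans (Finset.sum_congr rfl fun i _ ↦ map_smul L _ _))

variable [RiemannianBundle (fun x : M ↦ TangentSpace 𝓘(ℝ, Euc n) x)]

omit [IsManifold 𝓘(ℝ, Euc n) ∞ M] in
lemma inner_coordVector_right (x₀ : M) (y w : Euc n)
    (X : TangentSpace 𝓘(ℝ, Euc n) ((chartAt (Euc n) x₀).symm y)) :
    inner ℝ X (coordVector x₀ y w) =
      ∑ i, w i * inner ℝ X (coordVector x₀ y (EuclideanSpace.single i 1)) := by
  rw [coordVector_sum, inner_sum]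
  simp_rw [inner_smul_right]

lemma inner_eq_sum_coordRepr (x₀ : M) {y : Euc n} (hy : y ∈ (chartAt (Euc n) x₀).target)
    (X Y : TangentSpace 𝓘(ℝ, Euc n) ((chartAt (Euc n) x₀).symm y)) :
    inner ℝ X Y =
      ∑ i, coordRepr x₀ y Y i * inner ℝ X (coordVector x₀ y (EuclideanSpace.single i 1)) := by
  rw [← inner_coordVector_right, coordVector_coordRepr x₀ hy]

omit [IsManifold 𝓘(ℝ, Euc n) ∞ M] in
lemma inner_coordVector_eq_gramMatrix (x₀ : M) (y v w : Euc n) :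
    inner ℝ (coordVector x₀ y v) (coordVector x₀ y w) =
      v.ofLp ⬝ᵥ (gramMatrix x₀ y).mulVec w.ofLp := by
  rw [inner_coordVector_right]
  simp_rw [real_inner_comm _ (coordVector x₀ y v), inner_coordVector_right x₀ y v]
  simp only [dotProduct, Matrix.mulVec, gramMatrix, Matrix.of_apply, Finset.mul_sum]
  rw [Finset.sum_comm]
  refine Finset.sum_congr rfl fun i _ ↦ Finset.sum_congr rfl fun j _ ↦ ?_
  rw [real_inner_comm]
  ring

lemma gramMatrix_posDef (x₀ : M) {y : Euc n} (hy : y ∈ (chartAt (Euc n) x₀).target) :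
    (gramMatrix x₀ y).PosDef := by
  refine Matrix.PosDef.of_dotProduct_mulVec_pos ?_ ?_
  · ext i j
    simp only [gramMatrix, Matrix.conjTranspose_apply, Matrix.of_apply, star_trivial]
    exact real_inner_comm _ _
  · intro v hv
    have := inner_coordVector_eq_gramMatrix x₀ y (WithLp.toLp 2 v) (WithLp.toLp 2 v)
    rw [star_trivial, ← this, real_inner_self_eq_norm_sq]
    apply sq_pos_of_pos
    rw [norm_pos_iff]
    intro h0
    have h1 := coordRepr_coordVector x₀ hy (WithLp.toLp 2 v)
    rw [h0] at h1
    apply hv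
    have h2 : coordRepr x₀ y 0 = 0 := map_zero _
    have h3 : (WithLp.toLp 2 v : Euc n) = 0 := h1.symm.trans h2
    simpa using congrArg WithLp.ofLp h3

/-- A weak gradient is known through its products with the coordinate fields; the inverse Gram
matrix recovers its components, hence their measurability. -/
lemma gramMatrix_mulVec_coordRepr (x₀ : M) {y : Euc n} (hy : y ∈ (chartAt (Euc n) x₀).target)
    (X : TangentSpace 𝓘(ℝ, Euc n) ((chartAt (Euc n) x₀).symm y)) :
    (coordRepr x₀ y X).ofLp = (gramMatrix x₀ y)⁻¹.mulVec
      fun i ↦ inner ℝ X (coordVector x₀ y (EuclideanSpace.single i 1)) := by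
  have hdet : IsUnit (gramMatrix x₀ y).det := (gramMatrix_posDef x₀ hy).det_pos.ne'.isUnit
  have h : (gramMatrix x₀ y).mulVec (coordRepr x₀ y X).ofLp =
      fun i ↦ inner ℝ X (coordVector x₀ y (EuclideanSpace.single i 1)) := by
    ext i
    conv_rhs => rw [← coordVector_coordRepr x₀ hy X]
    rw [real_inner_comm, inner_coordVector_eq_gramMatrix]
    simp
  rw [← h, Matrix.mulVec_mulVec, Matrix.nonsing_inv_mul _ hdet, Matrix.one_mulVec]

variable [IsContinuousRiemannianBundle (Euc n) (fun x : M ↦ TangentSpace 𝓘(ℝ, Euc n) x)]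

lemma continuousOn_inner_coordVector (x₀ : M) (v w : Euc n) :
    ContinuousOn (fun y ↦ inner ℝ (coordVector x₀ y v) (coordVector x₀ y w))
      (chartAt (Euc n) x₀).target := by
  have h := continuousOn_coordVector (n := n) x₀
  have hv : ∀ v : Euc n, ContinuousOn (fun y : Euc n ↦
      (⟨(chartAt (Euc n) x₀).symm y, coordVector x₀ y v⟩ :
        TangentBundle 𝓘(ℝ, Euc n) M)) (chartAt (Euc n) x₀).target := fun v ↦
    h.comp (f := fun y ↦ (y, v)) (by fun_prop) fun y hy ↦ ⟨hy, mem_univ _⟩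
  exact ContinuousOn.inner_bundle (hv v) (hv w)

lemma continuousOn_norm_coordVector (x₀ : M) :
    ContinuousOn (fun z : Euc n × Euc n ↦ ‖coordVector x₀ z.1 z.2‖)
      ((chartAt (Euc n) x₀).target ×ˢ univ) := by
  have h := continuousOn_coordVector (n := n) x₀
  have := (ContinuousOn.inner_bundle h h).sqrt
  refine this.congr fun z _ ↦ ?_
  exact norm_eq_sqrt_real_inner _

lemma continuousOn_gramMatrix (x₀ : M) :
    ContinuousOn (gramMatrix (n := n) x₀) (chartAt (Euc n) x₀).target := by
  refine continuousOn_pi.2 fun i ↦ continuousOn_pi.2 fun j ↦ ?_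
  exact continuousOn_inner_coordVector x₀ _ _

lemma continuousOn_gramMatrix_det (x₀ : M) :
    ContinuousOn (fun y ↦ (gramMatrix (n := n) x₀ y).det) (chartAt (Euc n) x₀).target :=
  (Continuous.matrix_det continuous_id).comp_continuousOn (continuousOn_gramMatrix x₀)

lemma continuousOn_gramMatrix_inv (x₀ : M) :
    ContinuousOn (fun y ↦ (gramMatrix (n := n) x₀ y)⁻¹) (chartAt (Euc n) x₀).target := by
  simp_rw [Matrix.inv_def, Ring.inverse_eq_inv']
  refine ContinuousOn.smul (f := fun y ↦ ((gramMatrix (n := n) x₀ y).det)⁻¹) ?_ ?_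
  · exact (continuousOn_gramMatrix_det x₀).inv₀
      fun y hy ↦ (gramMatrix_posDef x₀ hy).det_pos.ne'
  · exact (Continuous.matrix_adjugate continuous_id).comp_continuousOn (continuousOn_gramMatrix x₀)

/-- On a compact set of coordinates, the Riemannian norm and the Euclidean norm of the components
are comparable. -/
lemma exists_norm_coordVector_le (x₀ : M) {K : Set (Euc n)} (hK : IsCompact K)
    (hKt : K ⊆ (chartAt (Euc n) x₀).target) :
    ∃ A : ℝ, 0 < A ∧ (∀ y ∈ K, ∀ w, ‖coordVector x₀ y w‖ ≤ A * ‖w‖) ∧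
      ∀ y ∈ K, ∀ w, ‖w‖ ≤ A * ‖coordVector x₀ y w‖ := by
  set S := K ×ˢ Metric.sphere (0 : Euc n) 1
  have hS : IsCompact S := hK.prod (isCompact_sphere _ _)
  have hc : ContinuousOn (fun z : Euc n × Euc n ↦ ‖coordVector x₀ z.1 z.2‖) S :=
    (continuousOn_norm_coordVector (n := n) x₀).mono (prod_mono hKt (subset_univ _))
  have hpos : ∀ z ∈ S, ‖coordVector x₀ z.1 z.2‖ ≠ 0 := by
    intro z hz h0
    rw [norm_eq_zero] at h0
    have h1 := coordRepr_coordVector x₀ (hKt hz.1) z.2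
    rw [h0] at h1
    have h2 : coordRepr x₀ z.1 0 = 0 := map_zero _
    have h3 : z.2 = 0 := h1.symm.trans h2
    have h4 : ‖z.2‖ = 1 := by simpa using hz.2
    rw [h3, norm_zero] at h4
    exact zero_ne_one h4
  obtain ⟨A₁, hA₁⟩ := hS.bddAbove_image hc
  obtain ⟨A₂, hA₂⟩ := hS.bddAbove_image (hc.inv₀ hpos)
  have hhom : ∀ y w, ∀ r : ℝ, ‖coordVector (n := n) x₀ y (r • w)‖ =
      |r| * ‖coordVector x₀ y w‖ := by
    intro y w r
    have : coordVector x₀ y (r • w) = r • coordVector x₀ y w := map_smul _ _ _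
    rw [this, norm_smul, Real.norm_eq_abs]
  have hzero : ∀ y, coordVector (n := n) x₀ y 0 = 0 := fun y ↦ map_zero _
  have hunit : ∀ w : Euc n, w ≠ 0 → ∃ e, ‖e‖ = 1 ∧ w = ‖w‖ • e := fun w hw ↦
    ⟨‖w‖⁻¹ • w, by simp [norm_smul, hw], by simp [smul_smul, hw]⟩
  refine ⟨max 1 (max A₁ A₂), by positivity, fun y hy w ↦ ?_, fun y hy w ↦ ?_⟩
  · rcases eq_or_ne w 0 with rfl | hw
    · rw [hzero]; simp
    obtain ⟨e, he, hwe⟩ := hunit w hw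
    have h1 : ‖coordVector x₀ y e‖ ≤ A₁ :=
      hA₁ ⟨(y, e), ⟨hy, by simpa using he⟩, rfl⟩
    conv_lhs => rw [hwe, hhom, abs_norm, mul_comm]
    gcongr
    exact h1.trans ((le_max_left _ _).trans (le_max_right _ _))
  · rcases eq_or_ne w 0 with rfl | hw
    · rw [hzero]; simp
    obtain ⟨e, he, hwe⟩ := hunit w hw
    have hz : (y, e) ∈ S := ⟨hy, by simpa using he⟩
    have h1 : ‖coordVector x₀ y e‖⁻¹ ≤ A₂ := hA₂ ⟨(y, e), hz, rfl⟩
    have h2 : 0 < ‖coordVector x₀ y e‖ := lt_of_le_of_ne (norm_nonneg _) (hpos _ hz).symm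
    have h3 : 1 ≤ max 1 (max A₁ A₂) * ‖coordVector x₀ y e‖ := by
      rw [inv_le_iff_one_le_mul₀ h2] at h1
      refine h1.trans ?_
      gcongr
      exact (le_max_right _ _).trans (le_max_right _ _)
    conv_rhs => rw [hwe, hhom, abs_norm]
    nlinarith [norm_nonneg w]

end Chart

set_option linter.unusedSectionVars false

/-! ### The Riemannian volume in charts. -/

section ChartMeasure

variable {n : ℕ} {M : Type*} [TopologicalSpace M] [ChartedSpace (Euc n) M]
  [IsManifold 𝓘(ℝ, Euc n) ∞ M]
  [RiemannianBundle (fun x : M ↦ TangentSpace 𝓘(ℝ, Euc n) x)]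
  [IsContinuousRiemannianBundle (Euc n) (fun x : M ↦ TangentSpace 𝓘(ℝ, Euc n) x)]
  [MeasurableSpace M] [BorelSpace M]

lemma aemeasurable_chart_symm {M : Type*} [TopologicalSpace M] [ChartedSpace (Euc n) M]
    [MeasurableSpace M] [BorelSpace M] (x₀ : M) :
    AEMeasurable (chartAt (Euc n) x₀).symm (volume.restrict (chartAt (Euc n) x₀).target) :=
  (chartAt (Euc n) x₀).continuousOn_symm.aemeasurable (chartAt (Euc n) x₀).open_target.measurableSet

lemma measurableSet_chart_target_inter_preimage
    {M : Type*} [TopologicalSpace M] [ChartedSpace (Euc n) M]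
    [MeasurableSpace M] [BorelSpace M] (x₀ : M) {A : Set M} (hA : MeasurableSet A) :
    MeasurableSet ((chartAt (Euc n) x₀).target ∩ (chartAt (Euc n) x₀).symm ⁻¹' A) := by
  have h := (chartAt (Euc n) x₀).continuousOn_symm.domRestrict.measurable hA
  have h2 := (chartAt (Euc n) x₀).open_target.measurableSet.subtype_image h
  convert h2 using 1
  ext y
  simp [and_comm]

lemma chartVolume_apply (x₀ : M) {A : Set M} (hA : MeasurableSet A) :
    chartVolume (n := n) x₀ A = ∫⁻ y in (chartAt (Euc n) x₀).target ∩ (chartAt (Euc n) x₀).symm ⁻¹' A,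
      ENNReal.ofReal (Real.sqrt (gramMatrix x₀ y).det) := by
  have hm := aemeasurable_chart_symm (n := n) x₀
  have hT := (chartAt (Euc n) x₀).open_target.measurableSet
  rw [chartVolume, Measure.map_apply_of_aemeasurable
    (hm.mono_ac (withDensity_absolutelyContinuous _ _)) hA]
  have h0 : ((chartAt (Euc n) x₀).symm ⁻¹' A : Set (Euc n)) =ᵐ[(volume.restrict (chartAt (Euc n) x₀).target).withDensity
      fun y ↦ ENNReal.ofReal (Real.sqrt (gramMatrix x₀ y).det)]
      ((chartAt (Euc n) x₀).target ∩ (chartAt (Euc n) x₀).symm ⁻¹' A : Set (Euc n)) := by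
    apply (withDensity_absolutelyContinuous _ _).ae_eq
    filter_upwards [ae_restrict_mem hT] with y hy
    exact propext ⟨fun h ↦ ⟨hy, h⟩, fun h ↦ h.2⟩
  have hTA := measurableSet_chart_target_inter_preimage (n := n) x₀ hA
  rw [measure_congr h0, withDensity_apply _ hTA, Measure.restrict_restrict hTA,
    inter_eq_left.2 inter_subset_left]

/-- With `L` the differential of the transition map, the Gram matrices satisfy `g₀ = Lᵀ g₁ L`; take
determinants and square roots. -/
lemma sqrt_det_gramMatrix_eq (x₀ x₁ : M) {y : Euc n} (hy : y ∈ (chartAt (Euc n) x₀).target)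
    (hy₁ : (chartAt (Euc n) x₀).symm y ∈ (chartAt (Euc n) x₁).source) :
    Real.sqrt (gramMatrix x₀ y).det =
      |(fderiv ℝ (chartAt (Euc n) x₁ ∘ (chartAt (Euc n) x₀).symm) y).det| *
        Real.sqrt (gramMatrix x₁ (chartAt (Euc n) x₁ ((chartAt (Euc n) x₀).symm y))).det := by
  set L : Euc n →L[ℝ] Euc n := fderiv ℝ (chartAt (Euc n) x₁ ∘ (chartAt (Euc n) x₀).symm) y with hL
  have hx : (chartAt (Euc n) x₁).symm (chartAt (Euc n) x₁ ((chartAt (Euc n) x₀).symm y)) =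
    (chartAt (Euc n) x₀).symm y := (chartAt (Euc n) x₁).left_inv hy₁
  have hy₂ := (chartAt (Euc n) x₁).map_source hy₁
  -- The two base points agree only propositionally, so the inner products are transported by
  -- substituting one point for the other.
  have key : ∀ (x x' : M) (_ : x = x') (X Y X' Y' : Euc n), X = X' → Y = Y' →
      inner ℝ (show TangentSpace 𝓘(ℝ, Euc n) x from X) (show TangentSpace 𝓘(ℝ, Euc n) x from Y) =
      inner ℝ (show TangentSpace 𝓘(ℝ, Euc n) x' from X')
        (show TangentSpace 𝓘(ℝ, Euc n) x' from Y') := by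
    rintro x _ rfl X Y _ _ rfl rfl
    rfl
  have hLw : ∀ w : Euc n, (show Euc n from coordVector x₁
      (chartAt (Euc n) x₁ ((chartAt (Euc n) x₀).symm y)) (L w)) = coordVector x₀ y w := by
    intro w
    have h1 := mfderiv_comp (x := y) (I := 𝓘(ℝ, Euc n)) (I' := 𝓘(ℝ, Euc n)) (I'' := 𝓘(ℝ, Euc n))
      (mdifferentiableAt_chart x₁ hy₁) (mdifferentiableAt_chart_symm x₀ hy)
    have h2 := mfderiv_comp (x := y) (I := 𝓘(ℝ, Euc n)) (I' := 𝓘(ℝ, Euc n)) (I'' := 𝓘(ℝ, Euc n))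
      (f := chartAt (Euc n) x₁ ∘ (chartAt (Euc n) x₀).symm) (g := (chartAt (Euc n) x₁).symm)
      (mdifferentiableAt_chart_symm x₁ hy₂)
      ((mdifferentiableAt_chart x₁ hy₁).comp y (mdifferentiableAt_chart_symm x₀ hy))
    have h3 : mfderiv 𝓘(ℝ, Euc n) 𝓘(ℝ, Euc n) ((chartAt (Euc n) x₁).symm ∘
        (chartAt (Euc n) x₁ ∘ (chartAt (Euc n) x₀).symm)) y =
        mfderiv 𝓘(ℝ, Euc n) 𝓘(ℝ, Euc n) (chartAt (Euc n) x₀).symm y := by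
      apply Filter.EventuallyEq.mfderiv_eq
      have : ∀ᶠ z in 𝓝 y, (chartAt (Euc n) x₀).symm z ∈ (chartAt (Euc n) x₁).source :=
        ((chartAt (Euc n) x₀).continuousAt_symm hy).eventually
          ((chartAt (Euc n) x₁).open_source.mem_nhds hy₁)
      filter_upwards [this] with z hz
      exact (chartAt (Euc n) x₁).left_inv hz
    have h4 := congrArg (fun L : Euc n →L[ℝ] Euc n ↦ L w) (h2.symm.trans h3)
    rw [mfderiv_eq_fderiv] at h4
    exact h4
  have hg : gramMatrix x₀ y = (L.toLinearMap.toMatrix (EuclideanSpace.basisFun (Fin n) ℝ).toBasis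
        (EuclideanSpace.basisFun (Fin n) ℝ).toBasis).transpose *
      gramMatrix x₁ (chartAt (Euc n) x₁ ((chartAt (Euc n) x₀).symm y)) *
      L.toLinearMap.toMatrix (EuclideanSpace.basisFun (Fin n) ℝ).toBasis
        (EuclideanSpace.basisFun (Fin n) ℝ).toBasis := by
    ext i j
    have h1 : gramMatrix x₀ y i j = inner ℝ (coordVector x₁ (chartAt (Euc n) x₁ ((chartAt (Euc n) x₀).symm y)) (L (EuclideanSpace.single i 1)))
      (coordVector x₁ (chartAt (Euc n) x₁ ((chartAt (Euc n) x₀).symm y)) (L (EuclideanSpace.single j 1))) :=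
      (key _ _ hx _ _ _ _ (hLw _) (hLw _)).symm
    rw [h1, inner_coordVector_eq_gramMatrix]
    simp only [Matrix.mul_apply, dotProduct, Matrix.mulVec, Matrix.transpose_apply,
      LinearMap.toMatrix_apply, OrthonormalBasis.coe_toBasis, EuclideanSpace.basisFun_apply,
      OrthonormalBasis.coe_toBasis_repr_apply, EuclideanSpace.basisFun_repr,
      ContinuousLinearMap.coe_coe, Finset.mul_sum, Finset.sum_mul]
    rw [Finset.sum_comm]
    refine Finset.sum_congr rfl fun k _ ↦ Finset.sum_congr rfl fun l _ ↦ ?_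
    ring
  have hdet : (L.toLinearMap.toMatrix (EuclideanSpace.basisFun (Fin n) ℝ).toBasis
        (EuclideanSpace.basisFun (Fin n) ℝ).toBasis).det = L.det := LinearMap.det_toMatrix _ _
  rw [hg, Matrix.det_mul, Matrix.det_mul, Matrix.det_transpose, hdet,
    show L.det * (gramMatrix x₁ (chartAt (Euc n) x₁ ((chartAt (Euc n) x₀).symm y))).det * L.det =
      L.det ^ 2 * (gramMatrix x₁ (chartAt (Euc n) x₁ ((chartAt (Euc n) x₀).symm y))).det by ring,
    Real.sqrt_mul (sq_nonneg _), Real.sqrt_sq_eq_abs]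

/-- Change of variables by the transition map, whose Jacobian is exactly the ratio of the two
densities. -/
lemma chartVolume_eq_of_subset (x₀ x₁ : M) {A : Set M} (hA : MeasurableSet A)
    (h₀ : A ⊆ (chartAt (Euc n) x₀).source) (h₁ : A ⊆ (chartAt (Euc n) x₁).source) :
    chartVolume (n := n) x₁ A = chartVolume (n := n) x₀ A := by
  have himage : (chartAt (Euc n) x₁ ∘ (chartAt (Euc n) x₀).symm) ''
      ((chartAt (Euc n) x₀).target ∩ (chartAt (Euc n) x₀).symm ⁻¹' A) =
      (chartAt (Euc n) x₁).target ∩ (chartAt (Euc n) x₁).symm ⁻¹' A := by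
    ext z
    constructor
    · rintro ⟨y, ⟨_, hyA⟩, rfl⟩
      refine ⟨(chartAt (Euc n) x₁).map_source (h₁ hyA), ?_⟩
      simp only [mem_preimage, Function.comp]
      rwa [(chartAt (Euc n) x₁).left_inv (h₁ hyA)]
    · rintro ⟨hz, hzA⟩
      refine ⟨chartAt (Euc n) x₀ ((chartAt (Euc n) x₁).symm z),
        ⟨(chartAt (Euc n) x₀).map_source (h₀ hzA), ?_⟩, ?_⟩
      · simp only [mem_preimage]
        rwa [(chartAt (Euc n) x₀).left_inv (h₀ hzA)]
      · simp only [Function.comp]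
        rw [(chartAt (Euc n) x₀).left_inv (h₀ hzA), (chartAt (Euc n) x₁).right_inv hz]
  have hm := measurableSet_chart_target_inter_preimage (n := n) x₀ hA
  rw [chartVolume_apply x₁ hA, chartVolume_apply x₀ hA, ← himage]
  rw [lintegral_image_eq_lintegral_abs_det_fderiv_mul volume hm
    (f' := fun y ↦ fderiv ℝ (chartAt (Euc n) x₁ ∘ (chartAt (Euc n) x₀).symm) y)]
  · refine setLIntegral_congr_fun hm fun y hy ↦ ?_
    rw [sqrt_det_gramMatrix_eq x₀ x₁ hy.1 (h₁ hy.2), ENNReal.ofReal_mul (abs_nonneg _)]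
    rfl
  · intro y hy
    have h1 := (mdifferentiableAt_chart (n := n) x₁ (h₁ hy.2)).comp y
      (mdifferentiableAt_chart_symm x₀ hy.1)
    exact (mdifferentiableAt_iff_differentiableAt.1 h1).hasFDerivAt.hasFDerivWithinAt
  · rintro y hy z hz h
    simp only [Function.comp] at h
    exact (chartAt (Euc n) x₀).symm.injOn hy.1 hz.1
      ((chartAt (Euc n) x₁).injOn (h₁ hy.2) (h₁ hz.2) h)

lemma chartVolume_compl_source (x₀ : M) :
    chartVolume (n := n) x₀ (chartAt (Euc n) x₀).sourceᶜ = 0 := by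
  rw [chartVolume_apply x₀ (chartAt (Euc n) x₀).open_source.measurableSet.compl]
  have : (chartAt (Euc n) x₀).target ∩ (chartAt (Euc n) x₀).symm ⁻¹' (chartAt (Euc n) x₀).sourceᶜ =
      ∅ := by
    ext y
    simp only [mem_inter_iff, mem_preimage, mem_compl_iff, mem_empty_iff_false, iff_false, not_and,
      not_not]
    exact fun h ↦ (chartAt (Euc n) x₀).map_target h
  rw [this]
  simp

/-- A supremum of measures could exceed its members on a chart. It does not: every `chartVolume x₁`
is at most `chartVolume x₀` plus the part of the total volume outside the chart at `x₀`, because the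
chart volumes agree on overlaps. -/
lemma riemannianVolume_restrict_source (x₀ : M) :
    (riemannianVolume n M).restrict (chartAt (Euc n) x₀).source = chartVolume (n := n) x₀ := by
  have hS := (chartAt (Euc n) x₀).open_source.measurableSet
  have hself : (chartVolume (n := n) x₀).restrict (chartAt (Euc n) x₀).source = chartVolume x₀ :=
    Measure.restrict_eq_self_of_ae_mem (chartVolume_compl_source x₀)
  apply le_antisymm
  · have h : riemannianVolume n M ≤ chartVolume (n := n) x₀ +
        (riemannianVolume n M).restrict (chartAt (Euc n) x₀).sourceᶜ := by
      refine iSup_le fun x₁ ↦ Measure.le_iff.2 fun A hA ↦ ?_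
      rw [Measure.add_apply, ← measure_inter_add_sdiff A hS, Measure.restrict_apply hA]
      gcongr ?_ + ?_
      · have hS₁ := (chartAt (Euc n) x₁).open_source.measurableSet
        rw [← measure_inter_add_sdiff (A ∩ (chartAt (Euc n) x₀).source) hS₁]
        have h0 : chartVolume (n := n) x₁ ((A ∩ (chartAt (Euc n) x₀).source) \
            (chartAt (Euc n) x₁).source) = 0 :=
          measure_mono_null (fun x hx ↦ hx.2) (chartVolume_compl_source x₁)
        rw [h0, add_zero, chartVolume_eq_of_subset x₀ x₁ ((hA.inter hS).inter hS₁)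
          (fun x hx ↦ hx.1.2) (fun x hx ↦ hx.2)]
        exact measure_mono fun x hx ↦ hx.1.1
      · exact le_iSup (fun x : M ↦ chartVolume (n := n) x) x₁ _
    refine (Measure.restrict_mono_measure h _).trans ?_
    rw [Measure.restrict_add, hself, Measure.restrict_restrict hS]
    simp
  · rw [← hself]
    exact Measure.restrict_mono_measure (le_iSup (fun x : M ↦ chartVolume (n := n) x) x₀) _

/-- The weighted measure in the chart at `x₀`. -/
noncomputable def coordMeasure (φ : M → ℝ) (x₀ : M) : Measure (Euc n) :=
  (volume.restrict (chartAt (Euc n) x₀).target).withDensity fun y ↦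
    ENNReal.ofReal (Real.sqrt (gramMatrix x₀ y).det * Real.exp (-φ ((chartAt (Euc n) x₀).symm y)))

omit [IsManifold 𝓘(ℝ, Euc n) ∞ M]
  [IsContinuousRiemannianBundle (Euc n) (fun x : M ↦ TangentSpace 𝓘(ℝ, Euc n) x)]
  [MeasurableSpace M] [BorelSpace M] in
lemma coordMeasure_absolutelyContinuous (φ : M → ℝ) (x₀ : M) :
    coordMeasure (n := n) φ x₀ ≪ volume.restrict (chartAt (Euc n) x₀).target :=
  withDensity_absolutelyContinuous _ _

lemma aemeasurable_chart_symm_coordMeasure (φ : M → ℝ) (x₀ : M) :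
    AEMeasurable (chartAt (Euc n) x₀).symm (coordMeasure (n := n) φ x₀) :=
  (aemeasurable_chart_symm x₀).mono_ac (coordMeasure_absolutelyContinuous φ x₀)

lemma weightedVolume_restrict_source {φ : M → ℝ} (hφ : Continuous φ) (x₀ : M) :
    (weightedVolume n φ).restrict (chartAt (Euc n) x₀).source =
      (coordMeasure (n := n) φ x₀).map (chartAt (Euc n) x₀).symm := by
  have hS := (chartAt (Euc n) x₀).open_source.measurableSet
  have hT := (chartAt (Euc n) x₀).open_target.measurableSet
  have he : Measurable fun x : M ↦ ENNReal.ofReal (Real.exp (-φ x)) := by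
    have := hφ.measurable
    fun_prop
  rw [weightedVolume, restrict_withDensity hS, riemannianVolume_restrict_source]
  ext A hA
  have hm := aemeasurable_chart_symm (n := n) x₀
  have hm' := (hm.mono_ac (withDensity_absolutelyContinuous (volume.restrict (chartAt (Euc n) x₀).target)
      fun y ↦ ENNReal.ofReal (Real.sqrt (gramMatrix x₀ y).det)))
  have hd : AEMeasurable (fun y ↦ ENNReal.ofReal (Real.sqrt (gramMatrix (n := n) x₀ y).det))
      (volume.restrict (chartAt (Euc n) x₀).target) :=
    ((continuousOn_gramMatrix_det x₀).sqrt.aemeasurable hT).ennreal_ofReal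
  have he' : AEMeasurable (fun y ↦ ENNReal.ofReal (Real.exp (-φ ((chartAt (Euc n) x₀).symm y))))
      (volume.restrict (chartAt (Euc n) x₀).target) := he.comp_aemeasurable hm
  have hprod : coordMeasure (n := n) φ x₀ =
      ((volume.restrict (chartAt (Euc n) x₀).target).withDensity
        fun y ↦ ENNReal.ofReal (Real.sqrt (gramMatrix x₀ y).det)).withDensity
        fun y ↦ ENNReal.ofReal (Real.exp (-φ ((chartAt (Euc n) x₀).symm y))) := by
    rw [← withDensity_mul₀ hd he', coordMeasure]
    congr 1
    ext y
    simp [ENNReal.ofReal_mul (Real.sqrt_nonneg _)]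
  rw [withDensity_apply _ hA, Measure.map_apply_of_aemeasurable
    (aemeasurable_chart_symm_coordMeasure φ x₀) hA, hprod, chartVolume,
    ← lintegral_indicator hA, lintegral_map' (he.indicator hA).aemeasurable hm']
  rw [withDensity_apply₀ _ (hm'.nullMeasurableSet_preimage hA),
    ← lintegral_indicator₀ (hm'.nullMeasurableSet_preimage hA)]
  rfl

lemma coordMeasure_compl_target (φ : M → ℝ) (x₀ : M) :
    coordMeasure (n := n) φ x₀ (chartAt (Euc n) x₀).targetᶜ = 0 := by
  apply coordMeasure_absolutelyContinuous φ x₀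
  rw [Measure.restrict_apply (chartAt (Euc n) x₀).open_target.measurableSet.compl,
    compl_inter_self, measure_empty]

lemma ae_mem_target_coordMeasure (φ : M → ℝ) (x₀ : M) :
    ∀ᵐ y ∂(coordMeasure (n := n) φ x₀), y ∈ (chartAt (Euc n) x₀).target :=
  measure_eq_zero_iff_ae_notMem.1 (coordMeasure_compl_target φ x₀) |>.mono fun _ h ↦ by simpa using h

lemma continuousOn_coordDensity {φ : M → ℝ} (hφ : Continuous φ) (x₀ : M) :
    ContinuousOn (fun y ↦ Real.sqrt (gramMatrix (n := n) x₀ y).det *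
      Real.exp (-φ ((chartAt (Euc n) x₀).symm y))) (chartAt (Euc n) x₀).target :=
  (continuousOn_gramMatrix_det x₀).sqrt.mul
    ((hφ.comp_continuousOn (chartAt (Euc n) x₀).continuousOn_symm).neg.rexp)

lemma coordDensity_pos (φ : M → ℝ) (x₀ : M) {y : Euc n} (hy : y ∈ (chartAt (Euc n) x₀).target) :
    0 < Real.sqrt (gramMatrix (n := n) x₀ y).det *
      Real.exp (-φ ((chartAt (Euc n) x₀).symm y)) :=
  mul_pos (Real.sqrt_pos.2 (gramMatrix_posDef x₀ hy).det_pos) (Real.exp_pos _)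

lemma volume_restrict_absolutelyContinuous_coordMeasure {φ : M → ℝ} (hφ : Continuous φ) (x₀ : M) :
    volume.restrict (chartAt (Euc n) x₀).target ≪ coordMeasure (n := n) φ x₀ := by
  have hT := (chartAt (Euc n) x₀).open_target.measurableSet
  apply withDensity_absolutelyContinuous'
  · exact ((continuousOn_coordDensity hφ x₀).aemeasurable hT).ennreal_ofReal
  · filter_upwards [ae_restrict_mem hT] with y hy
    exact (ENNReal.ofReal_pos.2 (coordDensity_pos φ x₀ hy)).ne'

/-- On compact sets of coordinates, the weighted measure and the Lebesgue measure are
comparable. -/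
lemma exists_coordMeasure_le {φ : M → ℝ} (hφ : Continuous φ) (x₀ : M) {K : Set (Euc n)}
    (hK : IsCompact K) (hKt : K ⊆ (chartAt (Euc n) x₀).target) :
    ∃ A : ℝ≥0∞, A ≠ ⊤ ∧ volume.restrict K ≤ A • coordMeasure (n := n) φ x₀ ∧
      (coordMeasure (n := n) φ x₀).restrict K ≤ A • volume.restrict K := by
  have hd := (continuousOn_coordDensity (n := n) hφ x₀).mono hKt
  obtain ⟨A₁, hA₁⟩ := hK.bddAbove_image hd
  obtain ⟨A₂, hA₂⟩ := hK.bddAbove_image (hd.inv₀ fun y hy ↦ (coordDensity_pos φ x₀ (hKt hy)).ne')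
  have hcoord : ∀ A, MeasurableSet A → coordMeasure (n := n) φ x₀ (A ∩ K) =
      ∫⁻ y in A ∩ K, ENNReal.ofReal (Real.sqrt (gramMatrix (n := n) x₀ y).det *
        Real.exp (-φ ((chartAt (Euc n) x₀).symm y))) := by
    intro A hA
    have hAK := hA.inter hK.measurableSet
    rw [coordMeasure, withDensity_apply _ hAK, Measure.restrict_restrict hAK,
      inter_eq_left.2 (inter_subset_right.trans hKt)]
  refine ⟨ENNReal.ofReal (max A₁ A₂), ENNReal.ofReal_ne_top, Measure.le_iff.2 fun A hA ↦ ?_,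
    Measure.le_iff.2 fun A hA ↦ ?_⟩
  · have hAK := hA.inter hK.measurableSet
    rw [Measure.restrict_apply hA, Measure.smul_apply, smul_eq_mul]
    refine le_trans ?_ (mul_le_mul_right (measure_mono (t := A) (s := A ∩ K) inter_subset_left) _)
    rw [hcoord A hA, ← lintegral_const_mul' _ _ ENNReal.ofReal_ne_top, ← setLIntegral_one]
    refine setLIntegral_mono_ae' hAK (ae_of_all _ fun y hy ↦ ?_)
    rw [← ENNReal.ofReal_mul' (coordDensity_pos φ x₀ (hKt hy.2)).le, ← ENNReal.ofReal_one]
    apply ENNReal.ofReal_le_ofReal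
    have h1 := hA₂ ⟨y, hy.2, rfl⟩
    refine ((inv_le_iff_one_le_mul₀ (coordDensity_pos φ x₀ (hKt hy.2))).1 h1).trans (mul_le_mul_of_nonneg_right (le_max_right _ _)
      (coordDensity_pos φ x₀ (hKt hy.2)).le)
  · have hAK := hA.inter hK.measurableSet
    rw [Measure.restrict_apply hA, Measure.smul_apply, smul_eq_mul, Measure.restrict_apply hA,
      hcoord A hA, ← setLIntegral_const]
    refine setLIntegral_mono_ae' hAK (ae_of_all _ fun y hy ↦ ?_)
    exact ENNReal.ofReal_le_ofReal ((hA₁ ⟨y, hy.2, rfl⟩).trans (le_max_left _ _))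

lemma map_chart_weightedVolume {φ : M → ℝ} (hφ : Continuous φ) (x₀ : M) :
    ((weightedVolume n φ).restrict (chartAt (Euc n) x₀).source).map (chartAt (Euc n) x₀) =
      coordMeasure (n := n) φ x₀ := by
  have hc : AEMeasurable (chartAt (Euc n) x₀)
      ((weightedVolume n φ).restrict (chartAt (Euc n) x₀).source) :=
    (chartAt (Euc n) x₀).continuousOn.aemeasurable (chartAt (Euc n) x₀).open_source.measurableSet
  rw [weightedVolume_restrict_source hφ] at hc ⊢
  rw [AEMeasurable.map_map_of_aemeasurable hc (aemeasurable_chart_symm_coordMeasure φ x₀)]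
  have : (chartAt (Euc n) x₀ ∘ (chartAt (Euc n) x₀).symm : Euc n → Euc n)
      =ᵐ[coordMeasure (n := n) φ x₀] id := by
    filter_upwards [ae_mem_target_coordMeasure φ x₀] with y hy
    exact (chartAt (Euc n) x₀).right_inv hy
  rw [Measure.map_congr this, Measure.map_id]

lemma aestronglyMeasurable_restrict_source_iff {φ : M → ℝ} (hφ : Continuous φ) (x₀ : M)
    {F : M → ℝ} : AEStronglyMeasurable F
      ((weightedVolume n φ).restrict (chartAt (Euc n) x₀).source) ↔
    AEStronglyMeasurable (fun y ↦ F ((chartAt (Euc n) x₀).symm y))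
      (volume.restrict (chartAt (Euc n) x₀).target) := by
  have hS := (chartAt (Euc n) x₀).open_source.measurableSet
  constructor
  · intro h
    rw [weightedVolume_restrict_source hφ] at h
    exact (h.comp_aemeasurable (aemeasurable_chart_symm_coordMeasure φ x₀)).mono_ac
      (volume_restrict_absolutelyContinuous_coordMeasure hφ x₀)
  · intro h
    have hc : AEMeasurable (chartAt (Euc n) x₀)
        ((weightedVolume n φ).restrict (chartAt (Euc n) x₀).source) :=
      (chartAt (Euc n) x₀).continuousOn.aemeasurable hS
    have h1 := h.mono_ac (coordMeasure_absolutelyContinuous φ x₀)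
    rw [← map_chart_weightedVolume hφ] at h1
    refine (h1.comp_aemeasurable hc).congr ?_
    filter_upwards [ae_restrict_mem hS] with x hx
    simp [(chartAt (Euc n) x₀).left_inv hx]

lemma aestronglyMeasurable_of_chart [SecondCountableTopology M] {φ : M → ℝ} (hφ : Continuous φ)
    {F : M → ℝ} (hF : ∀ x₀ : M, AEStronglyMeasurable (fun y ↦ F ((chartAt (Euc n) x₀).symm y))
      (volume.restrict (chartAt (Euc n) x₀).target)) :
    AEStronglyMeasurable F (weightedVolume n φ) := by
  obtain ⟨s, hs, hcov⟩ := TopologicalSpace.countable_cover_nhds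
    (fun x : M ↦ (chartAt (Euc n) x).open_source.mem_nhds (mem_chart_source (Euc n) x))
  have : Countable s := hs.to_subtype
  rw [← Measure.restrict_univ (μ := weightedVolume n φ), ← hcov, biUnion_eq_iUnion,
    aestronglyMeasurable_iUnion_iff]
  exact fun x ↦ (aestronglyMeasurable_restrict_source_iff hφ x.1).2 (hF x.1)

lemma setIntegral_source {φ : M → ℝ} (hφ : Continuous φ) (x₀ : M) {F : M → ℝ}
    (hF : AEStronglyMeasurable F ((weightedVolume n φ).restrict (chartAt (Euc n) x₀).source)) :
    ∫ x in (chartAt (Euc n) x₀).source, F x ∂(weightedVolume n φ) =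
      ∫ y, F ((chartAt (Euc n) x₀).symm y) ∂(coordMeasure (n := n) φ x₀) := by
  rw [weightedVolume_restrict_source hφ] at hF ⊢
  exact integral_map (aemeasurable_chart_symm_coordMeasure φ x₀) hF

lemma isLocallyFiniteMeasure_weightedVolume {φ : M → ℝ} (hφ : Continuous φ) :
    IsLocallyFiniteMeasure (weightedVolume (M := M) n φ) := by
  refine ⟨fun x ↦ ?_⟩
  obtain ⟨K, hK, hKx, hKt⟩ := exists_compact_subset (chartAt (Euc n) x).open_target
    (mem_chart_target (Euc n) x)
  obtain ⟨A, hA, -, hle⟩ := exists_coordMeasure_le (n := n) hφ x hK hKt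
  have hS := (chartAt (Euc n) x).open_source.measurableSet
  have hU : (chartAt (Euc n) x).source ∩ (chartAt (Euc n) x) ⁻¹' interior K ∈ 𝓝 x :=
    ((chartAt (Euc n) x).isOpen_inter_preimage isOpen_interior).mem_nhds
      ⟨mem_chart_source _ _, hKx⟩
  refine ⟨_, hU, ?_⟩
  have hUm := ((chartAt (Euc n) x).isOpen_inter_preimage (isOpen_interior (s := K))).measurableSet
  have hc : AEMeasurable (chartAt (Euc n) x)
        ((weightedVolume n φ).restrict (chartAt (Euc n) x).source) :=
      (chartAt (Euc n) x).continuousOn.aemeasurable hS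
  have h1 : weightedVolume n φ ((chartAt (Euc n) x).source ∩ (chartAt (Euc n) x) ⁻¹' interior K) ≤
      coordMeasure (n := n) φ x K := by
    rw [← map_chart_weightedVolume hφ, Measure.map_apply_of_aemeasurable hc hK.measurableSet]
    calc _ = (weightedVolume n φ).restrict (chartAt (Euc n) x).source
          ((chartAt (Euc n) x).source ∩ (chartAt (Euc n) x) ⁻¹' interior K) := by
          rw [Measure.restrict_apply hUm, inter_eq_left.2 inter_subset_left]
      _ ≤ _ := measure_mono fun z hz ↦ show chartAt (Euc n) x z ∈ K from interior_subset hz.2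
  refine h1.trans_lt ?_
  have h2 := hle K
  rw [Measure.restrict_apply_self, Measure.smul_apply, Measure.restrict_apply_self, smul_eq_mul] at h2
  exact h2.trans_lt (ENNReal.mul_lt_top hA.lt_top hK.measure_lt_top)

lemma IsWeakGradient.aestronglyMeasurable_coordRepr {u : M → ℝ}
    {G : ∀ x : M, TangentSpace 𝓘(ℝ, Euc n) x} (hG : IsWeakGradient u G) (x₀ : M) (i : Fin n) :
    AEStronglyMeasurable (fun y ↦ coordRepr x₀ y (G ((chartAt (Euc n) x₀).symm y)) i)
      (volume.restrict (chartAt (Euc n) x₀).target) := by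
  have hT := (chartAt (Euc n) x₀).open_target.measurableSet
  have h : AEStronglyMeasurable (fun y ↦ ∑ j, (gramMatrix x₀ y)⁻¹ i j *
      inner ℝ (G ((chartAt (Euc n) x₀).symm y)) (coordVector x₀ y (EuclideanSpace.single j 1)))
      (volume.restrict (chartAt (Euc n) x₀).target) := by
    refine Finset.aestronglyMeasurable_fun_sum _ fun j _ ↦ ?_
    refine AEStronglyMeasurable.mul ?_ ((hG x₀).2 (EuclideanSpace.single j 1)).1.aestronglyMeasurable
    have h1 := continuousOn_gramMatrix_inv (n := n) x₀
    exact ContinuousOn.aestronglyMeasurable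
      (continuousOn_pi.1 (continuousOn_pi.1 h1 i) j) hT
  refine h.congr ?_
  filter_upwards [ae_restrict_mem hT] with y hy
  have := congrFun (gramMatrix_mulVec_coordRepr x₀ hy (G ((chartAt (Euc n) x₀).symm y))) i
  exact this.symm

lemma IsWeakGradient.aestronglyMeasurable_inner [SecondCountableTopology M]
    {φ : M → ℝ} (hφ : Continuous φ) {u v : M → ℝ}
    {G H : ∀ x : M, TangentSpace 𝓘(ℝ, Euc n) x} (hG : IsWeakGradient u G)
    (hH : IsWeakGradient v H) :
    AEStronglyMeasurable (fun x ↦ inner ℝ (G x) (H x)) (weightedVolume n φ) := by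
  refine aestronglyMeasurable_of_chart hφ fun x₀ ↦ ?_
  have hT := (chartAt (Euc n) x₀).open_target.measurableSet
  have h : AEStronglyMeasurable (fun y ↦ ∑ i, coordRepr x₀ y (H ((chartAt (Euc n) x₀).symm y)) i *
      inner ℝ (G ((chartAt (Euc n) x₀).symm y)) (coordVector x₀ y (EuclideanSpace.single i 1)))
      (volume.restrict (chartAt (Euc n) x₀).target) :=
    Finset.aestronglyMeasurable_fun_sum _ fun i _ ↦
      (hH.aestronglyMeasurable_coordRepr x₀ i).mul
        ((hG x₀).2 (EuclideanSpace.single i 1)).1.aestronglyMeasurable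
  refine h.congr ?_
  filter_upwards [ae_restrict_mem hT] with y hy
  exact (inner_eq_sum_coordRepr x₀ hy _ _).symm

lemma IsWeakGradient.aestronglyMeasurable [SecondCountableTopology M]
    {φ : M → ℝ} (hφ : Continuous φ) {u : M → ℝ}
    {G : ∀ x : M, TangentSpace 𝓘(ℝ, Euc n) x} (hG : IsWeakGradient u G) :
    AEStronglyMeasurable u (weightedVolume n φ) :=
  aestronglyMeasurable_of_chart hφ fun x₀ ↦ (hG x₀).1.aestronglyMeasurable

end ChartMeasure

/-! ### Mollification on Euclidean space. -/

section Mollifier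

variable {n : ℕ}

/-- The `k`-th standard bump function, supported in the ball of radius `1 / (k + 1)`. -/
noncomputable def mollBump (n k : ℕ) : ContDiffBump (0 : Euc n) where
  rIn := 1 / (k + 1) / 2
  rOut := 1 / (k + 1)
  rIn_pos := by positivity
  rIn_lt_rOut := by
    have : (0 : ℝ) < 1 / (k + 1) := by positivity
    linarith

/-- The `k`-th standard mollification of a function on Euclidean space. -/
noncomputable def mollify (k : ℕ) (g : Euc n → ℝ) : Euc n → ℝ :=
  MeasureTheory.convolution ((mollBump n k).normed volume) g (ContinuousLinearMap.lsmul ℝ ℝ) volume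

lemma tendsto_mollBump_rOut : Tendsto (fun k ↦ (mollBump n k).rOut) atTop (𝓝 0) :=
  tendsto_one_div_add_atTop_nhds_zero_nat

lemma mollify_apply (k : ℕ) (g : Euc n → ℝ) (x : Euc n) :
    mollify k g x = ∫ t, (mollBump n k).normed volume t * g (x - t) := rfl

lemma mollify_apply' (k : ℕ) (g : Euc n → ℝ) (x : Euc n) :
    mollify k g x = ∫ t, (mollBump n k).normed volume (x - t) * g t := by
  rw [mollify, convolution_eq_swap]
  rfl

lemma contDiff_mollify (k : ℕ) {g : Euc n → ℝ} (hg : LocallyIntegrable g) :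
    ContDiff ℝ ∞ (mollify k g) :=
  (mollBump n k).hasCompactSupport_normed.contDiff_convolution_left _
    (mollBump n k).contDiff_normed hg

lemma ae_tendsto_mollify {g : Euc n → ℝ} (hg : LocallyIntegrable g) :
    ∀ᵐ x, Tendsto (fun k ↦ mollify k g x) atTop (𝓝 (g x)) := by
  refine ContDiffBump.ae_convolution_tendsto_right_of_locallyIntegrable (K := 2)
    tendsto_mollBump_rOut (Eventually.of_forall fun k ↦ ?_) hg
  simp only [mollBump]
  linarith

lemma integrable_mollify_integrand (k : ℕ) {g : Euc n → ℝ} (hg : LocallyIntegrable g) (x : Euc n) :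
    Integrable (fun t ↦ (mollBump n k).normed volume t * g (x - t)) :=
  (mollBump n k).hasCompactSupport_normed.convolutionExists_left (ContinuousLinearMap.lsmul ℝ ℝ)
    (mollBump n k).continuous_normed hg x

lemma tendsto_eLpNorm_translate {p : ℝ≥0∞} (hp1 : 1 ≤ p) (hp : p ≠ ⊤) {g : Euc n → ℝ}
    (hg : MemLp g p) :
    Tendsto (fun z ↦ eLpNorm (fun y ↦ g (y - z) - g y) p volume) (𝓝 0) (𝓝 0) := by
  have : Fact (1 ≤ p) := ⟨hp1⟩
  let T : C(Euc n × Euc n, Euc n) := ⟨fun a ↦ a.2 - a.1, by fun_prop⟩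
  have hT : ∀ z, MeasurePreserving (T.curry z) (volume : Measure (Euc n)) volume := fun z ↦
    measurePreserving_sub_right volume z
  have h := (ContinuousAt.compMeasurePreservingLp (f := fun _ : Euc n ↦ hg.toLp g) (z := 0)
    (g := fun z ↦ T.curry z) continuousAt_const T.curry.continuous.continuousAt hT hp)
  have h0 : Lp.compMeasurePreserving (T.curry 0) (hT 0) (hg.toLp g) = hg.toLp g := by
    rw [Lp.toLp_compMeasurePreserving]
    congr 1
    ext y
    simp [T]
  have h1 := (tendsto_iff_edist_tendsto_0.1 h)
  refine h1.congr fun z ↦ ?_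
  beta_reduce
  rw [h0, Lp.toLp_compMeasurePreserving, Lp.edist_toLp_toLp]
  rfl

/-- Young's inequality for the difference between a function and its mollification. -/
lemma lintegral_mollify_sub_rpow_le (k : ℕ) {p : ℝ} (hp : 1 ≤ p) {g : Euc n → ℝ}
    (hgm : StronglyMeasurable g) (hg : LocallyIntegrable g) :
    ∫⁻ y, ‖mollify k g y - g y‖ₑ ^ p ≤
      ∫⁻ z, ENNReal.ofReal ((mollBump n k).normed volume z) * ∫⁻ y, ‖g (y - z) - g y‖ₑ ^ p := by
  set b := (mollBump n k).normed volume with hb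
  have hbm : Measurable fun z ↦ ENNReal.ofReal (b z) :=
    (mollBump n k).continuous_normed.measurable.ennreal_ofReal
  have hb0 : ∀ z, 0 ≤ b z := (mollBump n k).nonneg_normed
  have hbint : Integrable b := (mollBump n k).continuous_normed.integrable_of_hasCompactSupport
    (mollBump n k).hasCompactSupport_normed
  -- The bump is a probability density, so monotonicity of the mean norms in the exponent plays the
  -- part of Jensen's inequality.
  have hprob : IsProbabilityMeasure (volume.withDensity fun z ↦ ENNReal.ofReal (b z)) := by
    refine ⟨?_⟩
    rw [withDensity_apply _ .univ, Measure.restrict_univ, ← ofReal_integral_eq_lintegral_ofReal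
      hbint (ae_of_all _ hb0), (mollBump n k).integral_normed, ENNReal.ofReal_one]
  have hjm : StronglyMeasurable fun a : Euc n × Euc n ↦ g (a.1 - a.2) - g a.1 :=
    (hgm.comp_measurable (measurable_fst.sub measurable_snd)).sub (hgm.comp_measurable measurable_fst)
  have key : ∀ y, ‖mollify k g y - g y‖ₑ ^ p ≤
      ∫⁻ z, ENNReal.ofReal (b z) * ‖g (y - z) - g y‖ₑ ^ p := by
    intro y
    have h1 : mollify k g y - g y = ∫ z, b z * (g (y - z) - g y) := by
      simp_rw [mul_sub]
      rw [integral_sub (integrable_mollify_integrand k hg y) (hbint.mul_const _),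
        integral_mul_const, (mollBump n k).integral_normed, one_mul, mollify_apply]
    have hym : StronglyMeasurable fun z ↦ g (y - z) - g y := hjm.comp_measurable measurable_prodMk_left
    have h2 : ‖mollify k g y - g y‖ₑ ≤
        eLpNorm' (fun z ↦ g (y - z) - g y) 1 (volume.withDensity fun z ↦ ENNReal.ofReal (b z)) := by
      rw [h1]
      refine (enorm_integral_le_lintegral_enorm _).trans_eq ?_
      simp only [eLpNorm', ENNReal.rpow_one, div_one]
      rw [lintegral_withDensity_eq_lintegral_mul _ hbm hym.measurable.enorm]
      refine lintegral_congr fun z ↦ ?_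
      rw [enorm_mul, Real.enorm_eq_ofReal (hb0 z)]
      rfl
    have h3 := h2.trans (eLpNorm'_le_eLpNorm'_of_exponent_le one_pos hp _ hym.aestronglyMeasurable)
    calc _ ≤ _ := ENNReal.rpow_le_rpow h3 (by linarith)
      _ = _ := by
        rw [eLpNorm', ← ENNReal.rpow_mul, one_div_mul_cancel (by linarith), ENNReal.rpow_one,
          lintegral_withDensity_eq_lintegral_mul _ hbm (hym.measurable.enorm.pow_const p)]
        rfl
  refine (lintegral_mono key).trans_eq ?_
  rw [lintegral_lintegral_swap]
  · refine lintegral_congr fun z ↦ lintegral_const_mul' _ _ ENNReal.ofReal_ne_top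
  · exact ((hbm.comp measurable_snd).mul (hjm.measurable.enorm.pow_const p)).aemeasurable

lemma mollify_congr_ae (k : ℕ) {g g' : Euc n → ℝ} (h : g =ᵐ[volume] g') :
    mollify k g = mollify k g' :=
  convolution_congr _ (ae_eq_refl _) h

/-- Mollifications converge in `L^p`. -/
lemma tendsto_eLpNorm_mollify {p : ℝ} (hp : 1 ≤ p) {g : Euc n → ℝ}
    (hg : MemLp g (ENNReal.ofReal p)) :
    Tendsto (fun k ↦ eLpNorm (fun y ↦ mollify k g y - g y) (ENNReal.ofReal p) volume)
      atTop (𝓝 0) := by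
  have hp1 : (1 : ℝ≥0∞) ≤ ENNReal.ofReal p := by simpa using hp
  have hp0 : ENNReal.ofReal p ≠ 0 := (one_pos.trans_le hp1).ne'
  have hpp : (ENNReal.ofReal p).toReal = p := ENNReal.toReal_ofReal (by linarith)
  wlog hgm : StronglyMeasurable g generalizing g
  · have hae := hg.1.ae_eq_mk
    have := this ((memLp_congr_ae hae).1 hg) hg.1.stronglyMeasurable_mk
    refine this.congr fun k ↦ ?_
    rw [mollify_congr_ae k hae]
    apply eLpNorm_congr_ae
    filter_upwards [hae] with y hy
    rw [hy]
  have hloc : LocallyIntegrable g := hg.locallyIntegrable hp1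
  have htr := tendsto_eLpNorm_translate hp1 ENNReal.ofReal_ne_top hg
  rw [ENNReal.tendsto_atTop_zero]
  intro ε hε
  have h1 := (ENNReal.tendsto_nhds_zero.1 htr) ε hε
  obtain ⟨r, hr, hball⟩ := Metric.eventually_nhds_iff.1 h1
  obtain ⟨k₀, hk₀⟩ := eventually_atTop.1 ((tendsto_mollBump_rOut (n := n)).eventually_lt_const hr)
  refine ⟨k₀, fun k hk ↦ ?_⟩
  have hbint : Integrable ((mollBump n k).normed volume) :=
    (mollBump n k).continuous_normed.integrable_of_hasCompactSupport
    (mollBump n k).hasCompactSupport_normed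
  rw [eLpNorm_eq_lintegral_rpow_enorm_toReal hp0 ENNReal.ofReal_ne_top, hpp]
  have h2 : ∫⁻ y, ‖mollify k g y - g y‖ₑ ^ p ≤ ε ^ p := by
    refine (lintegral_mollify_sub_rpow_le k hp hgm hloc).trans ?_
    calc _ ≤ ∫⁻ z, ENNReal.ofReal ((mollBump n k).normed volume z) * ε ^ p := by
          refine lintegral_mono fun z ↦ ?_
          by_cases hz : z ∈ Function.support ((mollBump n k).normed volume)
          · gcongr
            rw [(mollBump n k).support_normed_eq, Metric.mem_ball] at hz
            have h3 := hball (hz.trans (hk₀ k hk))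
            rw [eLpNorm_eq_lintegral_rpow_enorm_toReal hp0 ENNReal.ofReal_ne_top, hpp] at h3
            have h4 := ENNReal.rpow_le_rpow h3 (show 0 ≤ p by linarith)
            rwa [← ENNReal.rpow_mul, one_div_mul_cancel (by linarith), ENNReal.rpow_one] at h4
          · rw [Function.notMem_support.1 hz]
            simp
      _ = ε ^ p := by
          rw [lintegral_mul_const _ (mollBump n k).continuous_normed.measurable.ennreal_ofReal,
            ← ofReal_integral_eq_lintegral_ofReal hbint (ae_of_all _ (mollBump n k).nonneg_normed),
            (mollBump n k).integral_normed, ENNReal.ofReal_one, one_mul]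
  calc _ ≤ (ε ^ p) ^ (1 / p) := ENNReal.rpow_le_rpow h2 (by positivity)
    _ = ε := by rw [← ENNReal.rpow_mul, mul_one_div_cancel (by linarith), ENNReal.rpow_one]

lemma fderiv_mollify (k : ℕ) {g : Euc n → ℝ} (hg : LocallyIntegrable g) (y w : Euc n) :
    fderiv ℝ (mollify k g) y w =
      ∫ z, fderiv ℝ ((mollBump n k).normed volume) (y - z) w * g z := by
  have h1 := (mollBump n k).hasCompactSupport_normed.hasFDerivAt_convolution_left (μ := volume)
    (ContinuousLinearMap.lsmul ℝ ℝ) ((mollBump n k).contDiff_normed (μ := volume) (n := 1)) hg y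
  have h2 : fderiv ℝ (mollify k g) y = _ := h1.fderiv
  rw [h2, convolution_eq_swap]
  have hex : Integrable fun t ↦ (ContinuousLinearMap.precompL (Euc n) (ContinuousLinearMap.lsmul ℝ ℝ))
      (fderiv ℝ ((mollBump n k).normed volume) (y - t)) (g t) := by
    have := ((mollBump n k).hasCompactSupport_normed.fderiv ℝ).convolutionExists_left
      (ContinuousLinearMap.precompL (Euc n) (ContinuousLinearMap.lsmul ℝ ℝ))
      (((mollBump n k).contDiff_normed (μ := volume) (n := 1)).continuous_fderiv one_ne_zero) hg y
    exact this.integrable_swap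
  rw [ContinuousLinearMap.integral_apply hex]
  rfl

/-- Mollification commutes with weak differentiation, at points far from the boundary of the
domain. -/
lemma fderiv_mollify_indicator (k : ℕ) {Ω K K' : Set (Euc n)} (hΩ : MeasurableSet Ω)
    (hK' : IsCompact K') (hK'Ω : K' ⊆ Ω)
    {g g' : Euc n → ℝ} (hg : LocallyIntegrableOn g Ω) {w : Euc n}
    (hgg' : ∀ ψ : Euc n → ℝ, ContDiff ℝ ∞ ψ → HasCompactSupport ψ → tsupport ψ ⊆ Ω →
      ∫ y in Ω, g y * fderiv ℝ ψ y w = -∫ y in Ω, g' y * ψ y)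
    (hKK' : ∀ y ∈ K, Metric.closedBall y (mollBump n k).rOut ⊆ K') {y : Euc n} (hy : y ∈ K) :
    fderiv ℝ (mollify k (K'.indicator g)) y w = mollify k (K'.indicator g') y := by
  set b := (mollBump n k).normed (volume : Measure (Euc n)) with hb
  have hloc : LocallyIntegrable (K'.indicator g) :=
    ((integrable_indicator_iff hK'.measurableSet).2
      (hg.integrableOn_compact_subset hK'Ω hK')).locallyIntegrable
  -- The reflected and translated bump is itself a test function, as the ball about `y` stays in
  -- `K'`. Inserting it in the definition of the weak derivative is the whole proof; the reflection
  -- supplies the sign.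
  set ψ : Euc n → ℝ := fun z ↦ b (y - z) with hψ
  have hψs : ContDiff ℝ ∞ ψ := (mollBump n k).contDiff_normed.comp (contDiff_const.sub contDiff_id)
  have hts : tsupport ψ ⊆ Metric.closedBall y (mollBump n k).rOut := by
    refine closure_minimal (fun z hz ↦ ?_) Metric.isClosed_closedBall
    have : y - z ∈ Function.support b := hz
    rw [hb, (mollBump n k).support_normed_eq, Metric.mem_ball, dist_zero_right] at this
    rw [Metric.mem_closedBall, dist_comm, dist_eq_norm]
    exact this.le
  have hcs : HasCompactSupport ψ :=
    HasCompactSupport.of_support_subset_isCompact (isCompact_closedBall y (mollBump n k).rOut)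
      (subset_tsupport _ |>.trans hts)
  have hfd : ∀ z, fderiv ℝ ψ z w = -fderiv ℝ b (y - z) w := by
    intro z
    have hb1 : DifferentiableAt ℝ b (y - z) :=
      ((mollBump n k).contDiff_normed (n := 1)).differentiable one_ne_zero _
    have := hb1.hasFDerivAt.comp z ((hasFDerivAt_id z).const_sub y)
    have h2 : fderiv ℝ ψ z = _ := this.fderiv
    rw [h2]
    simp
  have h := hgg' ψ hψs hcs (hts.trans ((hKK' y hy).trans hK'Ω))
  have hout : ∀ z ∉ K', ψ z = 0 := fun z hz ↦
    image_eq_zero_of_notMem_tsupport fun h ↦ hz (hKK' y hy (hts h))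
  have hout' : ∀ z ∉ K', fderiv ℝ ψ z w = 0 := fun z hz ↦ by
    have : fderiv ℝ ψ z = 0 := by
      apply image_eq_zero_of_notMem_tsupport (f := fderiv ℝ ψ)
      exact fun h ↦ hz (hKK' y hy (hts (tsupport_fderiv_subset ℝ h)))
    rw [this]
    rfl
  rw [fderiv_mollify k hloc, mollify_apply']
  have e1 : ∫ z in Ω, g z * fderiv ℝ ψ z w = -∫ z, fderiv ℝ b (y - z) w * K'.indicator g z := by
    rw [← integral_indicator hΩ, ← integral_neg]
    refine integral_congr_ae (ae_of_all _ fun z ↦ ?_)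
    by_cases hz : z ∈ K'
    · simp only [indicator_of_mem hz, indicator_of_mem (hK'Ω hz), hfd]
      ring
    · by_cases hzΩ : z ∈ Ω
      · simp [indicator_of_notMem hz, indicator_of_mem hzΩ, hout' z hz]
      · simp [indicator_of_notMem hz, indicator_of_notMem hzΩ]
  have e2 : ∫ z in Ω, g' z * ψ z = ∫ z, b (y - z) * K'.indicator g' z := by
    rw [← integral_indicator hΩ]
    refine integral_congr_ae (ae_of_all _ fun z ↦ ?_)
    by_cases hz : z ∈ K'
    · simp only [indicator_of_mem hz, indicator_of_mem (hK'Ω hz), hψ]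
      ring
    · by_cases hzΩ : z ∈ Ω
      · simp [indicator_of_notMem hz, indicator_of_mem hzΩ, hout z hz]
      · simp [indicator_of_notMem hz, indicator_of_notMem hzΩ]
  rw [e1, e2] at h
  exact neg_injective h

end Mollifier

/-! ### Hopf-Rinow theorem and Lipschitz cutoffs in extended metric spaces. -/

section LengthSpace

/-- In a complete, locally compact length space, closed balls are compact. -/
lemma isCompact_closedEBall_of_length {X : Type*} [EMetricSpace X] [CompleteSpace X]
    [LocallyCompactSpace X]
    (hX : ∀ (x y : X) (a b : ℝ≥0∞), 0 < b → edist x y < a + b →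
      ∃ z, edist x z ≤ a ∧ edist z y < b)
    (x : X) (r : NNReal) : IsCompact (Metric.closedEBall x r) := by
  by_contra hr
  -- Let `R` be the infimum of the radii of noncompact balls. The ball of radius `R` is shown
  -- compact, then so is a slightly larger one, which contradicts the choice of `R`.
  set S : Set NNReal := {s | ¬ IsCompact (Metric.closedEBall x (s : ℝ≥0∞))} with hS
  have hbdd : BddBelow S := OrderBot.bddBelow S
  set R := sInf S with hR
  have hlt : ∀ s : NNReal, s < R → IsCompact (Metric.closedEBall x (s : ℝ≥0∞)) := fun s hs ↦ by
    by_contra h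
    exact absurd (csInf_le hbdd (show s ∈ S from h)) (not_le.2 hs)
  have hRc : IsCompact (Metric.closedEBall x (R : ℝ≥0∞)) := by
    refine isCompact_iff_totallyBounded_isComplete.2 ⟨?_, Metric.isClosed_closedEBall.isComplete⟩
    rcases eq_or_lt_of_le (zero_le (a := R)) with h0 | hpos
    · rw [← h0]
      simp only [ENNReal.coe_zero, Metric.closedEBall_zero]
      exact (finite_singleton x).totallyBounded
    rw [EMetric.totallyBounded_iff]
    intro ε hε
    obtain ⟨ε', hε', hε'ε⟩ := ENNReal.lt_iff_exists_nnreal_btwn.1 hε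
    have hε'0 : 0 < ε' := by exact_mod_cast hε'
    -- By the length property each point of the ball of radius `R` is within `ε'` of the compact
    -- ball of radius `R - ε'/2`; a finite `(ε - ε')`-net of the latter is an `ε`-net of the former.
    have hs : R - ε' / 2 < R := tsub_lt_self hpos (by positivity)
    have hK := (hlt _ hs).totallyBounded
    obtain ⟨t, ht, hcov⟩ := EMetric.totallyBounded_iff.1 hK (ε - ε') (tsub_pos_of_lt hε'ε)
    refine ⟨t, ht, fun y hy ↦ ?_⟩
    rw [Metric.mem_closedEBall'] at hy
    have h1 : edist x y < (R - ε' / 2 : NNReal) + (ε' : ℝ≥0∞) := by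
      refine hy.trans_lt ?_
      rw [← ENNReal.coe_add, ENNReal.coe_lt_coe]
      have h3 : ε' / 2 < ε' := half_lt_self hε'0
      calc R ≤ R - ε' / 2 + ε' / 2 := le_tsub_add
        _ < _ := by gcongr
    obtain ⟨z, hz, hzy⟩ := hX x y _ _ (by exact_mod_cast hε'0) h1
    obtain ⟨w, hw, hzw⟩ := mem_iUnion₂.1 (hcov (Metric.mem_closedEBall'.2 hz))
    refine mem_iUnion₂.2 ⟨w, hw, ?_⟩
    rw [Metric.mem_eball] at hzw ⊢
    calc edist y w ≤ edist y z + edist z w := edist_triangle _ _ _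
      _ < ε' + (ε - ε') := by
        rw [edist_comm y z]
        exact ENNReal.add_lt_add hzy hzw
      _ = ε := add_tsub_cancel_of_le hε'ε.le
  -- Local compactness gives a compact neighbourhood, hence room `δ` around the ball, and the length
  -- property places a larger ball inside it.
  obtain ⟨K, hK, hRK⟩ := exists_compact_superset hRc
  obtain ⟨δ, hδ, hthick⟩ := hRc.exists_thickening_subset_open isOpen_interior hRK
  set d : NNReal := δ.toNNReal / 2 with hd
  have hdpos : 0 < d := by
    have : 0 < δ.toNNReal := Real.toNNReal_pos.2 hδ
    positivity
  have hbig : IsCompact (Metric.closedEBall x ((R + d : NNReal) : ℝ≥0∞)) := by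
    refine hK.of_isClosed_subset Metric.isClosed_closedEBall fun y hy ↦ ?_
    apply interior_subset
    apply hthick
    rw [Metric.mem_closedEBall'] at hy
    have h1 : edist x y < (R : ℝ≥0∞) + ENNReal.ofReal δ := by
      refine hy.trans_lt ?_
      rw [ENNReal.ofReal, ← ENNReal.coe_add, ENNReal.coe_lt_coe]
      gcongr
      exact half_lt_self (Real.toNNReal_pos.2 hδ)
    obtain ⟨z, hz, hzy⟩ := hX x y _ _ (by simpa using hδ) h1
    rw [Metric.thickening, mem_ofPred_eq, Metric.infEDist_lt_iff]
    exact ⟨z, Metric.mem_closedEBall'.2 hz, by rwa [edist_comm]⟩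
  have hle : R + d ≤ R := by
    refine le_csInf ⟨r, hr⟩ fun s hs ↦ ?_
    by_contra hlt'
    apply hs
    refine hbig.of_isClosed_subset Metric.isClosed_closedEBall (Metric.closedEBall_subset_closedEBall ?_)
    exact_mod_cast (not_le.1 hlt').le
  exact absurd hle (not_le.2 (lt_add_of_pos_right _ hdpos))

/-- A complete, separable metric space with compact closed balls has Lipschitz cutoff functions
with arbitrarily small Lipschitz constants. -/
lemma exists_lipschitz_cutoff {X : Type*} [EMetricSpace X] [SecondCountableTopology X]
    (hX : ∀ (x : X) (r : NNReal), IsCompact (Metric.closedEBall x r)) :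
    ∃ χ : ℕ → X → ℝ, (∀ k x, 0 ≤ χ k x ∧ χ k x ≤ 1) ∧ (∀ k, HasCompactSupport (χ k)) ∧
      (∀ k : ℕ, LipschitzWith (1 / (k + 1)) (χ k)) ∧ ∀ x, Tendsto (fun k ↦ χ k x) atTop (𝓝 1) := by
  rcases isEmpty_or_nonempty X with hempty | hne
  · exact ⟨fun _ _ ↦ 0, by simp, fun _ ↦ HasCompactSupport.zero, fun _ x ↦ isEmptyElim x,
      fun x ↦ isEmptyElim x⟩
  set d := TopologicalSpace.denseSeq X with hd
  -- Several centres are needed, because distinct components lie at infinite distance; finitely many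
  -- of them keep the supports compact.
  set F : ℕ → Set X := fun k ↦ d '' Iic k with hF
  have hpos : ∀ k : ℕ, (0 : ℝ) < k + 1 := fun k ↦ by positivity
  have hlip : ∀ k : ℕ, LipschitzWith (1 / (k + 1))
      fun x ↦ (thickenedIndicator (hpos k) (F k) x : ℝ) := by
    intro k x y
    have h := lipschitzWith_thickenedIndicator (hpos k) (F k) x y
    have h2 : (((k : ℝ) + 1).toNNReal)⁻¹ = 1 / ((k : NNReal) + 1) := by
      rw [Real.toNNReal_add (by positivity) (by positivity)]
      simp
    rw [h2] at h
    exact h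
  refine ⟨fun k x ↦ (thickenedIndicator (hpos k) (F k) x : ℝ), fun k x ↦ ⟨NNReal.coe_nonneg _, ?_⟩,
    fun k ↦ ?_, fun k ↦ ?_, fun x ↦ ?_⟩
  · exact_mod_cast thickenedIndicator_le_one (hpos k) (F k) x
  · have hc : IsCompact (⋃ j ∈ Iic k, Metric.closedEBall (d j) ((k + 1 : NNReal) : ℝ≥0∞)) :=
      (finite_Iic k).isCompact_biUnion fun j _ ↦ hX _ _
    refine HasCompactSupport.intro hc fun x hx ↦ ?_
    refine NNReal.coe_eq_zero.2 (thickenedIndicator_zero (hpos k) _ fun hx' ↦ ?_)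
    apply hx
    rw [Metric.thickening, mem_ofPred_eq, Metric.infEDist_lt_iff] at hx'
    obtain ⟨_, ⟨j, hj, rfl⟩, hlt⟩ := hx'
    refine mem_iUnion₂.2 ⟨j, hj, ?_⟩
    rw [Metric.mem_closedEBall]
    refine hlt.le.trans (le_of_eq ?_)
    rw [ENNReal.ofReal]
    congr 1
    rw [Real.toNNReal_add (by positivity) (by positivity)]
    simp
  · exact hlip k
  -- A dense point within distance `1` of `x` belongs to `F k` for large `k`, where the cutoff is
  -- `1`; the Lipschitz bound then gives an error of at most `1/(k+1)` at `x`.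
  · obtain ⟨j, hj⟩ := (TopologicalSpace.denseRange_denseSeq X).exists_mem_open
      (Metric.isOpen_eball (x := x) (ε := 1)) ⟨x, Metric.mem_eball_self one_pos⟩
    rw [Metric.mem_eball'] at hj
    rw [tendsto_iff_dist_tendsto_zero]
    refine squeeze_zero' (Eventually.of_forall fun _ ↦ dist_nonneg) ?_
      tendsto_one_div_add_atTop_nhds_zero_nat
    filter_upwards [eventually_ge_atTop j] with k hk
    have h1 : thickenedIndicator (hpos k) (F k) (d j) = 1 :=
      thickenedIndicator_one (hpos k) _ ⟨j, hk, rfl⟩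
    have h2 := hlip k x (d j)
    beta_reduce at h2
    rw [h1, NNReal.coe_one] at h2
    have h3 : edist ((thickenedIndicator (hpos k) (F k) x : ℝ)) 1 ≤
        ((1 / ((k : NNReal) + 1) : NNReal) : ℝ≥0∞) :=
      h2.trans (mul_le_of_le_one_right' hj.le)
    rw [edist_dist, ← ENNReal.ofReal_coe_nnreal, ENNReal.ofReal_le_ofReal_iff (by positivity)] at h3
    simpa using h3

end LengthSpace

/-! ### Riemannian distance and coordinates. -/

section Length

/-- A Riemannian manifold is a length space. -/
lemma exists_edist_le_edist_lt (n : ℕ) {M : Type*} [EMetricSpace M] [ChartedSpace (Euc n) M]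
    [RiemannianBundle (fun x : M ↦ TangentSpace 𝓘(ℝ, Euc n) x)]
    [IsRiemannianManifold 𝓘(ℝ, Euc n) M] (x y : M) (a b : ℝ≥0∞) (hb : 0 < b) (hxy : edist x y < a + b) :
    ∃ z, edist x z ≤ a ∧ edist z y < b := by
  rcases le_total (edist x y) a with hle | hle
  · exact ⟨y, hle, by simpa using hb⟩
  have ha : a ≠ ⊤ := by
    rintro rfl
    simp [top_le_iff.1 hle] at hxy
  have hxy' := hxy
  rw [IsRiemannianManifold.out (I := 𝓘(ℝ, Euc n)) x y] at hxy'
  obtain ⟨γ, h0, h1, hγ, hlen, -, -⟩ :=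
    Manifold.exists_lt_locally_constant_of_riemannianEDist_lt hxy' (zero_lt_one (α := ℝ))
  have hcont : Continuous fun t ↦ edist x (γ t) := continuous_const.edist hγ.continuous
  -- The curve is stopped at distance exactly `a` from `x`. The first piece has length at least `a`,
  -- which leaves less than `b` for the second.
  obtain ⟨t, ht, hta⟩ := intermediate_value_Icc (zero_le_one (α := ℝ)) hcont.continuousOn
    (show a ∈ Icc (edist x (γ 0)) (edist x (γ 1)) by simpa [h0, h1] using hle)
  refine ⟨γ t, hta.le, ?_⟩
  have e1 : a ≤ Manifold.pathELength 𝓘(ℝ, Euc n) γ 0 t := by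
    rw [← hta]
    beta_reduce
    rw [IsRiemannianManifold.out (I := 𝓘(ℝ, Euc n)) x (γ t)]
    exact Manifold.riemannianEDist_le_pathELength hγ.contMDiffOn h0 rfl ht.1
  have e2 : edist (γ t) y ≤ Manifold.pathELength 𝓘(ℝ, Euc n) γ t 1 := by
    rw [IsRiemannianManifold.out (I := 𝓘(ℝ, Euc n)) (γ t) y]
    exact Manifold.riemannianEDist_le_pathELength hγ.contMDiffOn rfl h1 ht.2
  have e3 := Manifold.pathELength_add (I := 𝓘(ℝ, Euc n)) (γ := γ) ht.1 ht.2
  refine e2.trans_lt ?_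
  refine (ENNReal.add_lt_add_iff_left ha).1 (lt_of_le_of_lt ?_ hlen)
  rw [← e3]
  gcongr

variable {n : ℕ} {M : Type*} [EMetricSpace M] [ChartedSpace (Euc n) M]
  [IsManifold 𝓘(ℝ, Euc n) ∞ M]
  [RiemannianBundle (fun x : M ↦ TangentSpace 𝓘(ℝ, Euc n) x)]
  [IsContinuousRiemannianBundle (Euc n) (fun x : M ↦ TangentSpace 𝓘(ℝ, Euc n) x)]
  [IsRiemannianManifold 𝓘(ℝ, Euc n) M]

omit [IsRiemannianManifold 𝓘(ℝ, Euc n) M] in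
/-- Near a point, the Riemannian norms of the coordinate vector fields vary by a factor at most
two. -/
lemma exists_ball_norm_coordVector_le_two_mul (x₀ : M) :
    ∃ r : ℝ, 0 < r ∧ Metric.closedBall (chartAt (Euc n) x₀ x₀) r ⊆ (chartAt (Euc n) x₀).target ∧
      ∀ y ∈ Metric.closedBall (chartAt (Euc n) x₀ x₀) r,
      ∀ y' ∈ Metric.closedBall (chartAt (Euc n) x₀ x₀) r, ∀ w,
        ‖coordVector x₀ y w‖ ≤ 2 * ‖coordVector x₀ y' w‖ := by
  obtain ⟨r₀, hr₀, hball⟩ := Metric.nhds_basis_closedBall.mem_iff.1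
    ((chartAt (Euc n) x₀).open_target.mem_nhds (mem_chart_target (Euc n) x₀))
  obtain ⟨A, hA, -, hA2⟩ := exists_norm_coordVector_le (n := n) x₀ (isCompact_closedBall _ r₀) hball
  have hK := (isCompact_closedBall (chartAt (Euc n) x₀ x₀) r₀).prod
    (isCompact_sphere (0 : Euc n) 1)
  have huc := hK.uniformContinuousOn_of_continuous
    ((continuousOn_norm_coordVector (n := n) x₀).mono (prod_mono hball (subset_univ _)))
  -- On unit vectors the norm is at least `1 / A`, so an oscillation below `1 / A` is a factor of at
  -- most two.
  obtain ⟨δ, hδ, hclose⟩ := Metric.uniformContinuousOn_iff.1 huc (1 / A) (by positivity)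
  refine ⟨min r₀ (δ / 3), by positivity,
    (Metric.closedBall_subset_closedBall (min_le_left _ _)).trans hball, fun y hy y' hy' w ↦ ?_⟩
  have hyr := Metric.closedBall_subset_closedBall (min_le_left _ _) hy
  have hyr' := Metric.closedBall_subset_closedBall (min_le_left _ _) hy'
  have hdist : dist y y' < δ := by
    have h1 := (Metric.mem_closedBall.1 hy).trans (min_le_right _ _)
    have h2 := (Metric.mem_closedBall'.1 hy').trans (min_le_right _ _)
    have h3 := dist_triangle y (chartAt (Euc n) x₀ x₀) y'
    linarith
  rcases eq_or_ne w 0 with rfl | hw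
  · have h0 : ∀ z, coordVector (n := n) x₀ z 0 = 0 := fun z ↦ map_zero _
    simp [h0]
  have hhom : ∀ z, ‖coordVector (n := n) x₀ z w‖ =
      ‖w‖ * ‖coordVector x₀ z (‖w‖⁻¹ • w)‖ := by
    intro z
    have : coordVector x₀ z (‖w‖⁻¹ • w) = ‖w‖⁻¹ • coordVector x₀ z w := map_smul _ _ _
    rw [this, norm_smul, norm_inv, norm_norm, mul_inv_cancel_left₀ (norm_ne_zero_iff.2 hw)]
  have he : ‖‖w‖⁻¹ • w‖ = 1 := by simp [norm_smul, hw]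
  have h1 := hclose (y, ‖w‖⁻¹ • w) ⟨hyr, by simpa using he⟩ (y', ‖w‖⁻¹ • w)
    ⟨hyr', by simpa using he⟩ (by rw [Prod.dist_eq, dist_self]; exact max_lt hdist hδ)
  have h2 := hA2 y' hyr' (‖w‖⁻¹ • w)
  rw [he] at h2
  rw [hhom y, hhom y']
  have h3 : 1 / A ≤ ‖coordVector x₀ y' (‖w‖⁻¹ • w)‖ := by rwa [div_le_iff₀' hA]
  rw [Real.dist_eq] at h1
  have h4 := (abs_lt.1 h1).2
  have h5 : ‖coordVector x₀ y (‖w‖⁻¹ • w)‖ ≤ 2 * ‖coordVector x₀ y' (‖w‖⁻¹ • w)‖ := by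
    simp only at h4
    linarith
  nlinarith [norm_nonneg w]

omit [IsContinuousRiemannianBundle (Euc n) (fun x : M ↦ TangentSpace 𝓘(ℝ, Euc n) x)] in
/-- The distance between two points of a coordinate ball is controlled by the length of the
coordinate segment. -/
lemma edist_chart_symm_le (x₀ : M) {s : Set (Euc n)} (hs : Convex ℝ s)
    (hst : s ⊆ (chartAt (Euc n) x₀).target) {y y' : Euc n} (hy : y ∈ s) (hy' : y' ∈ s) {B : ℝ}
    (hB : ∀ z ∈ s, ‖coordVector x₀ z (y' - y)‖ ≤ B) :
    edist ((chartAt (Euc n) x₀).symm y) ((chartAt (Euc n) x₀).symm y') ≤ ENNReal.ofReal B := by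
  set ℓ : ℝ → Euc n := fun t ↦ AffineMap.lineMap (k := ℝ) y y' t with hℓ
  have hℓs : ∀ t ∈ Icc (0 : ℝ) 1, ℓ t ∈ s := fun t ht ↦ by
    rw [hℓ]
    exact hs.lineMap_mem hy hy' ht
  have hℓc : ContDiff ℝ ∞ ℓ := by
    rw [hℓ]
    exact (ContinuousAffineMap.lineMap (R := ℝ) y y').contDiff
  have hℓd : ∀ t, HasDerivAt ℓ (y' - y) t := fun t ↦ AffineMap.hasDerivAt_lineMap
  rw [IsRiemannianManifold.out (I := 𝓘(ℝ, Euc n))]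
  have hγ : ContMDiffOn 𝓘(ℝ, ℝ) 𝓘(ℝ, Euc n) 1 ((chartAt (Euc n) x₀).symm ∘ ℓ) (Icc 0 1) := by
    have h1 : ContMDiffOn 𝓘(ℝ, Euc n) 𝓘(ℝ, Euc n) 1 (chartAt (Euc n) x₀).symm
      (chartAt (Euc n) x₀).target := (contMDiffOn_chart_symm (n := ∞)).of_le (by simp)
    exact h1.comp (hℓc.of_le (by simp)).contMDiff.contMDiffOn fun t ht ↦ hst (hℓs t ht)
  refine (Manifold.riemannianEDist_le_pathELength hγ (by simp [hℓ]) (by simp [hℓ])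
    zero_le_one).trans ?_
  rw [Manifold.pathELength_eq_lintegral_mfderiv_Icc]
  have hbound : ∀ t ∈ Icc (0 : ℝ) 1,
      ‖mfderiv 𝓘(ℝ, ℝ) 𝓘(ℝ, Euc n) ((chartAt (Euc n) x₀).symm ∘ ℓ) t 1‖ₑ ≤ ENNReal.ofReal B := by
    intro t ht
    have h1 := mfderiv_comp (x := t) (I := 𝓘(ℝ, ℝ)) (I' := 𝓘(ℝ, Euc n)) (I'' := 𝓘(ℝ, Euc n))
      (mdifferentiableAt_chart_symm x₀ (hst (hℓs t ht)))
      ((hℓd t).differentiableAt.mdifferentiableAt)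
    have h2 : mfderiv 𝓘(ℝ, ℝ) 𝓘(ℝ, Euc n) ((chartAt (Euc n) x₀).symm ∘ ℓ) t 1 =
        coordVector x₀ (ℓ t) (y' - y) := by
      have h3 := congrArg (fun L : ℝ →L[ℝ] Euc n ↦ L 1) h1
      refine h3.trans ?_
      have h4 : (show ℝ →L[ℝ] Euc n from mfderiv 𝓘(ℝ, ℝ) 𝓘(ℝ, Euc n) ℓ t) 1 = y' - y := by
        rw [mfderiv_eq_fderiv]
        exact (hℓd t).deriv
      exact congrArg (fun w : Euc n ↦ (show Euc n →L[ℝ] Euc n from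
        mfderiv 𝓘(ℝ, Euc n) 𝓘(ℝ, Euc n) (chartAt (Euc n) x₀).symm (ℓ t)) w) h4
    rw [← ofReal_norm, h2]
    exact ENNReal.ofReal_le_ofReal (hB _ (hℓs t ht))
  calc _ ≤ ∫⁻ t in Icc (0 : ℝ) 1, ENNReal.ofReal B :=
        setLIntegral_mono_ae' measurableSet_Icc (ae_of_all _ hbound)
    _ = ENNReal.ofReal B := by simp

end Length

/-! ### Calculus of directional derivatives, and partitions of unity. -/

section DirDeriv

variable {n : ℕ} {M : Type*} [TopologicalSpace M] [ChartedSpace (Euc n) M]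

lemma dirDeriv_eq_zero_of_notMem_tsupport {η : M → ℝ} {x : M} (hx : x ∉ tsupport η)
    (X : TangentSpace 𝓘(ℝ, Euc n) x) : dirDeriv η x X = 0 := by
  have h1 : η =ᶠ[𝓝 x] fun _ ↦ (0 : ℝ) := notMem_tsupport_iff_eventuallyEq.1 hx
  have h2 := h1.mfderiv_eq (I := 𝓘(ℝ, Euc n)) (I' := 𝓘(ℝ, ℝ))
  have h3 := congrArg (fun L : Euc n →L[ℝ] ℝ ↦ L X) (h2.trans mfderiv_const)
  exact h3

lemma dirDeriv_mul {f g : M → ℝ} {x : M} (hf : MDifferentiableAt 𝓘(ℝ, Euc n) 𝓘(ℝ, ℝ) f x)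
    (hg : MDifferentiableAt 𝓘(ℝ, Euc n) 𝓘(ℝ, ℝ) g x) (X : TangentSpace 𝓘(ℝ, Euc n) x) :
    dirDeriv (fun x ↦ f x * g x) x X = g x * dirDeriv f x X + f x * dirDeriv g x X := by
  have h := (hf.hasMFDerivAt.mul hg.hasMFDerivAt).mfderiv
  have h3 := congrArg (fun L : Euc n →L[ℝ] ℝ ↦ L X) h
  exact h3.trans (add_comm _ _)

lemma dirDeriv_sum {ι : Type*} (s : Finset ι) {f : ι → M → ℝ} {x : M}
    (hf : ∀ i ∈ s, MDifferentiableAt 𝓘(ℝ, Euc n) 𝓘(ℝ, ℝ) (f i) x)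
    (X : TangentSpace 𝓘(ℝ, Euc n) x) :
    dirDeriv (fun x ↦ ∑ i ∈ s, f i x) x X = ∑ i ∈ s, dirDeriv (f i) x X := by
  classical
  have key : MDifferentiableAt 𝓘(ℝ, Euc n) 𝓘(ℝ, ℝ) (fun x ↦ ∑ i ∈ s, f i x) x ∧
      dirDeriv (fun x ↦ ∑ i ∈ s, f i x) x X = ∑ i ∈ s, dirDeriv (f i) x X := by
    induction s using Finset.induction_on with
    | empty =>
      refine ⟨by simpa using mdifferentiableAt_const, ?_⟩
      simp only [Finset.sum_empty]
      exact congrArg (fun L : Euc n →L[ℝ] ℝ ↦ L X) (mfderiv_const (c := (0 : ℝ)))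
    | insert i s hi ih =>
      obtain ⟨h1, h2⟩ := ih fun j hj ↦ hf j (Finset.mem_insert_of_mem hj)
      have h3 := hf i (Finset.mem_insert_self i s)
      have h4 := h3.hasMFDerivAt.add h1.hasMFDerivAt
      simp only [Finset.sum_insert hi]
      refine ⟨h4.mdifferentiableAt, ?_⟩
      rw [← h2]
      exact congrArg (fun L : Euc n →L[ℝ] ℝ ↦ L X) h4.mfderiv
  exact key.2

lemma IsTestFunction.mul {ρ g : M → ℝ} (hρ : IsTestFunction n ρ)
    (hg : ∀ x ∈ tsupport ρ, ContMDiffAt 𝓘(ℝ, Euc n) 𝓘(ℝ, ℝ) ∞ g x) :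
    IsTestFunction n (fun x ↦ ρ x * g x) :=
  ⟨contMDiff_of_tsupport fun x hx ↦ (hρ.1 x).mul (hg x (tsupport_mul_subset_left hx)),
    hρ.2.mul_right⟩

/-- The factor `g` is typically a function of the coordinates, meaningful on one chart only; off the
support of `ρ` all the terms vanish. -/
lemma dirDeriv_mul_of_tsupport {ρ g : M → ℝ} (hρ : ContMDiff 𝓘(ℝ, Euc n) 𝓘(ℝ, ℝ) ∞ ρ)
    (hg : ∀ x ∈ tsupport ρ, ContMDiffAt 𝓘(ℝ, Euc n) 𝓘(ℝ, ℝ) ∞ g x) (x : M)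
    (X : TangentSpace 𝓘(ℝ, Euc n) x) :
    dirDeriv (fun x ↦ ρ x * g x) x X = g x * dirDeriv ρ x X + ρ x * dirDeriv g x X := by
  by_cases hx : x ∈ tsupport ρ
  · exact dirDeriv_mul ((hρ x).mdifferentiableAt (by simp)) ((hg x hx).mdifferentiableAt (by simp)) X
  · rw [dirDeriv_eq_zero_of_notMem_tsupport (fun h ↦ hx (tsupport_mul_subset_left h)),
      dirDeriv_eq_zero_of_notMem_tsupport hx, image_eq_zero_of_notMem_tsupport hx]
    simp

variable [IsManifold 𝓘(ℝ, Euc n) ∞ M]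

lemma dirDeriv_comp_chart (x₀ : M) {y : Euc n} (hy : y ∈ (chartAt (Euc n) x₀).target)
    {G : Euc n → ℝ} (hG : DifferentiableAt ℝ G y)
    (X : TangentSpace 𝓘(ℝ, Euc n) ((chartAt (Euc n) x₀).symm y)) :
    dirDeriv (fun x ↦ G (chartAt (Euc n) x₀ x)) ((chartAt (Euc n) x₀).symm y) X =
      fderiv ℝ G y (coordRepr x₀ y X) := by
  have hr := (chartAt (Euc n) x₀).right_inv hy
  have hs := (chartAt (Euc n) x₀).map_target hy
  have h1 := mfderiv_comp_of_eq (x := (chartAt (Euc n) x₀).symm y) (y := y)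
    (I := 𝓘(ℝ, Euc n)) (I' := 𝓘(ℝ, Euc n)) (I'' := 𝓘(ℝ, ℝ))
    hG.mdifferentiableAt (mdifferentiableAt_chart x₀ hs) hr
  have h3 := congrArg (fun L : Euc n →L[ℝ] ℝ ↦ L X) h1
  refine h3.trans ?_
  have h4 := congrArg (fun z ↦ (show Euc n →L[ℝ] ℝ from
    mfderiv 𝓘(ℝ, Euc n) 𝓘(ℝ, ℝ) G z) (coordRepr x₀ y X)) hr
  refine h4.trans ?_
  rw [mfderiv_eq_fderiv]

lemma dirDeriv_coordVector (x₀ : M) {y : Euc n} (hy : y ∈ (chartAt (Euc n) x₀).target)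
    {η : M → ℝ}
    (hη : MDifferentiableAt 𝓘(ℝ, Euc n) 𝓘(ℝ, ℝ) η ((chartAt (Euc n) x₀).symm y)) (w : Euc n) :
    dirDeriv η ((chartAt (Euc n) x₀).symm y) (coordVector x₀ y w) =
      fderiv ℝ (fun z ↦ η ((chartAt (Euc n) x₀).symm z)) y w := by
  have h1 := mfderiv_comp (x := y) (I := 𝓘(ℝ, Euc n)) (I' := 𝓘(ℝ, Euc n)) (I'' := 𝓘(ℝ, ℝ))
    hη (mdifferentiableAt_chart_symm x₀ hy)
  rw [mfderiv_eq_fderiv] at h1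
  exact (congrArg (fun L : Euc n →L[ℝ] ℝ ↦ L w) h1).symm

lemma contMDiffAt_comp_chart (x₀ : M) {x : M} (hx : x ∈ (chartAt (Euc n) x₀).source)
    {G : Euc n → ℝ} (hG : ContDiff ℝ ∞ G) :
    ContMDiffAt 𝓘(ℝ, Euc n) 𝓘(ℝ, ℝ) ∞ (fun x ↦ G (chartAt (Euc n) x₀ x)) x :=
  hG.contMDiff.contMDiffAt.comp x (contMDiffOn_chart.contMDiffAt
    ((chartAt (Euc n) x₀).open_source.mem_nhds hx))

variable [RiemannianBundle (fun x : M ↦ TangentSpace 𝓘(ℝ, Euc n) x)]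
  [IsContinuousRiemannianBundle (Euc n) (fun x : M ↦ TangentSpace 𝓘(ℝ, Euc n) x)]

lemma IsTestFunction.exists_abs_dirDeriv_le {η : M → ℝ} (hη : IsTestFunction n η) :
    ∃ B : ℝ, 0 ≤ B ∧ ∀ x, ∀ X : TangentSpace 𝓘(ℝ, Euc n) x, |dirDeriv η x X| ≤ B * ‖X‖ := by
  have hloc : ∃ B : ℝ, 0 ≤ B ∧ ∀ x ∈ tsupport η, ∀ X : TangentSpace 𝓘(ℝ, Euc n) x,
      |dirDeriv η x X| ≤ B * ‖X‖ := by
    refine IsCompact.induction_on (p := fun s ↦ ∃ B : ℝ, 0 ≤ B ∧ ∀ x ∈ s,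
      ∀ X : TangentSpace 𝓘(ℝ, Euc n) x, |dirDeriv η x X| ≤ B * ‖X‖) hη.2 ⟨0, le_rfl, by simp⟩ ?_ ?_ ?_
    · rintro s t hst ⟨B, hB, h⟩
      exact ⟨B, hB, fun x hx ↦ h x (hst hx)⟩
    · rintro s t ⟨B, hB, h⟩ ⟨B', hB', h'⟩
      refine ⟨max B B', hB.trans (le_max_left _ _), fun x hx X ↦ ?_⟩
      rcases hx with hx | hx
      · exact (h x hx X).trans (by gcongr; exact le_max_left _ _)
      · exact (h' x hx X).trans (by gcongr; exact le_max_right _ _)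
    · intro x₀ _
      obtain ⟨r, hr, hball⟩ := Metric.nhds_basis_closedBall.mem_iff.1
        ((chartAt (Euc n) x₀).open_target.mem_nhds (mem_chart_target (Euc n) x₀))
      have hK := isCompact_closedBall (chartAt (Euc n) x₀ x₀) r
      obtain ⟨A, hA, -, hA2⟩ := exists_norm_coordVector_le (n := n) x₀ hK hball
      have hsm : ContDiffOn ℝ ∞ (fun z ↦ η ((chartAt (Euc n) x₀).symm z))
          (chartAt (Euc n) x₀).target :=
        (hη.1.comp_contMDiffOn (contMDiffOn_chart_symm (n := ∞))).contDiffOn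
      have hfc : ContinuousOn (fderiv ℝ (fun z ↦ η ((chartAt (Euc n) x₀).symm z)))
          (chartAt (Euc n) x₀).target :=
        hsm.continuousOn_fderiv_of_isOpen (chartAt (Euc n) x₀).open_target (by simp)
      obtain ⟨B, hB⟩ := hK.bddAbove_image (hfc.mono hball).norm
      have hB0 : 0 ≤ B := (norm_nonneg _).trans (hB ⟨_, Metric.mem_closedBall_self hr.le, rfl⟩)
      refine ⟨(chartAt (Euc n) x₀).source ∩ chartAt (Euc n) x₀ ⁻¹'
        Metric.ball (chartAt (Euc n) x₀ x₀) r, mem_nhdsWithin_of_mem_nhds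
        (((chartAt (Euc n) x₀).isOpen_inter_preimage Metric.isOpen_ball).mem_nhds
          ⟨mem_chart_source _ _, Metric.mem_ball_self hr⟩), B * A, by positivity, ?_⟩
      intro x hx X
      obtain ⟨y, hy, rfl⟩ : ∃ y ∈ Metric.ball (chartAt (Euc n) x₀ x₀) r,
          (chartAt (Euc n) x₀).symm y = x := ⟨_, hx.2, (chartAt (Euc n) x₀).left_inv hx.1⟩
      have hyK := Metric.ball_subset_closedBall hy
      have hyt := hball hyK
      rw [← coordVector_coordRepr x₀ hyt X,
        dirDeriv_coordVector x₀ hyt ((hη.1 _).mdifferentiableAt (by simp))]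
      calc _ ≤ ‖fderiv ℝ (fun z ↦ η ((chartAt (Euc n) x₀).symm z)) y‖ * ‖coordRepr x₀ y X‖ :=
            ContinuousLinearMap.le_opNorm _ _
        _ ≤ B * (A * ‖coordVector x₀ y (coordRepr x₀ y X)‖) := by
            gcongr
            · exact hB ⟨y, hyK, rfl⟩
            · exact hA2 y hyK _
        _ = _ := by ring
  obtain ⟨B, hB, h⟩ := hloc
  refine ⟨B, hB, fun x X ↦ ?_⟩
  by_cases hx : x ∈ tsupport η
  · exact h x hx X
  · rw [dirDeriv_eq_zero_of_notMem_tsupport hx, abs_zero]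
    positivity

omit [RiemannianBundle (fun x : M ↦ TangentSpace 𝓘(ℝ, Euc n) x)]
  [IsContinuousRiemannianBundle (Euc n) (fun x : M ↦ TangentSpace 𝓘(ℝ, Euc n) x)] in
/-- Finite smooth partitions of unity near a compact set. -/
lemma exists_finset_partitionOfUnity [T2Space M] [SigmaCompactSpace M] {U : M → Set M}
    (hU : ∀ x, IsOpen (U x)) (hxU : ∀ x, x ∈ U x) {K : Set M} (hK : IsCompact K) :
    ∃ (J : Finset M) (ρ : M → M → ℝ), (∀ i, ContMDiff 𝓘(ℝ, Euc n) 𝓘(ℝ, ℝ) ∞ (ρ i)) ∧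
      (∀ i, tsupport (ρ i) ⊆ U i) ∧ (∀ i x, 0 ≤ ρ i x) ∧ (∀ x, ∑ i ∈ J, ρ i x ≤ 1) ∧
      ∀ᶠ x in 𝓝ˢ K, ∑ i ∈ J, ρ i x = 1 := by
  have : LocallyCompactSpace M := ChartedSpace.locallyCompactSpace (Euc n) M
  obtain ⟨f, hf⟩ := SmoothPartitionOfUnity.exists_isSubordinate 𝓘(ℝ, Euc n) isClosed_univ U hU
    (fun x _ ↦ mem_iUnion.2 ⟨x, hxU x⟩)
  obtain ⟨K', hK', hKK'⟩ := exists_compact_superset hK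
  have hfin := f.locallyFinite.finite_nonempty_inter_compact hK'
  have hfs : ∀ x, (Function.support fun i ↦ f i x).Finite := fun x ↦
    f.locallyFinite.point_finite x
  refine ⟨hfin.toFinset, fun i ↦ f i, fun i ↦ (f i).contMDiff, hf, fun i x ↦ f.nonneg i x,
    fun x ↦ ?_, ?_⟩
  · classical
    refine le_trans ?_ (f.sum_le_one x)
    rw [finsum_eq_sum_of_support_subset (s := hfin.toFinset ∪ (hfs x).toFinset) _
      (fun i hi ↦ by simpa using Or.inr hi)]
    exact Finset.sum_le_sum_of_subset_of_nonneg Finset.subset_union_left fun i _ _ ↦ f.nonneg i x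
  · rw [eventually_nhdsSet_iff_exists]
    refine ⟨interior K', isOpen_interior, hKK', fun x hx ↦ ?_⟩
    rw [← f.sum_eq_one (mem_univ x), finsum_eq_sum_of_support_subset]
    intro i hi
    simp only [Set.Finite.coe_toFinset, mem_ofPred_eq]
    exact ⟨x, hi, interior_subset hx⟩

end DirDeriv

/-! ### Smooth cutoff functions with small gradient. -/

section Cutoff

variable {n : ℕ} {M : Type*} [EMetricSpace M] [ChartedSpace (Euc n) M]
  [IsManifold 𝓘(ℝ, Euc n) ∞ M]
  [RiemannianBundle (fun x : M ↦ TangentSpace 𝓘(ℝ, Euc n) x)]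
  [IsContinuousRiemannianBundle (Euc n) (fun x : M ↦ TangentSpace 𝓘(ℝ, Euc n) x)]
  [IsRiemannianManifold 𝓘(ℝ, Euc n) M]

/-- A Lipschitz function on the manifold can be approximated, in a small coordinate ball, by a
smooth function whose gradient is bounded by twice the Lipschitz constant. -/
lemma exists_contDiff_approx_of_lipschitz (x₀ : M) {r : ℝ} (hr : 0 < r)
    (hrt : Metric.closedBall (chartAt (Euc n) x₀ x₀) r ⊆ (chartAt (Euc n) x₀).target)
    (hr2 : ∀ y ∈ Metric.closedBall (chartAt (Euc n) x₀ x₀) r,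
      ∀ y' ∈ Metric.closedBall (chartAt (Euc n) x₀ x₀) r, ∀ w,
        ‖coordVector x₀ y w‖ ≤ 2 * ‖coordVector x₀ y' w‖)
    {χ : M → ℝ} {L : NNReal} (hχ : LipschitzWith L χ) (hχ01 : ∀ x, 0 ≤ χ x ∧ χ x ≤ 1) {ε : ℝ}
    (hε : 0 < ε) :
    ∃ G : Euc n → ℝ, ContDiff ℝ ∞ G ∧ (∀ y, 0 ≤ G y ∧ G y ≤ 1) ∧
      ∀ y ∈ Metric.ball (chartAt (Euc n) x₀ x₀) (r / 2),
        |G y - χ ((chartAt (Euc n) x₀).symm y)| ≤ ε ∧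
        ∀ w, |fderiv ℝ G y w| ≤ 2 * L * ‖coordVector x₀ y w‖ := by
  set S := Metric.closedBall (chartAt (Euc n) x₀ x₀) r with hS
  have hSc : IsCompact S := isCompact_closedBall _ _
  obtain ⟨A, hA, hA1, -⟩ := exists_norm_coordVector_le (n := n) x₀ hSc hrt
  set g : Euc n → ℝ := S.indicator fun y ↦ χ ((chartAt (Euc n) x₀).symm y) with hg
  have hg01 : ∀ y, 0 ≤ g y ∧ g y ≤ 1 := by
    intro y
    by_cases hy : y ∈ S
    · rw [hg, indicator_of_mem hy]
      exact hχ01 _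
    · rw [hg, indicator_of_notMem hy]
      simp
  have hgS : ∀ y ∈ S, g y = χ ((chartAt (Euc n) x₀).symm y) := fun y hy ↦ indicator_of_mem hy _
  have hgloc : LocallyIntegrable g := by
    refine ((integrable_indicator_iff hSc.measurableSet).2 ?_).locallyIntegrable
    exact (hχ.continuous.comp_continuousOn
      ((chartAt (Euc n) x₀).continuousOn_symm.mono hrt)).integrableOn_compact hSc
  -- The norm may be measured at any `y₁` of the ball, at the cost of the factor two. All translates
  -- occurring in the mollification are thus compared in the norm at one point.
  have hlip : ∀ y ∈ S, ∀ y' ∈ S, ∀ y₁ ∈ S, |g y - g y'| ≤ 2 * L * ‖coordVector x₀ y₁ (y' - y)‖ := by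
    intro y hy y' hy' y₁ hy₁
    rw [hgS y hy, hgS y' hy', ← Real.dist_eq]
    have h1 := (hχ ((chartAt (Euc n) x₀).symm y) ((chartAt (Euc n) x₀).symm y')).trans
      (mul_le_mul_right (edist_chart_symm_le x₀ (convex_closedBall _ r) hrt hy hy'
        fun z hz ↦ hr2 z hz y₁ hy₁ _) _)
    rw [edist_dist, ← ENNReal.ofReal_coe_nnreal, ← ENNReal.ofReal_mul (NNReal.coe_nonneg L),
      ENNReal.ofReal_le_ofReal_iff (by positivity)] at h1
    linarith
  -- The first condition keeps the averaging balls inside `S`, the second makes the uniform error at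
  -- most `ε`.
  obtain ⟨k, hk1, hk2⟩ : ∃ k : ℕ, (1 : ℝ) / (k + 1) < r / 2 ∧ 2 * L * A * (1 / (k + 1)) < ε := by
    have h1 := (tendsto_one_div_add_atTop_nhds_zero_nat (𝕜 := ℝ)).eventually_lt_const (half_pos hr)
    have h2 := ((tendsto_one_div_add_atTop_nhds_zero_nat (𝕜 := ℝ)).const_mul
      (2 * L * A)).eventually_lt_const (by simpa using hε)
    exact (h1.and h2).exists
  set b := (mollBump n k).normed (volume : Measure (Euc n)) with hb
  have hb0 : ∀ t, 0 ≤ b t := (mollBump n k).nonneg_normed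
  have hbint : Integrable b := (mollBump n k).continuous_normed.integrable_of_hasCompactSupport
    (mollBump n k).hasCompactSupport_normed
  have hb1 : ∫ t, b t = 1 := (mollBump n k).integral_normed
  have hbs : ∀ t, b t ≠ 0 → ‖t‖ < 1 / (k + 1) := fun t ht ↦ by
    have : t ∈ Function.support b := ht
    rw [hb, (mollBump n k).support_normed_eq, mem_ball_zero_iff] at this
    exact this
  have hmem : ∀ y ∈ Metric.ball (chartAt (Euc n) x₀ x₀) (r / 2), ∀ t, b t ≠ 0 → y - t ∈ S := by
    intro y hy t ht
    rw [hS, Metric.mem_closedBall, dist_eq_norm]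
    rw [Metric.mem_ball, dist_eq_norm] at hy
    have := norm_sub_le (y - chartAt (Euc n) x₀ x₀) t
    have h3 := hbs t ht
    rw [sub_right_comm]
    linarith
  have hballS : Metric.ball (chartAt (Euc n) x₀ x₀) (r / 2) ⊆ S :=
    Metric.ball_subset_closedBall.trans (Metric.closedBall_subset_closedBall (by linarith))
  have hint := integrable_mollify_integrand k hgloc
  have hdiff : ∀ y ∈ Metric.ball (chartAt (Euc n) x₀ x₀) (r / 2),
      ∀ y' ∈ Metric.ball (chartAt (Euc n) x₀ x₀) (r / 2),
      |mollify k g y' - mollify k g y| ≤ 2 * L * ‖coordVector x₀ y (y' - y)‖ := by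
    intro y hy y' hy'
    rw [mollify_apply, mollify_apply, ← integral_sub (hint y') (hint y), ← Real.norm_eq_abs]
    refine (norm_integral_le_of_norm_le
      (hbint.mul_const (2 * L * ‖coordVector x₀ y (y' - y)‖)) (ae_of_all _ fun t ↦ ?_)).trans_eq ?_
    · rw [← mul_sub, norm_mul, Real.norm_of_nonneg (hb0 t), Real.norm_eq_abs]
      by_cases ht : b t = 0
      · simp [ht]
      · refine mul_le_mul_of_nonneg_left ?_ (hb0 t)
        rw [abs_sub_comm]
        have := hlip _ (hmem y hy t ht) _ (hmem y' hy' t ht) y (hballS hy)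
        rwa [sub_sub_sub_cancel_right] at this
    · rw [integral_mul_const, hb1, one_mul]
  refine ⟨mollify k g, contDiff_mollify k hgloc, fun y ↦ ⟨?_, ?_⟩, fun y hy ↦ ⟨?_, fun w ↦ ?_⟩⟩
  · rw [mollify_apply]
    exact integral_nonneg fun t ↦ mul_nonneg (hb0 t) (hg01 _).1
  · rw [mollify_apply, ← hb1]
    exact integral_mono (hint y) hbint fun t ↦ mul_le_of_le_one_right (hb0 t) (hg01 _).2
  · rw [← hgS y (hballS hy)]
    have e1 : g y = ∫ t, b t * g y := by rw [integral_mul_const, hb1, one_mul]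
    rw [e1, mollify_apply, ← integral_sub (hint y) (hbint.mul_const _), ← Real.norm_eq_abs]
    refine (norm_integral_le_of_norm_le
      (hbint.mul_const (2 * L * A * (1 / (k + 1)))) (ae_of_all _ fun t ↦ ?_)).trans ?_
    · rw [← mul_sub, norm_mul, Real.norm_of_nonneg (hb0 t), Real.norm_eq_abs]
      by_cases ht : b t = 0
      · simp [ht]
      · refine mul_le_mul_of_nonneg_left ?_ (hb0 t)
        have h1 := hlip _ (hmem y hy t ht) _ (hballS hy) y (hballS hy)
        rw [sub_sub_cancel] at h1
        refine h1.trans ?_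
        rw [mul_assoc (2 * (L : ℝ))]
        refine mul_le_mul_of_nonneg_left ((hA1 y (hballS hy) t).trans ?_) (by positivity)
        exact mul_le_mul_of_nonneg_left (hbs t ht).le hA.le
    · rw [integral_mul_const, hb1, one_mul]
      exact hk2.le
  · have hd : HasFDerivAt (mollify k g) (fderiv ℝ (mollify k g) y) y :=
      ((contDiff_mollify k hgloc).differentiable (by simp) y).hasFDerivAt
    have hline : HasDerivAt (fun s : ℝ ↦ y + s • w) w 0 := by
      simpa using ((hasDerivAt_id (0 : ℝ)).smul_const w).const_add y
    have hd' : HasDerivAt (fun s : ℝ ↦ mollify k g (y + s • w)) (fderiv ℝ (mollify k g) y w) 0 :=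
      HasFDerivAt.comp_hasDerivAt_of_eq 0 hd hline (by simp)
    rw [← Real.norm_eq_abs]
    refine hd'.le_of_lip' (by positivity) ?_
    have hev : ∀ᶠ s : ℝ in 𝓝 0, y + s • w ∈ Metric.ball (chartAt (Euc n) x₀ x₀) (r / 2) := by
      apply hline.continuousAt.eventually_mem
      simpa using Metric.isOpen_ball.mem_nhds hy
    filter_upwards [hev] with s hs
    have h1 := hdiff y hy _ hs
    have h2 : ‖coordVector x₀ y (y + s • w - y)‖ = |s| * ‖coordVector x₀ y w‖ := by
      rw [add_sub_cancel_left]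
      have : coordVector x₀ y (s • w) = s • coordVector x₀ y w := map_smul _ _ _
      rw [this, norm_smul, Real.norm_eq_abs]
    rw [h2] at h1
    simp only [zero_smul, add_zero, sub_zero, Real.norm_eq_abs]
    linarith

omit [IsManifold 𝓘(ℝ, Euc n) ∞ M]
  [RiemannianBundle (fun x : M ↦ TangentSpace 𝓘(ℝ, Euc n) x)]
  [IsContinuousRiemannianBundle (Euc n) (fun x : M ↦ TangentSpace 𝓘(ℝ, Euc n) x)]
  [IsRiemannianManifold 𝓘(ℝ, Euc n) M] in
lemma IsTestFunction.sum {ι : Type*} {s : Finset ι} {f : ι → M → ℝ}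
    (hf : ∀ i ∈ s, IsTestFunction n (f i)) : IsTestFunction n fun x ↦ ∑ i ∈ s, f i x := by
  refine ⟨contMDiff_finsetSum fun i hi ↦ (hf i hi).1, ?_⟩
  have hc : IsCompact (⋃ i ∈ s, tsupport (f i)) := s.isCompact_biUnion fun i hi ↦ (hf i hi).2
  refine HasCompactSupport.intro hc fun x hx ↦ Finset.sum_eq_zero fun i hi ↦ ?_
  exact image_eq_zero_of_notMem_tsupport fun h ↦ hx (mem_iUnion₂.2 ⟨i, hi, h⟩)

/-- Local approximations `G i` are glued by a partition of unity `P i`. The gradient of the sum is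
`∑ (G i - χ) dP i + ∑ P i dG i`, since the `dP i` add up to zero near the support of `χ`: the first
sum is small, the second at most `2 L`. -/
lemma exists_testFunction_approx_of_lipschitz [SigmaCompactSpace M]
    {χ : M → ℝ} {L : NNReal} (hχ : LipschitzWith L χ) (hχ01 : ∀ x, 0 ≤ χ x ∧ χ x ≤ 1)
    (hχc : HasCompactSupport χ) {ε : ℝ} (hε : 0 < ε) :
    ∃ ρ : M → ℝ, IsTestFunction n ρ ∧ (∀ x, 0 ≤ ρ x ∧ ρ x ≤ 1) ∧ (∀ x, |ρ x - χ x| ≤ ε) ∧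
      ∀ x, ∀ X : TangentSpace 𝓘(ℝ, Euc n) x, |dirDeriv ρ x X| ≤ (2 * L + ε) * ‖X‖ := by
  choose r hr hrt hr2 using fun x₀ : M ↦ exists_ball_norm_coordVector_le_two_mul (n := n) x₀
  set U : M → Set M := fun x₀ ↦ (chartAt (Euc n) x₀).source ∩
    chartAt (Euc n) x₀ ⁻¹' Metric.ball (chartAt (Euc n) x₀ x₀) (r x₀ / 2) with hU
  obtain ⟨J, P, hPs, hPU, hP0, hP1, hPK⟩ := exists_finset_partitionOfUnity (n := n) (U := U)
    (fun x ↦ (chartAt (Euc n) x).isOpen_inter_preimage Metric.isOpen_ball)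
    (fun x ↦ ⟨mem_chart_source _ _, Metric.mem_ball_self (half_pos (hr x))⟩) hχc
  have hPt : ∀ i, IsTestFunction n (P i) := by
    refine fun i ↦ ⟨hPs i, ?_⟩
    have hsub : Metric.closedBall (chartAt (Euc n) i i) (r i / 2) ⊆ (chartAt (Euc n) i).target :=
      (Metric.closedBall_subset_closedBall (by linarith [hr i])).trans (hrt i)
    have hc : IsCompact ((chartAt (Euc n) i).symm ''
        Metric.closedBall (chartAt (Euc n) i i) (r i / 2)) :=
      (isCompact_closedBall _ _).image_of_continuousOn
        ((chartAt (Euc n) i).continuousOn_symm.mono hsub)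
    refine hc.of_isClosed_subset (isClosed_tsupport _) fun x hx ↦ ?_
    have hxU := hPU i hx
    exact ⟨_, Metric.ball_subset_closedBall hxU.2, (chartAt (Euc n) i).left_inv hxU.1⟩
  choose B hB0 hB using fun i ↦ (hPt i).exists_abs_dirDeriv_le
  set Bs := ∑ i ∈ J, B i with hBs
  have hBs0 : 0 ≤ Bs := Finset.sum_nonneg fun i _ ↦ hB0 i
  -- The local accuracy is fixed after the gradient bounds `B i` of the partition, which do not
  -- depend on it.
  set ε' := ε / (Bs + 1) with hε'
  have hε'0 : 0 < ε' := by positivity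
  have hε'ε : ε' ≤ ε := div_le_self hε.le (by linarith)
  have hε'B : ε' * Bs ≤ ε := by
    rw [hε', div_mul_eq_mul_div, div_le_iff₀ (by positivity)]
    nlinarith
  choose G hGs hG01 hG using fun x₀ : M ↦ exists_contDiff_approx_of_lipschitz (n := n) x₀ (hr x₀)
    (hrt x₀) (hr2 x₀) hχ hχ01 hε'0
  have hGat : ∀ i, ∀ x ∈ tsupport (P i),
      ContMDiffAt 𝓘(ℝ, Euc n) 𝓘(ℝ, ℝ) ∞ (fun x ↦ G i (chartAt (Euc n) i x)) x :=
    fun i x hx ↦ contMDiffAt_comp_chart i (hPU i hx).1 (hGs i)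
  have ht : ∀ i, IsTestFunction n fun x ↦ P i x * G i (chartAt (Euc n) i x) :=
    fun i ↦ (hPt i).mul (hGat i)
  have hclose : ∀ i, ∀ x ∈ tsupport (P i), |G i (chartAt (Euc n) i x) - χ x| ≤ ε' := by
    intro i x hx
    have := (hG i _ (hPU i hx).2).1
    rwa [(chartAt (Euc n) i).left_inv (hPU i hx).1] at this
  have hgrad : ∀ i, ∀ x ∈ tsupport (P i), ∀ X : TangentSpace 𝓘(ℝ, Euc n) x,
      |dirDeriv (fun x ↦ G i (chartAt (Euc n) i x)) x X| ≤ 2 * L * ‖X‖ := by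
    intro i x hx X
    obtain ⟨y, hy, rfl⟩ : ∃ y ∈ Metric.ball (chartAt (Euc n) i i) (r i / 2),
      (chartAt (Euc n) i).symm y = x := ⟨_, (hPU i hx).2, (chartAt (Euc n) i).left_inv (hPU i hx).1⟩
    have hyt : y ∈ (chartAt (Euc n) i).target :=
      hrt i (Metric.closedBall_subset_closedBall (by linarith [hr i])
        (Metric.ball_subset_closedBall hy))
    rw [dirDeriv_comp_chart i hyt ((hGs i).differentiable (by simp) y)]
    have := (hG i y hy).2 (coordRepr i y X)
    rwa [coordVector_coordRepr i hyt] at this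
  have hsumχ : ∀ x, χ x * ∑ i ∈ J, P i x = χ x := by
    intro x
    by_cases hx : x ∈ tsupport χ
    · rw [hPK.self_of_nhdsSet x hx, mul_one]
    · rw [image_eq_zero_of_notMem_tsupport hx, zero_mul]
  -- Only near the support of `χ` do the `P i` sum to one; the factor `χ` covers the remaining
  -- points.
  have hdsum : ∀ x, ∀ X : TangentSpace 𝓘(ℝ, Euc n) x, χ x * ∑ i ∈ J, dirDeriv (P i) x X = 0 := by
    intro x X
    by_cases hx : x ∈ tsupport χ
    · rw [← dirDeriv_sum J fun i _ ↦ (hPs i x).mdifferentiableAt (by simp)]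
      have h1 : (fun x ↦ ∑ i ∈ J, P i x) =ᶠ[𝓝 x] fun _ ↦ (1 : ℝ) :=
        hPK.filter_mono (nhds_le_nhdsSet hx)
      have h3 := congrArg (fun L : Euc n →L[ℝ] ℝ ↦ L X)
        ((h1.mfderiv_eq (I := 𝓘(ℝ, Euc n)) (I' := 𝓘(ℝ, ℝ))).trans mfderiv_const)
      have h4 : dirDeriv (fun x ↦ ∑ i ∈ J, P i x) x X = 0 := h3
      rw [h4, mul_zero]
    · rw [image_eq_zero_of_notMem_tsupport hx, zero_mul]
  refine ⟨fun x ↦ ∑ i ∈ J, P i x * G i (chartAt (Euc n) i x), IsTestFunction.sum fun i _ ↦ ht i,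
    fun x ↦ ⟨?_, ?_⟩, fun x ↦ ?_, fun x X ↦ ?_⟩
  · exact Finset.sum_nonneg fun i _ ↦ mul_nonneg (hP0 i x) (hG01 i _).1
  · exact (Finset.sum_le_sum fun i _ ↦ mul_le_of_le_one_right (hP0 i x) (hG01 i _).2).trans (hP1 x)
  · have e1 : ∑ i ∈ J, P i x * G i (chartAt (Euc n) i x) - χ x =
        ∑ i ∈ J, P i x * (G i (chartAt (Euc n) i x) - χ x) := by
      conv_lhs => rw [← hsumχ x]
      simp_rw [mul_sub, Finset.sum_sub_distrib, ← Finset.sum_mul]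
      ring
    rw [e1]
    calc _ ≤ ∑ i ∈ J, |P i x * (G i (chartAt (Euc n) i x) - χ x)| := Finset.abs_sum_le_sum_abs _ _
      _ ≤ ∑ i ∈ J, P i x * ε' := by
        refine Finset.sum_le_sum fun i _ ↦ ?_
        rw [abs_mul, abs_of_nonneg (hP0 i x)]
        by_cases hx : x ∈ tsupport (P i)
        · exact mul_le_mul_of_nonneg_left (hclose i x hx) (hP0 i x)
        · rw [image_eq_zero_of_notMem_tsupport hx]
          simp
      _ ≤ ε := by
        rw [← Finset.sum_mul]
        nlinarith [hP1 x]
  · rw [dirDeriv_sum J fun i _ ↦ ((ht i).1 x).mdifferentiableAt (by simp)]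
    have e1 : ∑ i ∈ J, dirDeriv (fun x ↦ P i x * G i (chartAt (Euc n) i x)) x X =
        ∑ i ∈ J, (G i (chartAt (Euc n) i x) - χ x) * dirDeriv (P i) x X +
        ∑ i ∈ J, P i x * dirDeriv (fun x ↦ G i (chartAt (Euc n) i x)) x X := by
      rw [← add_zero (∑ i ∈ J, (G i (chartAt (Euc n) i x) - χ x) * dirDeriv (P i) x X),
        ← hdsum x X, Finset.mul_sum, ← Finset.sum_add_distrib, ← Finset.sum_add_distrib]
      refine Finset.sum_congr rfl fun i _ ↦ ?_
      rw [dirDeriv_mul_of_tsupport (hPs i) (hGat i)]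
      ring
    rw [e1]
    refine (abs_add_le _ _).trans ?_
    have b1 : |∑ i ∈ J, (G i (chartAt (Euc n) i x) - χ x) * dirDeriv (P i) x X| ≤ ε * ‖X‖ := by
      calc _ ≤ ∑ i ∈ J, |(G i (chartAt (Euc n) i x) - χ x) * dirDeriv (P i) x X| :=
            Finset.abs_sum_le_sum_abs _ _
        _ ≤ ∑ i ∈ J, ε' * (B i * ‖X‖) := by
          refine Finset.sum_le_sum fun i _ ↦ ?_
          rw [abs_mul]
          by_cases hx : x ∈ tsupport (P i)
          · exact mul_le_mul (hclose i x hx) (hB i x X) (abs_nonneg _) hε'0.le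
          · rw [dirDeriv_eq_zero_of_notMem_tsupport hx, abs_zero, mul_zero]
            have := hB0 i
            positivity
        _ = ε' * Bs * ‖X‖ := by
          rw [← Finset.mul_sum, ← Finset.sum_mul, mul_assoc]
        _ ≤ _ := by gcongr
    have b2 : |∑ i ∈ J, P i x * dirDeriv (fun x ↦ G i (chartAt (Euc n) i x)) x X| ≤
        2 * L * ‖X‖ := by
      calc _ ≤ ∑ i ∈ J, |P i x * dirDeriv (fun x ↦ G i (chartAt (Euc n) i x)) x X| :=
            Finset.abs_sum_le_sum_abs _ _
        _ ≤ ∑ i ∈ J, P i x * (2 * L * ‖X‖) := by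
          refine Finset.sum_le_sum fun i _ ↦ ?_
          rw [abs_mul, abs_of_nonneg (hP0 i x)]
          by_cases hx : x ∈ tsupport (P i)
          · exact mul_le_mul_of_nonneg_left (hgrad i x hx X) (hP0 i x)
          · rw [image_eq_zero_of_notMem_tsupport hx]
            simp
        _ ≤ 1 * (2 * L * ‖X‖) := by
          rw [← Finset.sum_mul]
          exact mul_le_mul_of_nonneg_right (hP1 x) (by positivity)
        _ = _ := one_mul _
    linarith

/-- On a complete Riemannian manifold there are smooth compactly supported cutoff functions which
exhaust the manifold and whose gradients tend to zero uniformly. -/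
lemma exists_cutoff (n : ℕ) {M : Type*} [EMetricSpace M] [ChartedSpace (Euc n) M]
    [IsManifold 𝓘(ℝ, Euc n) ∞ M]
    [RiemannianBundle (fun x : M ↦ TangentSpace 𝓘(ℝ, Euc n) x)]
    [IsContinuousRiemannianBundle (Euc n) (fun x : M ↦ TangentSpace 𝓘(ℝ, Euc n) x)]
    [IsRiemannianManifold 𝓘(ℝ, Euc n) M] [CompleteSpace M] [SecondCountableTopology M] :
    ∃ ρ : ℕ → M → ℝ, (∀ k, IsTestFunction n (ρ k)) ∧ (∀ k x, 0 ≤ ρ k x ∧ ρ k x ≤ 1) ∧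
      (∀ x, Tendsto (fun k ↦ ρ k x) atTop (𝓝 1)) ∧
      ∀ k : ℕ, ∀ x, ∀ X : TangentSpace 𝓘(ℝ, Euc n) x,
        |dirDeriv (ρ k) x X| ≤ 3 * (1 / (k + 1)) * ‖X‖ := by
  have : LocallyCompactSpace M := ChartedSpace.locallyCompactSpace (Euc n) M
  obtain ⟨χ, hχ01, hχc, hχL, hχ1⟩ := exists_lipschitz_cutoff (X := M)
    (isCompact_closedEBall_of_length (exists_edist_le_edist_lt n))
  -- The accuracy equals the Lipschitz constant `1/(k+1)`, whence the factor `3 = 2 + 1` in the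
  -- gradient bound.
  choose ρ hρt hρ01 hρχ hρd using fun k : ℕ ↦ exists_testFunction_approx_of_lipschitz (n := n)
    (hχL k) (hχ01 k) (hχc k) (ε := 1 / ((k : ℝ) + 1)) (by positivity)
  refine ⟨ρ, hρt, hρ01, fun x ↦ ?_, fun k x X ↦ (hρd k x X).trans (le_of_eq ?_)⟩
  · have h0 : Tendsto (fun k ↦ ρ k x - χ k x) atTop (𝓝 0) :=
      squeeze_zero_norm (fun k ↦ hρχ k x) tendsto_one_div_add_atTop_nhds_zero_nat
    simpa using h0.add (hχ1 x)
  · push_cast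
    ring

end Cutoff

/-! ### Passing to the limit in triple products. -/

section Limit

lemma integrable_mul_mul {α : Type*} [MeasurableSpace α] {ν : Measure α} {p p' : ℝ≥0∞}
    [ENNReal.HolderConjugate p p'] {F m s : α → ℝ} (hF : MemLp F p' ν) (hm : MemLp m p ν)
    (hs : AEStronglyMeasurable s ν) {c : ℝ} (hc : ∀ᵐ x ∂ν, |s x| ≤ c) :
    Integrable (fun x ↦ F x * (s x * m x)) ν := by
  have hFm : Integrable (fun x ↦ m x * F x) ν := hm.integrable_mul hF
  refine (hFm.abs.const_mul c).mono' (hF.1.mul (hs.mul hm.1)) ?_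
  filter_upwards [hc] with x hx
  rw [Real.norm_eq_abs, show F x * (s x * m x) = s x * (m x * F x) by ring, abs_mul]
  exact mul_le_mul_of_nonneg_right hx (abs_nonneg _)

/-- Products of a fixed function of `L^{p'}`, a boundedly convergent sequence and a sequence which
converges in `L^p` may be integrated in the limit. -/
lemma tendsto_integral_mul_mul {α : Type*} [MeasurableSpace α] {ν : Measure α} {p p' : ℝ≥0∞}
    [ENNReal.HolderConjugate p p'] {F m s : α → ℝ} {mk sk : ℕ → α → ℝ}
    (hF : MemLp F p' ν) (hm : MemLp m p ν) (hmk : ∀ k, MemLp (mk k) p ν)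
    (hmm : Tendsto (fun k ↦ eLpNorm (fun x ↦ mk k x - m x) p ν) atTop (𝓝 0))
    (hsk : ∀ k, AEStronglyMeasurable (sk k) ν) {c : ℝ} (hc : ∀ k, ∀ᵐ x ∂ν, |sk k x| ≤ c)
    (hss : ∀ᵐ x ∂ν, Tendsto (fun k ↦ sk k x) atTop (𝓝 (s x))) :
    Tendsto (fun k ↦ ∫ x, F x * (sk k x * mk k x) ∂ν) atTop (𝓝 (∫ x, F x * (s x * m x) ∂ν)) := by
  have hFm : Integrable (fun x ↦ m x * F x) ν := hm.integrable_mul hF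
  have hd : ∀ k, AEStronglyMeasurable (fun x ↦ mk k x - m x) ν := fun k ↦ (hmk k).1.sub hm.1
  have t1 : Tendsto (fun k ↦ ∫ x, F x * (sk k x * m x) ∂ν) atTop
      (𝓝 (∫ x, F x * (s x * m x) ∂ν)) := by
    refine tendsto_integral_of_dominated_convergence (fun x ↦ c * |m x * F x|)
      (fun k ↦ hF.1.mul ((hsk k).mul hm.1)) (hFm.abs.const_mul c) (fun k ↦ ?_) ?_
    · filter_upwards [hc k] with x hx
      rw [Real.norm_eq_abs, show F x * (sk k x * m x) = sk k x * (m x * F x) by ring, abs_mul]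
      exact mul_le_mul_of_nonneg_right hx (abs_nonneg _)
    · filter_upwards [hss] with x hx
      exact (hx.mul_const _).const_mul _
  -- Writing `mk = m + (mk - m)`, dominated convergence handles the first term and Hölder's
  -- inequality the second.
  have hbound : ∀ k, eLpNorm (fun x ↦ F x * (sk k x * (mk k x - m x))) 1 ν ≤
      ENNReal.ofReal c * eLpNorm (fun x ↦ mk k x - m x) p ν * eLpNorm F p' ν := by
    intro k
    have h1 : eLpNorm (fun x ↦ F x * (sk k x * (mk k x - m x))) 1 ν ≤
        ENNReal.ofReal c * eLpNorm (fun x ↦ (mk k x - m x) * F x) 1 ν := by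
      refine eLpNorm_le_mul_eLpNorm_of_ae_le_mul ?_ 1
      filter_upwards [hc k] with x hx
      rw [Real.norm_eq_abs, Real.norm_eq_abs,
        show F x * (sk k x * (mk k x - m x)) = sk k x * ((mk k x - m x) * F x) by ring, abs_mul]
      exact mul_le_mul_of_nonneg_right hx (abs_nonneg _)
    refine h1.trans ?_
    rw [mul_assoc]
    gcongr
    have h2 := eLpNorm_smul_le_mul_eLpNorm (p := p) (q := p') (r := 1) (f := F)
      (φ := fun x ↦ mk k x - m x) hF.1 (hd k)
    exact h2
  have t0 : Tendsto (fun k ↦ ENNReal.ofReal c * eLpNorm (fun x ↦ mk k x - m x) p ν * eLpNorm F p' ν)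
      atTop (𝓝 0) := by
    have := ENNReal.Tendsto.mul_const (ENNReal.Tendsto.const_mul (a := ENNReal.ofReal c) hmm
      (Or.inr ENNReal.ofReal_ne_top)) (b := eLpNorm F p' ν) (Or.inr hF.2.ne)
    simpa using this
  have t2' := tendsto_of_tendsto_of_tendsto_of_le_of_le tendsto_const_nhds t0
    (fun _ ↦ zero_le) hbound
  have hi : ∀ k, Integrable (fun x ↦ F x * (sk k x * (mk k x - m x))) ν := fun k ↦
    memLp_one_iff_integrable.1 ⟨hF.1.mul ((hsk k).mul (hd k)), (hbound k).trans_lt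
      (ENNReal.mul_lt_top (ENNReal.mul_lt_top ENNReal.ofReal_lt_top ((hmk k).sub hm).2) hF.2)⟩
  have t2 : Tendsto (fun k ↦ ∫ x, F x * (sk k x * (mk k x - m x)) ∂ν) atTop (𝓝 0) := by
    have h0 := tendsto_integral_of_L1' (fun _ ↦ (0 : ℝ)) aestronglyMeasurable_const
      (Eventually.of_forall hi) (l := atTop) ?_
    · simpa using h0
    · refine t2'.congr fun k ↦ ?_
      congr 1
      ext x
      simp
  have hi' : ∀ k, Integrable (fun x ↦ F x * (sk k x * m x)) ν := fun k ↦
    integrable_mul_mul hF hm (hsk k) (hc k)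
  have t3 := t2.add t1
  rw [zero_add] at t3
  refine t3.congr fun k ↦ ?_
  rw [← integral_add (hi k) (hi' k)]
  refine integral_congr_ae (ae_of_all _ fun x ↦ ?_)
  simp only
  ring

end Limit

/-! ### Integrals and Lebesgue spaces in a chart. -/

section Coord

variable {n : ℕ} {M : Type*} [TopologicalSpace M] [ChartedSpace (Euc n) M]
  [IsManifold 𝓘(ℝ, Euc n) ∞ M]
  [RiemannianBundle (fun x : M ↦ TangentSpace 𝓘(ℝ, Euc n) x)]
  [IsContinuousRiemannianBundle (Euc n) (fun x : M ↦ TangentSpace 𝓘(ℝ, Euc n) x)]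
  [MeasurableSpace M] [BorelSpace M]

omit [IsManifold 𝓘(ℝ, Euc n) ∞ M]
  [RiemannianBundle (fun x : M ↦ TangentSpace 𝓘(ℝ, Euc n) x)]
  [IsContinuousRiemannianBundle (Euc n) (fun x : M ↦ TangentSpace 𝓘(ℝ, Euc n) x)]
  [MeasurableSpace M] [BorelSpace M] in
lemma isCompact_chart_image (x₀ : M) {s : Set M} (hs : IsCompact s)
    (hsub : s ⊆ (chartAt (Euc n) x₀).source) : IsCompact (chartAt (Euc n) x₀ '' s) :=
  hs.image_of_continuousOn ((chartAt (Euc n) x₀).continuousOn.mono hsub)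

omit [IsManifold 𝓘(ℝ, Euc n) ∞ M]
  [RiemannianBundle (fun x : M ↦ TangentSpace 𝓘(ℝ, Euc n) x)]
  [IsContinuousRiemannianBundle (Euc n) (fun x : M ↦ TangentSpace 𝓘(ℝ, Euc n) x)]
  [MeasurableSpace M] [BorelSpace M] in
lemma chart_image_subset_target (x₀ : M) {s : Set M} (hsub : s ⊆ (chartAt (Euc n) x₀).source) :
    chartAt (Euc n) x₀ '' s ⊆ (chartAt (Euc n) x₀).target := by
  rintro _ ⟨x, hx, rfl⟩
  exact (chartAt (Euc n) x₀).map_source (hsub hx)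

lemma integral_eq_integral_coord {φ : M → ℝ} (hφ : Continuous φ) (x₀ : M) {s : Set M}
    (hs : IsCompact s) (hsub : s ⊆ (chartAt (Euc n) x₀).source) {F : M → ℝ}
    (hF0 : ∀ x ∉ s, F x = 0)
    (hFm : AEStronglyMeasurable (fun y ↦ F ((chartAt (Euc n) x₀).symm y))
      ((coordMeasure (n := n) φ x₀).restrict (chartAt (Euc n) x₀ '' s))) :
    ∫ x, F x ∂(weightedVolume n φ) = ∫ y in chartAt (Euc n) x₀ '' s,
      F ((chartAt (Euc n) x₀).symm y) ∂(coordMeasure (n := n) φ x₀) := by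
  have hK := (isCompact_chart_image (n := n) x₀ hs hsub).measurableSet
  have hae : (fun y ↦ F ((chartAt (Euc n) x₀).symm y)) =ᵐ[coordMeasure (n := n) φ x₀]
      (chartAt (Euc n) x₀ '' s).indicator fun y ↦ F ((chartAt (Euc n) x₀).symm y) := by
    filter_upwards [ae_mem_target_coordMeasure φ x₀] with y hy
    by_cases hyK : y ∈ chartAt (Euc n) x₀ '' s
    · rw [indicator_of_mem hyK]
    · rw [indicator_of_notMem hyK]
      apply hF0
      exact fun h ↦ hyK ⟨_, h, (chartAt (Euc n) x₀).right_inv hy⟩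
  have hm : AEStronglyMeasurable (fun y ↦ F ((chartAt (Euc n) x₀).symm y))
      (coordMeasure (n := n) φ x₀) :=
    ((aestronglyMeasurable_indicator_iff hK).2 hFm).congr hae.symm
  have hm2 : AEStronglyMeasurable F ((weightedVolume n φ).restrict (chartAt (Euc n) x₀).source) :=
    (aestronglyMeasurable_restrict_source_iff hφ x₀).2
      (hm.mono_ac (volume_restrict_absolutelyContinuous_coordMeasure hφ x₀))
  rw [← setIntegral_eq_integral_of_forall_compl_eq_zero (s := (chartAt (Euc n) x₀).source)
    (fun x hx ↦ hF0 x fun h ↦ hx (hsub h)), setIntegral_source hφ x₀ hm2, integral_congr_ae hae,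
    integral_indicator hK]

lemma memLp_comp_chart_symm {φ : M → ℝ} (hφ : Continuous φ) (x₀ : M) {F : M → ℝ} {p : ℝ≥0∞}
    (hF : MemLp F p (weightedVolume n φ)) :
    MemLp (fun y ↦ F ((chartAt (Euc n) x₀).symm y)) p (coordMeasure (n := n) φ x₀) := by
  have h := hF.restrict (chartAt (Euc n) x₀).source
  rw [weightedVolume_restrict_source hφ] at h
  exact h.comp_of_map (aemeasurable_chart_symm_coordMeasure φ x₀)

lemma integrableOn_comp_chart_symm {φ : M → ℝ} (hφ : Continuous φ) (x₀ : M) {s : Set M}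
    (hs : IsCompact s) (hsm : MeasurableSet s) (hsub : s ⊆ (chartAt (Euc n) x₀).source) {F : M → ℝ}
    (hF : IntegrableOn F s (weightedVolume n φ)) :
    IntegrableOn (fun y ↦ F ((chartAt (Euc n) x₀).symm y)) (chartAt (Euc n) x₀ '' s)
      (coordMeasure (n := n) φ x₀) := by
  have h1 : MemLp (s.indicator F) 1 (weightedVolume n φ) :=
    memLp_one_iff_integrable.2 ((integrable_indicator_iff hsm).2 hF)
  have h2 := (memLp_one_iff_integrable.1 (memLp_comp_chart_symm hφ x₀ h1)).integrableOn
    (s := chartAt (Euc n) x₀ '' s)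
  refine h2.congr_fun ?_ (isCompact_chart_image (n := n) x₀ hs hsub).measurableSet
  rintro _ ⟨x, hx, rfl⟩
  simp only [(chartAt (Euc n) x₀).left_inv (hsub hx), indicator_of_mem hx]

/-- The components of a weak gradient of class `L^p`, cut off outside a compact set of
coordinates, belong to `L^p`. -/
lemma IsWeakGradient.memLp_indicator_inner_coordVector {φ : M → ℝ} (hφ : Continuous φ) {p : ℝ≥0∞}
    {v : M → ℝ} {V : ∀ x : M, TangentSpace 𝓘(ℝ, Euc n) x} (hV : IsWeakGradient v V)
    (hVp : MemLp (fun x ↦ ‖V x‖) p (weightedVolume n φ)) (x₀ : M) {K : Set (Euc n)}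
    (hK : IsCompact K) (hKt : K ⊆ (chartAt (Euc n) x₀).target) (w : Euc n) :
    MemLp (K.indicator fun y ↦ inner ℝ (V ((chartAt (Euc n) x₀).symm y)) (coordVector x₀ y w))
      p volume := by
  obtain ⟨B, hB, hle, -⟩ := exists_coordMeasure_le (n := n) hφ x₀ hK hKt
  obtain ⟨A, hA, hA1, -⟩ := exists_norm_coordVector_le (n := n) x₀ hK hKt
  rw [memLp_indicator_iff_restrict hK.measurableSet]
  have h1 : MemLp (fun y ↦ ‖V ((chartAt (Euc n) x₀).symm y)‖) p (volume.restrict K) :=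
    ((memLp_comp_chart_symm hφ x₀ hVp).smul_measure hB).mono_measure hle
  refine h1.of_le_mul (c := A * ‖w‖) ?_ ?_
  · exact ((hV x₀).2 w).1.aestronglyMeasurable.mono_measure (Measure.restrict_mono_set _ hKt)
  · filter_upwards [ae_restrict_mem hK.measurableSet] with y hy
    rw [norm_norm]
    refine (norm_inner_le_norm _ _).trans ?_
    rw [mul_comm]
    exact mul_le_mul_of_nonneg_right (hA1 y hy w) (norm_nonneg _)

end Coord

/-! ### Integration by parts within one chart. -/

section LocalIntegrationByParts

lemma clm_apply_eq_sum {n : ℕ} (L : Euc n →L[ℝ] ℝ) (w : Euc n) :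
    L w = ∑ i, w i * L (EuclideanSpace.single i 1) := by
  have h : w = ∑ i, w i • EuclideanSpace.single i (1 : ℝ) := by
    ext j
    simp [Finset.sum_apply, Pi.single_apply]
  conv_lhs => rw [h, map_sum]
  simp

variable {n : ℕ} {M : Type*} [TopologicalSpace M] [ChartedSpace (Euc n) M]
  [IsManifold 𝓘(ℝ, Euc n) ∞ M]
  [RiemannianBundle (fun x : M ↦ TangentSpace 𝓘(ℝ, Euc n) x)]
  [IsContinuousRiemannianBundle (Euc n) (fun x : M ↦ TangentSpace 𝓘(ℝ, Euc n) x)]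
  [MeasurableSpace M] [BorelSpace M]

/-- Test functions of the form `ρ T(v)`, where `v` is a weakly differentiable function and `ρ` is
supported in a chart, are admissible in the definition of the weak `p`-Laplacian. -/
lemma IsWeakPLaplacian.integral_mul_comp_of_tsupport_subset {p : ℝ} (hp : 1 < p) {φ : M → ℝ}
    (hφ : Continuous φ) {v₀ v f : M → ℝ} {V V' : ∀ x : M, TangentSpace 𝓘(ℝ, Euc n) x}
    (hf : IsWeakPLaplacian p φ V f) (hV : IsWeakGradient v₀ V)
    (hVp : MemLp (fun x ↦ ‖V x‖) (ENNReal.ofReal p) (weightedVolume n φ))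
    (hv : IsWeakGradient v V')
    (hV'p : MemLp (fun x ↦ ‖V' x‖) (ENNReal.ofReal p) (weightedVolume n φ))
    {T : ℝ → ℝ} (hT : ContDiff ℝ ∞ T) {c : ℝ} (hTc : ∀ s, |T s| ≤ c) (hT'c : ∀ s, |deriv T s| ≤ c)
    {ρ : M → ℝ} (hρ : IsTestFunction n ρ) (x₀ : M)
    (hsub : tsupport ρ ⊆ (chartAt (Euc n) x₀).source) :
    ∫ x, f x * (ρ x * T (v x)) ∂(weightedVolume n φ) =
      -∫ x, ‖V x‖ ^ (p - 2) * (T (v x) * dirDeriv ρ x (V x) +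
        ρ x * (deriv T (v x) * inner ℝ (V' x) (V x))) ∂(weightedVolume n φ) := by
  have hc0 : 0 ≤ c := (abs_nonneg _).trans (hTc 0)
  have hT' : Continuous (deriv T) := hT.continuous_deriv (by simp)
  have hTd : Differentiable ℝ T := hT.differentiable (by simp)
  have hsm : MeasurableSet (tsupport ρ) := (isClosed_tsupport ρ).measurableSet
  have hK := isCompact_chart_image (n := n) x₀ hρ.2.isCompact hsub
  have hKt := chart_image_subset_target (n := n) x₀ hsub
  set K : Set (Euc n) := chartAt (Euc n) x₀ '' tsupport ρ with hKdef
  have hKm := hK.measurableSet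
  set lam := (coordMeasure (n := n) φ x₀).restrict K with hlam
  have hT0 := (chartAt (Euc n) x₀).open_target
  -- The functions are cut off on `K'` rather than on `K`, which leaves room to mollify without
  -- disturbing their values and weak derivatives on `K`.
  obtain ⟨K', hK', hKK', hK't⟩ := exists_compact_between hK hT0 hKt
  obtain ⟨B, hB, -, hle⟩ := exists_coordMeasure_le (n := n) hφ x₀ hK hKt
  obtain ⟨A, hA, -, hA2⟩ := exists_norm_coordVector_le (n := n) x₀ hK hKt
  have hlam_vol : lam ≤ B • volume := hle.trans (by
    gcongr
    exact Measure.restrict_le_self)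
  have hac : lam ≪ volume.restrict (chartAt (Euc n) x₀).target :=
    Measure.restrict_le_self.absolutelyContinuous.trans (coordMeasure_absolutelyContinuous φ x₀)
  have hac' : lam ≪ volume := hac.trans Measure.restrict_le_self.absolutelyContinuous
  have hfin : IsFiniteMeasure lam := ⟨by
    refine (hle univ).trans_lt ?_
    simpa using ENNReal.mul_lt_top hB.lt_top hK.measure_lt_top⟩
  have hmemK : ∀ᵐ y ∂lam, y ∈ K := ae_restrict_mem hKm
  -- mollifications
  obtain ⟨k₀, hk₀⟩ : ∃ k₀, ∀ k, ∀ y ∈ K,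
      Metric.closedBall y (mollBump n (k + k₀)).rOut ⊆ K' := by
    obtain ⟨δ, hδ, hthick⟩ := hK.exists_cthickening_subset_open isOpen_interior hKK'
    obtain ⟨k₀, hk₀⟩ := eventually_atTop.1
      ((tendsto_mollBump_rOut (n := n)).eventually_lt_const hδ)
    refine ⟨k₀, fun k y hy ↦ ?_⟩
    exact ((Metric.closedBall_subset_closedBall (hk₀ (k + k₀) (by omega)).le).trans
      (Metric.closedBall_subset_cthickening hy δ)).trans (hthick.trans interior_subset)
  set w : Euc n → ℝ := K'.indicator fun y ↦ v ((chartAt (Euc n) x₀).symm y) with hw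
  have hwloc : LocallyIntegrable w := ((integrable_indicator_iff hK'.measurableSet).2
    ((hv x₀).1.integrableOn_compact_subset hK't hK')).locallyIntegrable
  set vk : ℕ → Euc n → ℝ := fun k ↦ mollify (k + k₀) w with hvk
  have hvks : ∀ k, ContDiff ℝ ∞ (vk k) := fun k ↦ contDiff_mollify _ hwloc
  set a : Fin n → Euc n → ℝ := fun i ↦ K'.indicator fun y ↦
    inner ℝ (V' ((chartAt (Euc n) x₀).symm y)) (coordVector x₀ y (EuclideanSpace.single i 1)) with ha
  have haLp : ∀ i, MemLp (a i) (ENNReal.ofReal p) volume := fun i ↦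
    hv.memLp_indicator_inner_coordVector hφ hV'p x₀ hK' hK't _
  have haloc : ∀ i, LocallyIntegrable (a i) := fun i ↦
    (haLp i).locallyIntegrable (by simpa using hp.le)
  set m : Fin n → ℕ → Euc n → ℝ := fun i k ↦ mollify (k + k₀) (a i) with hm
  have hder : ∀ i k, ∀ y ∈ K, fderiv ℝ (vk k) y (EuclideanSpace.single i 1) = m i k y :=
    fun i k y hy ↦ fderiv_mollify_indicator (k + k₀) hT0.measurableSet hK' hK't (hv x₀).1
      ((hv x₀).2 (EuclideanSpace.single i 1)).2 (hk₀ k) hy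
  have htend : ∀ᵐ y ∂lam, Tendsto (fun k ↦ vk k y) atTop
      (𝓝 (v ((chartAt (Euc n) x₀).symm y))) := by
    filter_upwards [hac'.ae_le (ae_tendsto_mollify hwloc), hmemK] with y hy hyK
    rw [hw, indicator_of_mem (interior_subset (hKK' hyK))] at hy
    exact hy.comp (tendsto_add_atTop_nat k₀)
  have hmLp : ∀ i, Tendsto (fun k ↦ eLpNorm (fun y ↦ m i k y - a i y) (ENNReal.ofReal p) lam)
      atTop (𝓝 0) := by
    intro i
    have h1 := (tendsto_eLpNorm_mollify hp.le (haLp i)).comp (tendsto_add_atTop_nat k₀)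
    have h2 := ENNReal.Tendsto.const_mul (a := B ^ (1 / ENNReal.ofReal p).toReal) h1
      (Or.inr (ENNReal.rpow_ne_top_of_nonneg ENNReal.toReal_nonneg hB))
    rw [mul_zero] at h2
    refine tendsto_of_tendsto_of_tendsto_of_le_of_le tendsto_const_nhds h2 (fun _ ↦ zero_le)
      fun k ↦ ?_
    refine (eLpNorm_mono_measure _ hlam_vol).trans_eq ?_
    rw [eLpNorm_smul_measure_of_ne_top ENNReal.ofReal_ne_top, smul_eq_mul]
    rfl
  have haLp' : ∀ i, MemLp (a i) (ENNReal.ofReal p) lam := fun i ↦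
    ((haLp i).smul_measure hB).mono_measure hlam_vol
  have hmMem : ∀ i k, MemLp (m i k) (ENNReal.ofReal p) lam := by
    intro i k
    have hcont : Continuous (m i k) := (contDiff_mollify _ (haloc i)).continuous
    obtain ⟨b, hb⟩ := hK.bddAbove_image hcont.norm.continuousOn
    refine MemLp.of_bound hcont.aestronglyMeasurable b ?_
    filter_upwards [hmemK] with y hy
    exact hb ⟨y, hy, rfl⟩
  -- the other factors
  set r : Euc n → ℝ := fun y ↦ ρ ((chartAt (Euc n) x₀).symm y) with hr
  have hrs : ContDiffOn ℝ ∞ r (chartAt (Euc n) x₀).target :=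
    (hρ.1.comp_contMDiffOn (contMDiffOn_chart_symm (n := ∞))).contDiffOn
  set ri : Fin n → Euc n → ℝ := fun i y ↦ fderiv ℝ r y (EuclideanSpace.single i 1) with hri
  have hric : ∀ i, ContinuousOn (ri i) (chartAt (Euc n) x₀).target := fun i ↦
    (hrs.continuousOn_fderiv_of_isOpen hT0 (by simp)).clm_apply continuousOn_const
  have hrm : AEStronglyMeasurable r lam :=
    (hrs.continuousOn.aestronglyMeasurable hT0.measurableSet).mono_ac hac
  have hrim : ∀ i, AEStronglyMeasurable (ri i) lam := fun i ↦
    ((hric i).aestronglyMeasurable hT0.measurableSet).mono_ac hac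
  obtain ⟨b₀, hb₀⟩ := hK.bddAbove_image (hrs.continuousOn.mono hKt).norm
  choose b hb using fun i ↦ hK.bddAbove_image ((hric i).mono hKt).norm
  set X : Euc n → Euc n := fun y ↦ coordRepr x₀ y (V ((chartAt (Euc n) x₀).symm y)) with hX
  -- The components of the flux `‖V‖^(p-2) V`. They lie in the dual space `L^{p'}`, so strong `L^p`
  -- convergence of the mollified derivatives is enough.
  set F : Fin n → Euc n → ℝ := fun i y ↦
    ‖V ((chartAt (Euc n) x₀).symm y)‖ ^ (p - 2) * X y i with hF
  set p' := ENNReal.ofReal (p / (p - 1)) with hp'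
  have hconj : ENNReal.HolderConjugate (ENNReal.ofReal p) p' := by
    have := holderConjugate_ofReal (q := p - 1) (by linarith)
    rwa [sub_add_cancel] at this
  have hVlam : MemLp (fun y ↦ ‖V ((chartAt (Euc n) x₀).symm y)‖) (ENNReal.ofReal p) lam :=
    (memLp_comp_chart_symm hφ x₀ hVp).restrict K
  have hFLp : ∀ i, MemLp (F i) p' lam := by
    intro i
    refine (memLp_abs_rpow (s := p - 1) (by linarith) hVlam).of_le_mul (c := A) ?_ ?_
    · have h1 := hVlam.1.aemeasurable
      have h2 : AEMeasurable (fun y ↦ X y i) lam :=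
        ((hV.aestronglyMeasurable_coordRepr x₀ i).mono_ac hac).aemeasurable
      exact ((h1.pow_const (p - 2)).mul h2).aestronglyMeasurable
    · filter_upwards [hmemK] with y hy
      have h1 : ‖X y i‖ ≤ A * ‖V ((chartAt (Euc n) x₀).symm y)‖ := by
        refine (PiLp.norm_apply_le (X y) i).trans ?_
        have := hA2 y hy (X y)
        rwa [hX, coordVector_coordRepr x₀ (hKt hy)] at this
      have h2 := rpow_sub_one_mul_self (q := p - 1) (by linarith)
        (norm_nonneg (V ((chartAt (Euc n) x₀).symm y)))
      rw [show p - 1 - 1 = p - 2 by ring] at h2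
      have h0 := norm_nonneg (V ((chartAt (Euc n) x₀).symm y))
      calc ‖F i y‖ = ‖V ((chartAt (Euc n) x₀).symm y)‖ ^ (p - 2) * ‖X y i‖ := by
            rw [hF, norm_mul, Real.norm_of_nonneg (Real.rpow_nonneg h0 (p - 2))]
        _ ≤ ‖V ((chartAt (Euc n) x₀).symm y)‖ ^ (p - 2) *
            (A * ‖V ((chartAt (Euc n) x₀).symm y)‖) := by gcongr
        _ = A * ‖V ((chartAt (Euc n) x₀).symm y)‖ ^ (p - 1) := by rw [← h2]; ring
        _ = _ := by rw [abs_of_nonneg h0, Real.norm_of_nonneg (Real.rpow_nonneg h0 (p - 1))]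
  -- The constant function brings the term with the derivative of `ρ` into the shape of
  -- `tendsto_integral_mul_mul`.
  have hone : MemLp (fun _ : Euc n ↦ (1 : ℝ)) (ENNReal.ofReal p) lam := memLp_const 1
  have hvm : AEStronglyMeasurable (fun y ↦ v ((chartAt (Euc n) x₀).symm y)) lam :=
    (hv x₀).1.aestronglyMeasurable.mono_ac hac
  have hbd1 : ∀ i (τ : Euc n → ℝ), ∀ᵐ y ∂lam, |ri i y * T (τ y)| ≤ b i * c := by
    intro i τ
    filter_upwards [hmemK] with y hy
    rw [abs_mul]
    have h1 := hb i ⟨y, hy, rfl⟩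
    exact mul_le_mul h1 (hTc _) (abs_nonneg _) ((norm_nonneg _).trans h1)
  have hbd2 : ∀ (τ : Euc n → ℝ), ∀ᵐ y ∂lam, |r y * deriv T (τ y)| ≤ b₀ * c := by
    intro τ
    filter_upwards [hmemK] with y hy
    rw [abs_mul]
    have h1 := hb₀ ⟨y, hy, rfl⟩
    exact mul_le_mul h1 (hT'c _) (abs_nonneg _) ((norm_nonneg _).trans h1)
  have hms1 : ∀ i {τ : Euc n → ℝ}, AEStronglyMeasurable τ lam →
      AEStronglyMeasurable (fun y ↦ ri i y * T (τ y)) lam := fun i τ hτ ↦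
    (hrim i).mul (hT.continuous.comp_aestronglyMeasurable hτ)
  have hms2 : ∀ {τ : Euc n → ℝ}, AEStronglyMeasurable τ lam →
      AEStronglyMeasurable (fun y ↦ r y * deriv T (τ y)) lam := fun hτ ↦
    hrm.mul (hT'.comp_aestronglyMeasurable hτ)
  have hint1 : ∀ i {τ : Euc n → ℝ}, AEStronglyMeasurable τ lam →
      Integrable (fun y ↦ F i y * (ri i y * T (τ y) * 1)) lam := fun i τ hτ ↦
    integrable_mul_mul (hFLp i) hone (hms1 i hτ) (hbd1 i τ)
  have hint2 : ∀ i {τ g : Euc n → ℝ}, AEStronglyMeasurable τ lam →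
      MemLp g (ENNReal.ofReal p) lam →
      Integrable (fun y ↦ F i y * (r y * deriv T (τ y) * g y)) lam := fun i τ g hτ hg ↦
    integrable_mul_mul (hFLp i) hg (hms2 hτ) (hbd2 τ)
  have hsplit : ∀ {τ : Euc n → ℝ} {g : Fin n → Euc n → ℝ}, AEStronglyMeasurable τ lam →
      (∀ i, MemLp (g i) (ENNReal.ofReal p) lam) →
      Integrable (fun y ↦ ∑ i, (F i y * (ri i y * T (τ y) * 1) +
        F i y * (r y * deriv T (τ y) * g i y))) lam ∧
      ∫ y, ∑ i, (F i y * (ri i y * T (τ y) * 1) + F i y * (r y * deriv T (τ y) * g i y)) ∂lam =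
      ∑ i, (∫ y, F i y * (ri i y * T (τ y) * 1) ∂lam +
        ∫ y, F i y * (r y * deriv T (τ y) * g i y) ∂lam) := by
    intro τ g hτ hg
    have hi : ∀ i, Integrable (fun y ↦ F i y * (ri i y * T (τ y) * 1) +
        F i y * (r y * deriv T (τ y) * g i y)) lam :=
      fun i ↦ (hint1 i hτ).add (hint2 i hτ (hg i))
    refine ⟨integrable_finsetSum _ fun i _ ↦ hi i, ?_⟩
    rw [integral_finsetSum _ fun i _ ↦ hi i]
    exact Finset.sum_congr rfl fun i _ ↦ integral_add (hint1 i hτ) (hint2 i hτ (hg i))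
  have hvkm : ∀ k, AEStronglyMeasurable (vk k) lam := fun k ↦ (hvks k).continuous.aestronglyMeasurable
  -- differential of the cutoff in coordinates
  have hdρ : ∀ y ∈ K, dirDeriv ρ ((chartAt (Euc n) x₀).symm y) (V ((chartAt (Euc n) x₀).symm y)) =
      ∑ i, X y i * ri i y := by
    intro y hy
    have h1 := dirDeriv_coordVector x₀ (hKt hy) ((hρ.1 _).mdifferentiableAt (by simp)) (X y)
    rw [hX, coordVector_coordRepr x₀ (hKt hy)] at h1
    rw [h1, clm_apply_eq_sum]
  -- the right-hand sides
  have hRk : ∀ k, ∫ x, ‖V x‖ ^ (p - 2) *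
      dirDeriv (fun x ↦ ρ x * T (vk k (chartAt (Euc n) x₀ x))) x (V x) ∂(weightedVolume n φ) =
      ∫ y, ∑ i, (F i y * (ri i y * T (vk k y) * 1) +
        F i y * (r y * deriv T (vk k y) * m i k y)) ∂lam := by
    intro k
    have hTv : ContDiff ℝ ∞ fun y ↦ T (vk k y) := hT.comp (hvks k)
    have hat : ∀ x ∈ tsupport ρ, ContMDiffAt 𝓘(ℝ, Euc n) 𝓘(ℝ, ℝ) ∞
      (fun x ↦ T (vk k (chartAt (Euc n) x₀ x))) x :=
      fun x hx ↦ contMDiffAt_comp_chart x₀ (hsub hx) hTv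
    have hpt : ∀ y ∈ K, ‖V ((chartAt (Euc n) x₀).symm y)‖ ^ (p - 2) *
        dirDeriv (fun x ↦ ρ x * T (vk k (chartAt (Euc n) x₀ x))) ((chartAt (Euc n) x₀).symm y)
          (V ((chartAt (Euc n) x₀).symm y)) =
        ∑ i, (F i y * (ri i y * T (vk k y) * 1) +
          F i y * (r y * deriv T (vk k y) * m i k y)) := by
      intro y hy
      have hd : HasFDerivAt (fun y ↦ T (vk k y)) (deriv T (vk k y) • fderiv ℝ (vk k) y) y :=
        (hTd _).hasDerivAt.comp_hasFDerivAt y ((hvks k).differentiable (by simp) y).hasFDerivAt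
      rw [dirDeriv_mul_of_tsupport hρ.1 hat, dirDeriv_comp_chart x₀ (hKt hy)
        (hTv.differentiable (by simp) y), hdρ y hy, hd.fderiv,
        (chartAt (Euc n) x₀).right_inv (hKt hy), smul_apply,
        clm_apply_eq_sum (fderiv ℝ (vk k) y)]
      simp_rw [hder _ k y hy]
      rw [Finset.sum_add_distrib, mul_add, smul_eq_mul, Finset.mul_sum, Finset.mul_sum,
        Finset.mul_sum, Finset.mul_sum, Finset.mul_sum]
      congr 1
      · exact Finset.sum_congr rfl fun i _ ↦ by simp only [hF]; ring
      · exact Finset.sum_congr rfl fun i _ ↦ by simp only [hF, hX, hr]; ring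
    rw [integral_eq_integral_coord hφ x₀ hρ.2 hsub]
    · exact setIntegral_congr_fun hKm hpt
    · intro x hx
      rw [dirDeriv_eq_zero_of_notMem_tsupport (fun h ↦ hx (tsupport_mul_subset_left h)), mul_zero]
    · refine (hsplit (hvkm k) (hmMem · k)).1.1.congr ?_
      filter_upwards [hmemK] with y hy
      exact (hpt y hy).symm
  have hR : ∫ x, ‖V x‖ ^ (p - 2) * (T (v x) * dirDeriv ρ x (V x) +
        ρ x * (deriv T (v x) * inner ℝ (V' x) (V x))) ∂(weightedVolume n φ) =
      ∫ y, ∑ i, (F i y * (ri i y * T (v ((chartAt (Euc n) x₀).symm y)) * 1) +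
        F i y * (r y * deriv T (v ((chartAt (Euc n) x₀).symm y)) * a i y)) ∂lam := by
    have hpt : ∀ y ∈ K, ‖V ((chartAt (Euc n) x₀).symm y)‖ ^ (p - 2) *
        (T (v ((chartAt (Euc n) x₀).symm y)) *
          dirDeriv ρ ((chartAt (Euc n) x₀).symm y) (V ((chartAt (Euc n) x₀).symm y)) +
        ρ ((chartAt (Euc n) x₀).symm y) * (deriv T (v ((chartAt (Euc n) x₀).symm y)) *
          inner ℝ (V' ((chartAt (Euc n) x₀).symm y)) (V ((chartAt (Euc n) x₀).symm y)))) =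
        ∑ i, (F i y * (ri i y * T (v ((chartAt (Euc n) x₀).symm y)) * 1) +
        F i y * (r y * deriv T (v ((chartAt (Euc n) x₀).symm y)) * a i y)) := by
      intro y hy
      rw [hdρ y hy, inner_eq_sum_coordRepr x₀ (hKt hy), Finset.sum_add_distrib, mul_add,
        Finset.mul_sum, Finset.mul_sum, Finset.mul_sum, Finset.mul_sum, Finset.mul_sum]
      congr 1
      · exact Finset.sum_congr rfl fun i _ ↦ by simp only [hF]; ring
      · refine Finset.sum_congr rfl fun i _ ↦ ?_
        simp only [hF, hX, hr, ha, indicator_of_mem (interior_subset (hKK' hy))]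
        ring
    rw [integral_eq_integral_coord hφ x₀ hρ.2 hsub]
    · exact setIntegral_congr_fun hKm hpt
    · intro x hx
      rw [dirDeriv_eq_zero_of_notMem_tsupport hx, image_eq_zero_of_notMem_tsupport hx]
      simp
    · refine (hsplit hvm haLp').1.1.congr ?_
      filter_upwards [hmemK] with y hy
      exact (hpt y hy).symm
  have hRlim : Tendsto (fun k ↦ ∫ x, ‖V x‖ ^ (p - 2) *
      dirDeriv (fun x ↦ ρ x * T (vk k (chartAt (Euc n) x₀ x))) x (V x) ∂(weightedVolume n φ))
      atTop (𝓝 (∫ x, ‖V x‖ ^ (p - 2) * (T (v x) * dirDeriv ρ x (V x) +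
        ρ x * (deriv T (v x) * inner ℝ (V' x) (V x))) ∂(weightedVolume n φ))) := by
    simp_rw [hRk]
    rw [hR, (hsplit hvm haLp').2]
    simp_rw [fun k ↦ (hsplit (hvkm k) (hmMem · k)).2]
    refine tendsto_finsetSum _ fun i _ ↦ Tendsto.add ?_ ?_
    · refine tendsto_integral_mul_mul (p := ENNReal.ofReal p) (p' := p') (hFLp i) hone
        (fun _ ↦ hone) (by simp) (fun k ↦ hms1 i (hvkm k)) (fun k ↦ hbd1 i (vk k)) ?_
      filter_upwards [htend] with y hy
      exact ((hT.continuous.tendsto _).comp hy).const_mul _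
    · refine tendsto_integral_mul_mul (p := ENNReal.ofReal p) (p' := p') (hFLp i) (haLp' i)
        (hmMem i) (hmLp i) (fun k ↦ hms2 (hvkm k)) (fun k ↦ hbd2 (vk k)) ?_
      filter_upwards [htend] with y hy
      exact ((hT'.tendsto _).comp hy).const_mul _
  -- the left-hand sides
  have hfK : IntegrableOn (fun y ↦ f ((chartAt (Euc n) x₀).symm y)) K
      (coordMeasure (n := n) φ x₀) :=
    integrableOn_comp_chart_symm hφ x₀ hρ.2 hsm hsub (hf.1.integrableOn_isCompact hρ.2)
  have hLm : ∀ {τ : Euc n → ℝ}, AEStronglyMeasurable τ lam →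
      AEStronglyMeasurable (fun y ↦ f ((chartAt (Euc n) x₀).symm y) * (r y * T (τ y))) lam :=
    fun hτ ↦ hfK.1.mul (hrm.mul (hT.continuous.comp_aestronglyMeasurable hτ))
  have hLk : ∀ k, ∫ x, f x * (ρ x * T (vk k (chartAt (Euc n) x₀ x))) ∂(weightedVolume n φ) =
      ∫ y, f ((chartAt (Euc n) x₀).symm y) * (r y * T (vk k y)) ∂lam := by
    intro k
    have hpt : ∀ y ∈ K, f ((chartAt (Euc n) x₀).symm y) * (ρ ((chartAt (Euc n) x₀).symm y) *
        T (vk k (chartAt (Euc n) x₀ ((chartAt (Euc n) x₀).symm y)))) =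
        f ((chartAt (Euc n) x₀).symm y) * (r y * T (vk k y)) := fun y hy ↦ by
      rw [(chartAt (Euc n) x₀).right_inv (hKt hy)]
    rw [integral_eq_integral_coord hφ x₀ hρ.2 hsub]
    · exact setIntegral_congr_fun hKm hpt
    · intro x hx
      rw [image_eq_zero_of_notMem_tsupport hx]
      simp
    · refine (hLm (hvkm k)).congr ?_
      filter_upwards [hmemK] with y hy
      exact (hpt y hy).symm
  have hL : ∫ x, f x * (ρ x * T (v x)) ∂(weightedVolume n φ) =
      ∫ y, f ((chartAt (Euc n) x₀).symm y) *
        (r y * T (v ((chartAt (Euc n) x₀).symm y))) ∂lam := by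
    rw [integral_eq_integral_coord hφ x₀ hρ.2 hsub]
    · intro x hx
      rw [image_eq_zero_of_notMem_tsupport hx]
      simp
    · exact hLm hvm
  have hLlim : Tendsto (fun k ↦ ∫ x, f x * (ρ x * T (vk k (chartAt (Euc n) x₀ x)))
      ∂(weightedVolume n φ)) atTop (𝓝 (∫ x, f x * (ρ x * T (v x)) ∂(weightedVolume n φ))) := by
    simp_rw [hLk]
    rw [hL]
    refine tendsto_integral_of_dominated_convergence
      (fun y ↦ |f ((chartAt (Euc n) x₀).symm y)| * (b₀ * c)) (fun k ↦ hLm (hvkm k))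
      (hfK.abs.mul_const _) (fun k ↦ ?_) ?_
    · filter_upwards [hmemK] with y hy
      rw [Real.norm_eq_abs, abs_mul, abs_mul]
      have h1 := hb₀ ⟨y, hy, rfl⟩
      exact mul_le_mul_of_nonneg_left (mul_le_mul h1 (hTc _) (abs_nonneg _)
        ((norm_nonneg _).trans h1)) (abs_nonneg _)
    · filter_upwards [htend] with y hy
      exact (((hT.continuous.tendsto _).comp hy).const_mul _).const_mul _
  -- With `v` replaced by a mollification, the product with `ρ` is a genuine test function and the
  -- definition applies.
  have hE : ∀ k, ∫ x, f x * (ρ x * T (vk k (chartAt (Euc n) x₀ x))) ∂(weightedVolume n φ) =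
      -∫ x, ‖V x‖ ^ (p - 2) *
        dirDeriv (fun x ↦ ρ x * T (vk k (chartAt (Euc n) x₀ x))) x (V x) ∂(weightedVolume n φ) :=
    fun k ↦ hf.2 _ (hρ.mul fun x hx ↦ contMDiffAt_comp_chart x₀ (hsub hx) (hT.comp (hvks k)))
  exact tendsto_nhds_unique hLlim (by simpa only [hE] using hRlim.neg)

end LocalIntegrationByParts

/-! ### Integration by parts with an arbitrary compactly supported cutoff. -/

section GlobalIntegrationByParts

variable {n : ℕ} {M : Type*} [TopologicalSpace M] [ChartedSpace (Euc n) M]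
  [IsManifold 𝓘(ℝ, Euc n) ∞ M]
  [RiemannianBundle (fun x : M ↦ TangentSpace 𝓘(ℝ, Euc n) x)]
  [IsContinuousRiemannianBundle (Euc n) (fun x : M ↦ TangentSpace 𝓘(ℝ, Euc n) x)]
  [MeasurableSpace M] [BorelSpace M] [SecondCountableTopology M]

lemma IsWeakGradient.aestronglyMeasurable_dirDeriv {φ : M → ℝ} (hφ : Continuous φ) {v : M → ℝ}
    {V : ∀ x : M, TangentSpace 𝓘(ℝ, Euc n) x} (hV : IsWeakGradient v V) {η : M → ℝ}
    (hη : ContMDiff 𝓘(ℝ, Euc n) 𝓘(ℝ, ℝ) ∞ η) :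
    AEStronglyMeasurable (fun x ↦ dirDeriv η x (V x)) (weightedVolume n φ) := by
  refine aestronglyMeasurable_of_chart hφ fun x₀ ↦ ?_
  have hT0 := (chartAt (Euc n) x₀).open_target
  have hrs : ContDiffOn ℝ ∞ (fun y ↦ η ((chartAt (Euc n) x₀).symm y))
      (chartAt (Euc n) x₀).target :=
    (hη.comp_contMDiffOn (contMDiffOn_chart_symm (n := ∞))).contDiffOn
  have h : AEStronglyMeasurable (fun y ↦ ∑ i, coordRepr x₀ y (V ((chartAt (Euc n) x₀).symm y)) i *
      fderiv ℝ (fun y ↦ η ((chartAt (Euc n) x₀).symm y)) y (EuclideanSpace.single i 1))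
      (volume.restrict (chartAt (Euc n) x₀).target) :=
    Finset.aestronglyMeasurable_fun_sum _ fun i _ ↦
      (hV.aestronglyMeasurable_coordRepr x₀ i).mul
        (((hrs.continuousOn_fderiv_of_isOpen hT0 (by simp)).clm_apply
          continuousOn_const).aestronglyMeasurable hT0.measurableSet)
  refine h.congr ?_
  filter_upwards [ae_restrict_mem hT0.measurableSet] with y hy
  have h1 := dirDeriv_coordVector x₀ hy ((hη _).mdifferentiableAt (by simp))
    (coordRepr x₀ y (V ((chartAt (Euc n) x₀).symm y)))
  rw [coordVector_coordRepr x₀ hy] at h1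
  rw [h1, clm_apply_eq_sum]

lemma integrable_mul_testFunction_mul [T2Space M] {φ : M → ℝ} {f g ρ : M → ℝ}
    (hf : LocallyIntegrable f (weightedVolume n φ)) (hρ : IsTestFunction n ρ)
    (hg : AEStronglyMeasurable g (weightedVolume n φ)) {c : ℝ} (hgc : ∀ x, |g x| ≤ c) :
    Integrable (fun x ↦ f x * (ρ x * g x)) (weightedVolume n φ) := by
  have h := (hf.integrable_smul_left_of_hasCompactSupport hρ.1.continuous hρ.2).mul_bdd (c := c) hg
    (ae_of_all _ hgc)
  refine h.congr (ae_of_all _ fun x ↦ ?_)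
  simp only [smul_eq_mul]
  ring

lemma abs_norm_rpow_mul_mul_le {F : Type*} [NormedAddCommGroup F] {p : ℝ} (hp : 1 < p)
    {V : F} {t d B : ℝ} (hd : |d| ≤ B * ‖V‖) :
    |‖V‖ ^ (p - 2) * (t * d)| ≤ B * (‖V‖ ^ (p - 1) * |t|) := by
  have h2 := rpow_sub_one_mul_self (q := p - 1) (by linarith) (norm_nonneg V)
  rw [show p - 1 - 1 = p - 2 by ring] at h2
  rw [abs_mul, abs_mul, abs_of_nonneg (Real.rpow_nonneg (norm_nonneg V) (p - 2))]
  calc _ ≤ ‖V‖ ^ (p - 2) * (|t| * (B * ‖V‖)) := by gcongr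
    _ = B * (‖V‖ ^ (p - 2) * ‖V‖ * |t|) := by ring
    _ = _ := by rw [h2]

lemma integrable_norm_rpow_mul_dirDeriv {p : ℝ} (hp : 1 < p) {φ : M → ℝ} (hφ : Continuous φ)
    {v₀ g ρ : M → ℝ} {V : ∀ x : M, TangentSpace 𝓘(ℝ, Euc n) x} (hV : IsWeakGradient v₀ V)
    (hVp : MemLp (fun x ↦ ‖V x‖) (ENNReal.ofReal p) (weightedVolume n φ))
    (hρ : IsTestFunction n ρ) (hg : AEStronglyMeasurable g (weightedVolume n φ)) {c : ℝ}
    (hgc : ∀ x, |g x| ≤ c) :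
    Integrable (fun x ↦ ‖V x‖ ^ (p - 2) * (g x * dirDeriv ρ x (V x))) (weightedVolume n φ) := by
  have := isLocallyFiniteMeasure_weightedVolume (n := n) (M := M) hφ
  obtain ⟨B, hB, hle⟩ := hρ.exists_abs_dirDeriv_le
  have hm : AEStronglyMeasurable (fun x ↦ ‖V x‖ ^ (p - 2) * (g x * dirDeriv ρ x (V x)))
      (weightedVolume n φ) :=
    (hVp.1.aemeasurable.pow_const (p - 2)).aestronglyMeasurable.mul
      (hg.mul (hV.aestronglyMeasurable_dirDeriv hφ hρ.1))
  rw [← integrableOn_iff_integrable_of_support_subset (s := tsupport ρ)]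
  · have hone : IntegrableOn (fun _ : M ↦ (1 : ℝ)) (tsupport ρ) (weightedVolume n φ) :=
      integrableOn_const hρ.2.isCompact.measure_lt_top.ne
    have hVi : IntegrableOn (fun x ↦ |‖V x‖| ^ p) (tsupport ρ) (weightedVolume n φ) :=
      (integrable_abs_rpow (by linarith) hVp).integrableOn
    refine ((hVi.add hone).const_mul (B * c)).mono' hm.restrict (ae_of_all _ fun x ↦ ?_)
    have hc : 0 ≤ c := (abs_nonneg _).trans (hgc x)
    -- On the compact support of `ρ`, which has finite measure, the power `p - 1` is dominated by
    -- the integrable power `p` plus a constant.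
    have h1 : ‖V x‖ ^ (p - 1) ≤ |‖V x‖| ^ p + 1 := by
      rw [abs_norm]
      rcases le_total ‖V x‖ 1 with h | h
      · have := Real.rpow_le_one (norm_nonneg (V x)) h (by linarith : 0 ≤ p - 1)
        have := Real.rpow_nonneg (norm_nonneg (V x)) p
        linarith
      · have := Real.rpow_le_rpow_of_exponent_le h (by linarith : p - 1 ≤ p)
        linarith
    refine (abs_norm_rpow_mul_mul_le hp (hle x (V x))).trans ?_
    calc _ ≤ B * ((|‖V x‖| ^ p + 1) * c) := by
          gcongr
          exact hgc x
      _ = _ := by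
          simp only [Pi.add_apply]
          ring
  · intro x hx
    by_contra h
    exact hx (by simp only [dirDeriv_eq_zero_of_notMem_tsupport h, mul_zero])

/-- Test functions of the form `ρ T(v)`, where `v` is a weakly differentiable function, are
admissible in the definition of the weak `p`-Laplacian. -/
lemma IsWeakPLaplacian.integral_mul_comp [T2Space M] {p : ℝ} (hp : 1 < p) {φ : M → ℝ}
    (hφ : Continuous φ) {v₀ v f : M → ℝ} {V V' : ∀ x : M, TangentSpace 𝓘(ℝ, Euc n) x}
    (hf : IsWeakPLaplacian p φ V f) (hV : IsWeakGradient v₀ V)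
    (hVp : MemLp (fun x ↦ ‖V x‖) (ENNReal.ofReal p) (weightedVolume n φ))
    (hv : IsWeakGradient v V')
    (hV'p : MemLp (fun x ↦ ‖V' x‖) (ENNReal.ofReal p) (weightedVolume n φ))
    {T : ℝ → ℝ} (hT : ContDiff ℝ ∞ T) {c : ℝ} (hTc : ∀ s, |T s| ≤ c) (hT'c : ∀ s, |deriv T s| ≤ c)
    {ρ : M → ℝ} (hρ : IsTestFunction n ρ) :
    ∫ x, f x * (ρ x * T (v x)) ∂(weightedVolume n φ) =
      -∫ x, ‖V x‖ ^ (p - 2) * (T (v x) * dirDeriv ρ x (V x)) ∂(weightedVolume n φ) -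
        ∫ x, ρ x * (deriv T (v x) * (‖V x‖ ^ (p - 2) * inner ℝ (V x) (V' x)))
          ∂(weightedVolume n φ) := by
  have : LocallyCompactSpace M := ChartedSpace.locallyCompactSpace (Euc n) M
  have hT' : Continuous (deriv T) := hT.continuous_deriv (by simp)
  have hvm := hv.aestronglyMeasurable hφ
  have hTm := hT.continuous.comp_aestronglyMeasurable hvm
  have hT'm := hT'.comp_aestronglyMeasurable hvm
  have hVV := integrable_norm_rpow_mul_inner hp hVp hV'p (hV.aestronglyMeasurable_inner hφ hv)
  -- The cutoff `ρ` is split as `∑ ρ P i` with each summand supported in one chart; the terms with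
  -- the derivatives of the summands add up to the derivative of `ρ`.
  obtain ⟨J, P, hPs, hPU, -, -, hP1⟩ := exists_finset_partitionOfUnity (n := n)
    (U := fun x : M ↦ (chartAt (Euc n) x).source) (fun x ↦ (chartAt (Euc n) x).open_source)
    (fun x ↦ mem_chart_source (Euc n) x) hρ.2.isCompact
  have hP1' : ∀ x ∈ tsupport ρ, ∑ i ∈ J, P i x = 1 := fun x hx ↦
    (hP1.filter_mono (nhds_le_nhdsSet hx)).self_of_nhds
  have hρP : ∀ i, IsTestFunction n fun x ↦ ρ x * P i x := fun i ↦ hρ.mul fun x _ ↦ hPs i x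
  have hsum : ∀ x, ∑ i ∈ J, ρ x * P i x = ρ x := by
    intro x
    rw [← Finset.mul_sum]
    by_cases hx : x ∈ tsupport ρ
    · rw [hP1' x hx, mul_one]
    · rw [image_eq_zero_of_notMem_tsupport hx, zero_mul]
  have hdsum : ∀ x (X : TangentSpace 𝓘(ℝ, Euc n) x),
      ∑ i ∈ J, dirDeriv (fun x ↦ ρ x * P i x) x X = dirDeriv ρ x X := by
    intro x X
    rw [← dirDeriv_sum J fun i _ ↦ ((hρP i).1 x).mdifferentiableAt (by simp)]
    simp_rw [hsum]
  have hcbound : ∀ {ρ : M → ℝ}, IsTestFunction n ρ →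
      ∃ B, ∀ x, ‖ρ x * deriv T (v x)‖ ≤ B := by
    intro ρ hρ
    obtain ⟨B, hB⟩ := hρ.1.continuous.bounded_above_of_compact_support hρ.2
    refine ⟨B * c, fun x ↦ ?_⟩
    rw [norm_mul]
    exact mul_le_mul (hB x) (hT'c _) (norm_nonneg _) ((norm_nonneg _).trans (hB x))
  have hiC : ∀ {ρ : M → ℝ}, IsTestFunction n ρ → Integrable (fun x ↦
      ρ x * (deriv T (v x) * (‖V x‖ ^ (p - 2) * inner ℝ (V x) (V' x)))) (weightedVolume n φ) := by
    intro ρ hρ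
    obtain ⟨B, hB⟩ := hcbound hρ
    refine (hVV.bdd_mul (hρ.1.continuous.aestronglyMeasurable.mul hT'm) (ae_of_all _ hB)).congr
      (ae_of_all _ fun x ↦ ?_)
    simp only [Pi.mul_apply]
    ring
  have hiB : ∀ {ρ : M → ℝ}, IsTestFunction n ρ → Integrable (fun x ↦
      ‖V x‖ ^ (p - 2) * (T (v x) * dirDeriv ρ x (V x))) (weightedVolume n φ) := fun hρ ↦
    integrable_norm_rpow_mul_dirDeriv hp hφ hV hVp hρ hTm fun x ↦ hTc _
  have hloc : ∀ i, ∫ x, f x * ((ρ x * P i x) * T (v x)) ∂(weightedVolume n φ) =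
      -∫ x, ‖V x‖ ^ (p - 2) * (T (v x) * dirDeriv (fun x ↦ ρ x * P i x) x (V x))
        ∂(weightedVolume n φ) -
        ∫ x, (ρ x * P i x) * (deriv T (v x) * (‖V x‖ ^ (p - 2) * inner ℝ (V x) (V' x)))
          ∂(weightedVolume n φ) := by
    intro i
    rw [hf.integral_mul_comp_of_tsupport_subset hp hφ hV hVp hv hV'p hT hTc hT'c (hρP i) i
      (tsupport_mul_subset_right.trans (hPU i)), ← neg_add', ← integral_add (hiB (hρP i))
      (hiC (hρP i))]
    congr 1
    refine integral_congr_ae (ae_of_all _ fun x ↦ ?_)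
    simp only [real_inner_comm]
    ring
  have hL : ∫ x, f x * (ρ x * T (v x)) ∂(weightedVolume n φ) =
      ∑ i ∈ J, ∫ x, f x * ((ρ x * P i x) * T (v x)) ∂(weightedVolume n φ) := by
    rw [← integral_finsetSum _ fun i _ ↦
      integrable_mul_testFunction_mul hf.1 (hρP i) hTm (fun x ↦ hTc _)]
    refine integral_congr_ae (ae_of_all _ fun x ↦ ?_)
    simp only
    rw [← Finset.mul_sum, ← Finset.sum_mul, hsum]
  have hR1 : ∫ x, ‖V x‖ ^ (p - 2) * (T (v x) * dirDeriv ρ x (V x)) ∂(weightedVolume n φ) =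
      ∑ i ∈ J, ∫ x, ‖V x‖ ^ (p - 2) * (T (v x) * dirDeriv (fun x ↦ ρ x * P i x) x (V x))
        ∂(weightedVolume n φ) := by
    rw [← integral_finsetSum _ fun i _ ↦ hiB (hρP i)]
    refine integral_congr_ae (ae_of_all _ fun x ↦ ?_)
    simp only
    rw [← Finset.mul_sum, ← Finset.mul_sum, hdsum]
  have hR2 : ∫ x, ρ x * (deriv T (v x) * (‖V x‖ ^ (p - 2) * inner ℝ (V x) (V' x)))
        ∂(weightedVolume n φ) =
      ∑ i ∈ J, ∫ x, (ρ x * P i x) * (deriv T (v x) * (‖V x‖ ^ (p - 2) * inner ℝ (V x) (V' x)))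
        ∂(weightedVolume n φ) := by
    rw [← integral_finsetSum _ fun i _ ↦ hiC (hρP i)]
    refine integral_congr_ae (ae_of_all _ fun x ↦ ?_)
    simp only
    rw [← Finset.sum_mul, hsum]
  rw [hL, hR1, hR2, ← Finset.sum_neg_distrib, ← Finset.sum_sub_distrib]
  exact Finset.sum_congr rfl fun i _ ↦ hloc i

end GlobalIntegrationByParts

/-! ### Integration by parts on the whole manifold. -/

section CompleteManifold

variable {n : ℕ} {M : Type*} [EMetricSpace M] [ChartedSpace (Euc n) M]
  [IsManifold 𝓘(ℝ, Euc n) ∞ M]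
  [RiemannianBundle (fun x : M ↦ TangentSpace 𝓘(ℝ, Euc n) x)]
  [IsContinuousRiemannianBundle (Euc n) (fun x : M ↦ TangentSpace 𝓘(ℝ, Euc n) x)]
  [IsRiemannianManifold 𝓘(ℝ, Euc n) M] [CompleteSpace M] [SecondCountableTopology M]
  [MeasurableSpace M] [BorelSpace M]

/-- Completeness enters here, through cutoffs with gradient at most `3/(k+1)`. The boundary term is
at most this times `∫ ‖V‖^(p-1) |T(v)|`, which is finite because `T(v)` is in `L^p`. -/
lemma IsWeakPLaplacian.integral_mul_comp_of_complete {p : ℝ} (hp : 1 < p) {φ : M → ℝ}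
    (hφ : Continuous φ) {v₀ v f : M → ℝ} {V V' : ∀ x : M, TangentSpace 𝓘(ℝ, Euc n) x}
    (hf : IsWeakPLaplacian p φ V f) (hV : IsWeakGradient v₀ V)
    (hVp : MemLp (fun x ↦ ‖V x‖) (ENNReal.ofReal p) (weightedVolume n φ))
    (hv : IsWeakGradient v V')
    (hV'p : MemLp (fun x ↦ ‖V' x‖) (ENNReal.ofReal p) (weightedVolume n φ))
    {T : ℝ → ℝ} (hT : ContDiff ℝ ∞ T) {c : ℝ} (hTc : ∀ s, |T s| ≤ c) (hT'c : ∀ s, |deriv T s| ≤ c)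
    (hfT : Integrable (fun x ↦ f x * T (v x)) (weightedVolume n φ))
    (hTp : MemLp (fun x ↦ T (v x)) (ENNReal.ofReal p) (weightedVolume n φ)) :
    ∫ x, f x * T (v x) ∂(weightedVolume n φ) =
      -∫ x, deriv T (v x) * (‖V x‖ ^ (p - 2) * inner ℝ (V x) (V' x)) ∂(weightedVolume n φ) := by
  obtain ⟨ρ, hρt, hρ01, hρ1, hρd⟩ := exists_cutoff n (M := M)
  have hT' : Continuous (deriv T) := hT.continuous_deriv (by simp)
  have hvm := hv.aestronglyMeasurable hφ
  have hT'm := hT'.comp_aestronglyMeasurable hvm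
  have hVV := integrable_norm_rpow_mul_inner hp hVp hV'p (hV.aestronglyMeasurable_inner hφ hv)
  have hT'V : Integrable (fun x ↦ deriv T (v x) * (‖V x‖ ^ (p - 2) * inner ℝ (V x) (V' x)))
      (weightedVolume n φ) := hVV.bdd_mul hT'm (ae_of_all _ fun x ↦ hT'c _)
  have hlim : ∀ {g : M → ℝ}, Integrable g (weightedVolume n φ) →
      Tendsto (fun k ↦ ∫ x, ρ k x * g x ∂(weightedVolume n φ)) atTop
        (𝓝 (∫ x, g x ∂(weightedVolume n φ))) := by
    intro g hg
    refine tendsto_integral_of_dominated_convergence (fun x ↦ |g x|)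
      (fun k ↦ (hρt k).1.continuous.aestronglyMeasurable.mul hg.1) hg.abs
      (fun k ↦ ae_of_all _ fun x ↦ ?_) (ae_of_all _ fun x ↦ ?_)
    · rw [norm_mul, Real.norm_of_nonneg (hρ01 k x).1, Real.norm_eq_abs]
      exact mul_le_of_le_one_left (abs_nonneg _) (hρ01 k x).2
    · simpa using (hρ1 x).mul_const (g x)
  have hgrad : Tendsto (fun k ↦ ∫ x, ‖V x‖ ^ (p - 2) * (T (v x) * dirDeriv (ρ k) x (V x))
      ∂(weightedVolume n φ)) atTop (𝓝 0) := by
    have hconj : ENNReal.HolderConjugate (ENNReal.ofReal p) (ENNReal.ofReal (p / (p - 1))) := by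
      have := holderConjugate_ofReal (q := p - 1) (by linarith)
      rwa [sub_add_cancel] at this
    have hi : Integrable (fun x ↦ ‖V x‖ ^ (p - 1) * |T (v x)|) (weightedVolume n φ) := by
      have h1 := memLp_abs_rpow (s := p - 1) (by linarith) hVp
      simp only [abs_norm] at h1
      refine (hTp.abs.integrable_mul h1).congr (ae_of_all _ fun x ↦ ?_)
      exact mul_comm |T (v x)| (‖V x‖ ^ (p - 1))
    have h0 : Tendsto (fun k : ℕ ↦ 3 * (1 / ((k : ℝ) + 1)) *
        ∫ x, ‖V x‖ ^ (p - 1) * |T (v x)| ∂(weightedVolume n φ)) atTop (𝓝 0) := by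
      simpa using (tendsto_one_div_add_atTop_nhds_zero_nat.const_mul (3 : ℝ)).mul_const
        (∫ x, ‖V x‖ ^ (p - 1) * |T (v x)| ∂(weightedVolume n φ))
    refine squeeze_zero_norm (fun k ↦ ?_) h0
    rw [← integral_const_mul]
    exact norm_integral_le_of_norm_le (hi.const_mul _)
      (ae_of_all _ fun x ↦ abs_norm_rpow_mul_mul_le hp (hρd k x (V x)))
  have hL := hlim hfT
  have hR := hgrad.neg.sub (hlim hT'V)
  rw [neg_zero, zero_sub] at hR
  refine tendsto_nhds_unique hL (hR.congr fun k ↦ ?_)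
  rw [← hf.integral_mul_comp hp hφ hV hVp hv hV'p hT hTc hT'c (hρt k)]
  refine integral_congr_ae (ae_of_all _ fun x ↦ ?_)
  simp only
  ring

lemma memLp_of_abs_le {α : Type*} [MeasurableSpace α] {μ : Measure α} {g : α → ℝ} {r p c : ℝ}
    (hg : MemLp g (ENNReal.ofReal r) μ) (hr : 0 < r) (hrp : r ≤ p) (hgc : ∀ x, |g x| ≤ c) :
    MemLp g (ENNReal.ofReal p) μ := by
  have hp : 0 < p := hr.trans_le hrp
  rw [← integrable_norm_rpow_iff hg.1 (by simpa using hp) ENNReal.ofReal_ne_top,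
    ENNReal.toReal_ofReal hp.le]
  have hm : AEStronglyMeasurable (fun x ↦ ‖g x‖ ^ p) μ :=
    (hg.1.norm.aemeasurable.pow_const p).aestronglyMeasurable
  refine ((integrable_abs_rpow hr hg).const_mul (c ^ (p - r))).mono' hm (ae_of_all _ fun x ↦ ?_)
  rw [Real.norm_of_nonneg (by positivity), Real.norm_eq_abs]
  calc |g x| ^ p = |g x| ^ (p - r) * |g x| ^ r := by
        rw [← Real.rpow_add_of_nonneg (abs_nonneg _) (by linarith) hr.le, sub_add_cancel]
    _ ≤ c ^ (p - r) * |g x| ^ r :=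
        mul_le_mul_of_nonneg_right (Real.rpow_le_rpow (abs_nonneg _) (hgc x) (sub_nonneg.2 hrp))
          (by positivity)

lemma abs_arctan_le_abs (s : ℝ) : |Real.arctan s| ≤ |s| := by
  have h : LipschitzWith 1 Real.arctan := lipschitzWith_of_nnnorm_deriv_le
    Real.differentiable_arctan fun x ↦ by
      rw [← NNReal.coe_le_coe, coe_nnnorm, Real.deriv_arctan, NNReal.coe_one, norm_div, norm_one,
        Real.norm_of_nonneg (by positivity), div_le_one (by positivity)]
      nlinarith [sq_nonneg x]
  simpa using h.dist_le_mul s 0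

/-- Integration by parts on a complete manifold, without boundary terms. -/
theorem IsWeakPLaplacian.integral_mul_eq {p q : ℝ} (hp : 1 < p) (hq : 0 < q)
    (hδ : 0 ≤ q * (p - 1) - 1) {φ : M → ℝ}
    (hφ : Continuous φ) {v₀ v f : M → ℝ} {V V' : ∀ x : M, TangentSpace 𝓘(ℝ, Euc n) x}
    (hf : IsWeakPLaplacian p φ V f) (hV : IsWeakGradient v₀ V)
    (hVp : MemLp (fun x ↦ ‖V x‖) (ENNReal.ofReal p) (weightedVolume n φ))
    (hv : IsWeakGradient v V')
    (hV'p : MemLp (fun x ↦ ‖V' x‖) (ENNReal.ofReal p) (weightedVolume n φ))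
    (hfq : MemLp f (ENNReal.ofReal (q + 1)) (weightedVolume n φ))
    (hvq : MemLp v (ENNReal.ofReal ((q + 1) / q)) (weightedVolume n φ)) :
    ∫ x, f x * v x ∂(weightedVolume n φ) =
      -∫ x, ‖V x‖ ^ (p - 2) * inner ℝ (V x) (V' x) ∂(weightedVolume n φ) := by
  have hvm := hv.aestronglyMeasurable hφ
  have hVV := integrable_norm_rpow_mul_inner hp hVp hV'p (hV.aestronglyMeasurable_inner hφ hv)
  have hfv := integrable_mul_of_memLp hq hfq hvq
  -- This is `δ ≥ 0`. It puts bounded functions of `L^((q+1)/q)` into `L^p`, although `v` itself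
  -- need not be there.
  have hr : (q + 1) / q ≤ p := by
    rw [div_le_iff₀ hq]
    linarith
  -- Smooth bounded truncations with `|T j s| ≤ |s|` and `0 < T j' ≤ 1`, converging to the identity
  -- together with their derivatives, so that both sides pass to the limit by dominated convergence.
  set T : ℕ → ℝ → ℝ := fun j s ↦ (j + 1) * Real.arctan (s / (j + 1)) with hTdef
  have hj : ∀ j : ℕ, (0 : ℝ) < j + 1 := fun j ↦ by positivity
  have hTs : ∀ j, ContDiff ℝ ∞ (T j) := fun j ↦
    contDiff_const.mul (Real.contDiff_arctan.comp (contDiff_id.div_const _))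
  have hTle : ∀ j s, |T j s| ≤ |s| := by
    intro j s
    rw [hTdef, abs_mul, abs_of_pos (hj j)]
    calc _ ≤ ((j : ℝ) + 1) * |s / (j + 1)| :=
          mul_le_mul_of_nonneg_left (abs_arctan_le_abs _) (hj j).le
      _ = |s| := by
          rw [abs_div, abs_of_pos (hj j)]
          field_simp
  -- The crude bound `π/2 ≤ 2` suffices; the same constant also bounds the derivative, as the
  -- preceding lemma expects.
  have hTc : ∀ j s, |T j s| ≤ (j + 1) * 2 := by
    intro j s
    rw [hTdef, abs_mul, abs_of_pos (hj j)]
    gcongr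
    rw [abs_le]
    constructor <;> linarith [Real.arctan_lt_pi_div_two (s / (j + 1)),
      Real.neg_pi_div_two_lt_arctan (s / (j + 1)), Real.pi_le_four]
  have hT' : ∀ j s, deriv (T j) s = 1 / (1 + (s / (j + 1)) ^ 2) := by
    intro j s
    have h := (((hasDerivAt_id s).div_const ((j : ℝ) + 1)).arctan).const_mul ((j : ℝ) + 1)
    rw [show deriv (T j) s = _ from h.deriv]
    have := (hj j).ne'
    simp only [id]
    field_simp
  have hT'1 : ∀ j s, |deriv (T j) s| ≤ 1 := by
    intro j s
    rw [hT', abs_of_nonneg (by positivity), div_le_one (by positivity)]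
    nlinarith [sq_nonneg (s / (j + 1))]
  have hinv : Tendsto (fun j : ℕ ↦ 1 / ((j : ℝ) + 1)) atTop (𝓝 0) :=
    tendsto_one_div_add_atTop_nhds_zero_nat
  have hT'lim : ∀ s, Tendsto (fun j ↦ deriv (T j) s) atTop (𝓝 1) := by
    intro s
    have h : Tendsto (fun j : ℕ ↦ 1 / (1 + (s * (1 / ((j : ℝ) + 1))) ^ 2)) atTop
        (𝓝 (1 / (1 + (s * 0) ^ 2))) :=
      Tendsto.div tendsto_const_nhds (((hinv.const_mul s).pow 2).const_add 1) (by simp)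
    refine (h.congr fun j ↦ ?_).trans (by simp)
    rw [hT', mul_one_div]
  have hTlim : ∀ s, Tendsto (fun j ↦ T j s) atTop (𝓝 s) := by
    intro s
    rcases eq_or_ne s 0 with rfl | hs
    · simp [hTdef]
    have h0 : HasDerivAt Real.arctan 1 0 := by simpa using Real.hasDerivAt_arctan 0
    have h1 : Tendsto (fun j : ℕ ↦ s * (1 / ((j : ℝ) + 1))) atTop (𝓝[≠] 0) := by
      refine tendsto_nhdsWithin_iff.2 ⟨by simpa using hinv.const_mul s,
        Eventually.of_forall fun j ↦ ?_⟩
      exact mul_ne_zero hs (one_div_pos.2 (hj j)).ne'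
    have h2 := ((hasDerivAt_iff_tendsto_slope.1 h0).comp h1).const_mul s
    rw [mul_one] at h2
    refine h2.congr fun j ↦ ?_
    have := (hj j).ne'
    simp only [Function.comp_apply, slope_def_field, Real.arctan_zero, sub_zero, hTdef,
      mul_one_div]
    field_simp
  have hTvm : ∀ j, AEStronglyMeasurable (fun x ↦ T j (v x)) (weightedVolume n φ) := fun j ↦
    (hTs j).continuous.comp_aestronglyMeasurable hvm
  have hT'vm : ∀ j, AEStronglyMeasurable (fun x ↦ deriv (T j) (v x)) (weightedVolume n φ) :=
    fun j ↦ ((hTs j).continuous_deriv (by simp)).comp_aestronglyMeasurable hvm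
  have hTp : ∀ j, MemLp (fun x ↦ T j (v x)) (ENNReal.ofReal p) (weightedVolume n φ) := by
    intro j
    have h1 : MemLp (fun x ↦ T j (v x)) (ENNReal.ofReal ((q + 1) / q)) (weightedVolume n φ) :=
      hvq.mono (hTvm j) (ae_of_all _ fun x ↦ hTle j _)
    exact memLp_of_abs_le h1 (by positivity) hr (hTc j <| v ·)
  have hid : ∀ j, ∫ x, f x * T j (v x) ∂(weightedVolume n φ) =
      -∫ x, deriv (T j) (v x) * (‖V x‖ ^ (p - 2) * inner ℝ (V x) (V' x)) ∂(weightedVolume n φ) :=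
    fun j ↦ hf.integral_mul_comp_of_complete hp hφ hV hVp hv hV'p (hTs j) (hTc j)
      (fun s ↦ (hT'1 j s).trans (by linarith [hj j]))
      (integrable_mul_of_memLp hq hfq (hvq.mono (hTvm j) (ae_of_all _ fun x ↦ hTle j _))) (hTp j)
  have hL : Tendsto (fun j ↦ ∫ x, f x * T j (v x) ∂(weightedVolume n φ)) atTop
      (𝓝 (∫ x, f x * v x ∂(weightedVolume n φ))) := by
    refine tendsto_integral_of_dominated_convergence (fun x ↦ |f x * v x|)
      (fun j ↦ hfq.1.mul (hTvm j)) hfv.abs (fun j ↦ ae_of_all _ fun x ↦ ?_)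
      (ae_of_all _ fun x ↦ (hTlim _).const_mul _)
    rw [Real.norm_eq_abs, abs_mul, abs_mul (f x)]
    exact mul_le_mul_of_nonneg_left (hTle j (v x)) (abs_nonneg (f x))
  have hR : Tendsto (fun j ↦ ∫ x, deriv (T j) (v x) * (‖V x‖ ^ (p - 2) * inner ℝ (V x) (V' x))
      ∂(weightedVolume n φ)) atTop
      (𝓝 (∫ x, ‖V x‖ ^ (p - 2) * inner ℝ (V x) (V' x) ∂(weightedVolume n φ))) := by
    refine tendsto_integral_of_dominated_convergence
      (fun x ↦ |‖V x‖ ^ (p - 2) * inner ℝ (V x) (V' x)|)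
      (fun j ↦ (hT'vm j).mul hVV.1) hVV.abs (fun j ↦ ae_of_all _ fun x ↦ ?_)
      (ae_of_all _ fun x ↦ ?_)
    · rw [norm_mul, Real.norm_eq_abs, Real.norm_eq_abs]
      exact mul_le_of_le_one_left (abs_nonneg _) (hT'1 j _)
    · simpa using (hT'lim (v x)).mul_const (‖V x‖ ^ (p - 2) * inner ℝ (V x) (V' x))
  exact tendsto_nhds_unique hL (by simpa only [hid] using hR.neg)

end CompleteManifold

/-! ### Time intervals, regularity of the metric, and the theorem. -/

lemma uniqueDiffOn_timeInterval {a b : EReal} (hab : a < b) :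
    UniqueDiffOn ℝ (timeInterval a b) := by
  refine uniqueDiffOn_convex (OrdConnected.convex ⟨fun x hx y hy z hz ↦ ?_⟩) ?_
  · exact ⟨hx.1.trans (EReal.coe_le_coe_iff.2 hz.1), (EReal.coe_le_coe_iff.2 hz.2).trans hy.2⟩
  · obtain ⟨c, hac, hcb⟩ := EReal.lt_iff_exists_real_btwn.1 hab
    refine ⟨c, mem_interior.2 ⟨(fun t : ℝ ↦ (t : EReal)) ⁻¹' Ioo a b, fun t ht ↦ ?_,
      isOpen_Ioo.preimage continuous_coe_real_ereal, hac, hcb⟩⟩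
    exact ⟨ht.1.le, ht.2.le⟩

lemma isContinuousRiemannianBundle {n : ℕ} {M : Type*} [TopologicalSpace M] [ChartedSpace (Euc n) M]
    [IsManifold 𝓘(ℝ, Euc n) ∞ M]
    [RiemannianBundle (fun x : M ↦ TangentSpace 𝓘(ℝ, Euc n) x)]
    [h : IsContMDiffRiemannianBundle 𝓘(ℝ, Euc n) ∞ (Euc n)
      (fun x : M ↦ TangentSpace 𝓘(ℝ, Euc n) x)] :
    IsContinuousRiemannianBundle (Euc n) (fun x : M ↦ TangentSpace 𝓘(ℝ, Euc n) x) := by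
  rcases h.exists_contMDiff with ⟨g, g_smooth, hg⟩
  exact ⟨g, g_smooth.continuous, hg⟩

end ParabolicFrequency

open ParabolicFrequency in
theorem theorem4 {n : ℕ} {M : Type*} [EMetricSpace M] [ChartedSpace (Euc n) M]
    [IsManifold 𝓘(ℝ, Euc n) ∞ M]
    [RiemannianBundle (fun x : M ↦ TangentSpace 𝓘(ℝ, Euc n) x)]
    [IsContMDiffRiemannianBundle 𝓘(ℝ, Euc n) ∞ (Euc n)
      (fun x : M ↦ TangentSpace 𝓘(ℝ, Euc n) x)]
    [IsRiemannianManifold 𝓘(ℝ, Euc n) M] [CompleteSpace M] [SecondCountableTopology M]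
    [MeasurableSpace M] [BorelSpace M]
    (φ : M → ℝ) (hφ : ContMDiff 𝓘(ℝ, Euc n) 𝓘(ℝ, ℝ) ∞ φ)
    (p q : ℝ) (hp : 1 < p) (hq : 0 < q) (hδ : 0 ≤ q * (p - 1) - 1)
    (a b : EReal) (hab : a < b)
    (C : ℝ → ℝ) (hC : ContDiffOn ℝ ∞ C (timeInterval a b))
    (hC0 : ∀ t ∈ timeInterval a b, 0 ≤ C t)
    -- the solution `u`, its time derivative `ut`, and the weak gradient `V` of `u^q`
    (u ut : ℝ → M → ℝ) (V : ℝ → ∀ x : M, TangentSpace 𝓘(ℝ, Euc n) x)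
    (hut : ∀ t ∈ timeInterval a b,
      HasLpDerivWithinAt (q + 1) (weightedVolume n φ) u (ut t) (timeInterval a b) t)
    (hut_cont : LpContinuousOn (q + 1) (weightedVolume n φ) ut (timeInterval a b))
    (hvt : q < 1 → ∀ t ∈ timeInterval a b, ∃ w : M → ℝ,
      HasLpDerivWithinAt ((q + 1) / q) (weightedVolume n φ) (fun s x ↦ spow (u s x) q) w
        (timeInterval a b) t)
    (hu : ∀ t ∈ timeInterval a b, MemSobolevZero n (q + 1) φ (u t))
    (hutW : ∀ t ∈ timeInterval a b, MemSobolevZero n (q + 1) φ (ut t))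
    (hV : ∀ t ∈ timeInterval a b, IsWeakGradient (fun x ↦ spow (u t x) q) (V t))
    (hVp : ∀ t ∈ timeInterval a b,
      MemLp (fun x ↦ ‖V t x‖) (ENNReal.ofReal p) (weightedVolume n φ))
    -- the differential inequality for `∂ₜu - L u^q`
    (hE : ∀ t ∈ timeInterval a b, ∃ f : M → ℝ, IsWeakPLaplacian p φ (V t) f ∧
      ∀ᵐ x ∂(weightedVolume n φ),
        |ut t x - f x| ≤ errorBound p q (C t) |u t x| ‖V t x‖) :
    ∀ t ∈ timeInterval a b, 0 < energyI n q φ (u t) →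
      (DifferentiableWithinAt ℝ (fun s ↦ Real.log (energyI n q φ (u s)))
          (timeInterval a b) t ∧
        (q + 1 + C t) * frequency p q φ (u t) (V t) - (2 * q + 3 / 2) * C t ≤
          derivWithin (fun s ↦ Real.log (energyI n q φ (u s))) (timeInterval a b) t) ∧
      (DifferentiableWithinAt ℝ (fun s ↦ frequency p q φ (u s) (V s))
          (timeInterval a b) t ∧
        p * q / (q + 1) * C t ^ 2 * (frequency p q φ (u t) (V t) - q - 1 / 2) ≤
          derivWithin (fun s ↦ frequency p q φ (u s) (V s)) (timeInterval a b) t) := by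
  have := isContinuousRiemannianBundle (n := n) (M := M)
  have hφc : Continuous φ := hφ.continuous
  have hloc := isLocallyFiniteMeasure_weightedVolume (n := n) (M := M) hφc
  -- One `p`-Laplacian is selected at each time. No regularity of the selection in time is needed,
  -- since the convexity argument supplies what the differentiation of the energy requires.
  choose! f hf hfE using hE
  have hfm : ∀ t ∈ timeInterval a b, AEStronglyMeasurable (f t) (weightedVolume n φ) :=
    fun t ht ↦ (hf t ht).1.aestronglyMeasurable
  intro t ht hI
  refine frequency_monotonicity_of_integration_by_parts hp hq hδ (uniqueDiffOn_timeInterval hab)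
    hC.continuousOn hC0 hut hut_cont hvt hVp
    (fun s hs s' hs' ↦ (hV s hs).aestronglyMeasurable_inner hφc (hV s' hs')) hfm hfE
    (fun s hs s' hs' ↦ ?_) ht rfl rfl hI
  exact (hf s hs).integral_mul_eq hp hq hδ hφc (hV s hs) (hVp s hs) (hV s' hs') (hVp s' hs')
    (memLp_of_abs_sub_le_errorBound hp hq (hC0 s hs) ((hut s hs).1 s hs) (hut s hs).2.1
      (hfm s hs) (hVp s hs) (fun x ↦ norm_nonneg _) (hfE s hs))
    (memLp_spow hq ((hut s' hs').1 s' hs'))
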